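/- Let $\gamma>0$ and $t\in\mathbb R$ with $|t|<\gamma$, and put $\zeta=t/\gamma\in(-1,1)$. Among all probability measures $\nu$ on $\mathbb R$ with $\nu\big((a,b)\big)\le \frac{b-a}{2\gamma}$ for all $a<b$, the functional $$H(\nu)=\iint_{x\ne y}\log\frac1{|x-y|}\,d\nu(x)\,d\nu(y)+\int_{\mathbb R}(|x|-\zeta x)\,d\nu(x)\in(-\infty,+\infty]$$ (taken to be $+\infty$ when one of the integrals does not converge) has a unique minimizer $\nu_0$, the equilibrium measure. It has a continuous density $\rho\ge 0$ with respect to Lebesgue measure, and there are real numbers $\alpha<\alpha'<0<\beta'<\beta$ such that the support of $\nu_0$ is $[\alpha,\beta]$, the saturated region $\{x:\rho(x)=\frac1{2\gamma}\}$ is $[\alpha',\beta']$, $0<\rho(x)<\frac1{2\gamma}$ on $(\alpha,\alpha')\cup(\beta',\beta)$, $\rho=0$ outside $[\alpha,\beta]$, and $$\rho(x)=\begin{cases}\displaystyle\frac1\pi\int_\alpha^x\frac{dx'}{\sqrt{(x'-\alpha)(\alpha'-x')(\beta'-x')(\beta-x')}},&\alpha\le x\le\alpha',\\[2ex]\displaystyle\frac1{2\gamma},&\alpha'\le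 x\le\beta',\\[1ex]\displaystyle\frac1\pi\int_x^\beta\frac{dx'}{\sqrt{(x'-\alpha)(x'-\alpha')(x'-\beta')(\beta-x')}},&\beta'\le x\le\beta.\end{cases}$$ Moreover $$\int_0^\beta\rho(x)\,dx=\frac{1+\zeta}2 .$$ Finally, the resolvent $\omega(z)=\int_{\mathbb R}\frac{\rho(x)\,dx}{z-x}$, $z\in\mathbb C\setminus[\alpha,\beta]$, is given by $$\omega(z)=\int_z^\infty\frac{dz'}{\sqrt{R(z')}},\qquad R(z)=(z-\alpha)(z-\alpha')(z-\beta')(z-\beta),$$ where $\sqrt{R}$ is the branch that is analytic on $\mathbb C\setminus([\alpha,\alpha']\cup[\beta',\beta])$ and positive on $(\beta,\infty)$, and the (improper) integral is taken along any continuously differentiable path from $z$ to $\infty$ in $\mathbb C\setminus[\alpha,\beta]$. -/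

import Mathlib

open MeasureTheory Set Filter Topology

noncomputable section

/-- Probability measures on the line whose mass on every interval `(a, b)` is at most
`(b - a) / (2γ)`. -/
def admissibleMeasures (γ : ℝ) : Set (Measure ℝ) :=
  {ν | IsProbabilityMeasure ν ∧
    ∀ a b : ℝ, a < b → ν (Ioo a b) ≤ ENNReal.ofReal ((b - a) / (2 * γ))}

open Classical in
/-- The functional
`H(ν) = ∬_{x ≠ y} log (1 / |x - y|) dν(x) dν(y) + ∫ (|x| - ζ x) dν(x)`,
with values in `(-∞, +∞]`.  It is `+∞` when one of the two integrals does not converge: for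
`|ζ| < 1`, if the integral of `|x| - ζ x` converges, the logarithmic one can only diverge
to `+∞`; if it diverges, the external term, growing linearly, dominates the logarithm. -/
def energy (ζ : ℝ) (ν : Measure ℝ) : EReal :=
  if Integrable (fun x : ℝ => |x| - ζ * x) ν ∧
      IntegrableOn (fun p : ℝ × ℝ => Real.log (1 / |p.1 - p.2|)) {p | p.1 ≠ p.2} (ν.prod ν) then
    (((∫ p in {p : ℝ × ℝ | p.1 ≠ p.2}, Real.log (1 / |p.1 - p.2|) ∂(ν.prod ν)) +
      ∫ x, (|x| - ζ * x) ∂ν : ℝ) : EReal)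
  else ⊤

/-- `ν` minimizes `H` among all admissible measures. -/
def IsEquilibriumMeasure (γ ζ : ℝ) (ν : Measure ℝ) : Prop :=
  ν ∈ admissibleMeasures γ ∧ IsMinOn (energy ζ) (admissibleMeasures γ) ν

/-- The resolvent `∫ dν(x) / (z - x)`. -/
def measureResolvent (ν : Measure ℝ) (z : ℂ) : ℂ :=
  ∫ x : ℝ, 1 / (z - (x : ℂ)) ∂ν

/-- The real interval `[a, b]` as a subset of the complex plane. -/
def realSegment (a b : ℝ) : Set ℂ :=
  (fun x : ℝ => (x : ℂ)) '' Icc a b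

/-- `s` is the sheet of the square root of `R(z) = (z - α)(z - α')(z - β')(z - β)` with cuts on
`[α, α']` and `[β', β]` for which `s > 0` on `(β, ∞)`.  This determines `s` off the cuts. -/
structure IsSqrtSheet (α α' β' β : ℝ) (s : ℂ → ℂ) : Prop where
  analytic : DifferentiableOn ℂ s (realSegment α α' ∪ realSegment β' β)ᶜ
  sq_eq : ∀ z ∈ (realSegment α α' ∪ realSegment β' β)ᶜ,
    s z ^ 2 = (z - α) * (z - α') * (z - β') * (z - β)
  pos : ∀ x : ℝ, β < x → ∃ r : ℝ, 0 < r ∧ s (x : ℂ) = (r : ℂ)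

/-- `c : [0, ∞) → U` is a continuously differentiable path in `U` from `z` to infinity. -/
structure IsPathToInfinity (U : Set ℂ) (z : ℂ) (c : ℝ → ℂ) : Prop where
  contDiffOn : ContDiffOn ℝ 1 c (Ici 0)
  start : c 0 = z
  mem : ∀ s : ℝ, 0 ≤ s → c s ∈ U
  tendsto : Tendsto (fun s => ‖c s‖) atTop atTop

/-- `∫_z^∞ f(z') dz' = w`: there are paths from `z` to infinity inside `U`, and the (improper)
integral of `f` along each of them converges to `w`. -/
def IntegralToInfinityEq (U : Set ℂ) (f : ℂ → ℂ) (z w : ℂ) : Prop :=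
  (∃ c : ℝ → ℂ, IsPathToInfinity U z c) ∧
  ∀ c : ℝ → ℂ, IsPathToInfinity U z c →
    Tendsto (fun T : ℝ => ∫ s in (0 : ℝ)..T, f (c s) * deriv c s) atTop (𝓝 w)

end

open MeasureTheory Set Filter Topology

noncomputable section

/-! ### The square root of `(z - a) (z - b)` cut along `[a, b]` -/

/-! The minimizer is written down explicitly, shown to satisfy the Euler–Lagrange conditions, and
then singled out by positive definiteness of the logarithmic energy on neutral densities.

The candidate `bandDensity` averages the uniform laws on `[p, q]`, where `p` and `q` are independent
with arcsine laws on `[α, α']` and `[β', β]`. The Stieltjes transform of one uniform law has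
derivative `-1 / ((z - p) (z - q))`. By independence the average factors into two arcsine
transforms, so the resolvent has derivative `-1 / √R` (`hasDerivAt_stieltjes_bandDensity`). As the
resolvent vanishes at infinity, its integral formula follows. Integrating out one random end point
gives the formulas for the density, and the plateau height is the mean of `1 / (q - p)`.

As `Im z` tends to `0`, the real part of the resolvent tends to `bandForce x`, the integral of the
real boundary values of `1 / √R` over `(x, ∞)`. It is minus the derivative of the logarithmic
potential (`logPotential_bandDensity_sub`), it is constant on each band, and it increases across the
gap. If the tail integrals of `1 / √|R|` are `(1 ∓ ζ) / 2`, the effective potential `2U + |x| - ζ x`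
is constant on each band; the balance equation makes the two constants agree. These equations and
the height condition form `IsMatched`. The effective potential is then nonincreasing on the negative
axis and nondecreasing on the positive one, which gives the sign conditions in the gap and outside
the support (`IsMatched.euler_lagrange`).

The four equations are solved in `exists_isMatched`. A Möbius map carries the branch points to `±1,
±κ`. The height fixes `κ` through a ratio of elliptic periods, the tails fix the preimage of
infinity and the scale, and a translation gives the balance.

For optimality, an admissible measure has a density bounded by `1 / (2γ)`, and the energy difference
is the logarithmic energy of the neutral difference plus an integral that is nonnegative by
Euler–Lagrange. The first term is an integral of squared masses of windows (`logEnergy_eq`): it is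
nonnegative, and zero only when every interval gets the same mass from both densities. The mass to
the right of `0` comes from stationarity of the energy under translations, which do not change its
logarithmic part. -/

/-- The principal square root of `(z - a) / (z - b)`. -/
def sqrtRatio (a b : ℝ) (z : ℂ) : ℂ := Complex.exp (Complex.log ((z - a) / (z - b)) / 2)

/-- The square root of `(z - a) (z - b)` that is cut along `[a, b]` and asymptotic to `z`. -/
def bandSqrt (a b : ℝ) (z : ℂ) : ℂ := (z - b) * sqrtRatio a b z

lemma sub_ne_zero_of_notMem_realSegment {a b : ℝ} {z : ℂ} (hz : z ∉ realSegment a b) {x : ℝ}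
    (hx : x ∈ Icc a b) : z - x ≠ 0 := by
  intro h
  exact hz ⟨x, hx, (sub_eq_zero.1 h).symm⟩

lemma ofReal_notMem_realSegment {a b x : ℝ} (hx : x ∉ Icc a b) : (x : ℂ) ∉ realSegment a b := by
  rintro ⟨y, hy, h⟩
  have : y = x := Complex.ofReal_injective h
  exact hx (this ▸ hy)

lemma notMem_realSegment_of_im_ne_zero {a b : ℝ} {z : ℂ} (hz : z.im ≠ 0) :
    z ∉ realSegment a b := by
  rintro ⟨y, _, rfl⟩
  simp at hz

lemma isClosed_realSegment (a b : ℝ) : IsClosed (realSegment a b) :=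
  (isCompact_Icc.image Complex.continuous_ofReal).isClosed

lemma realSegment_mono {a b c d : ℝ} (h₁ : c ≤ a) (h₂ : b ≤ d) :
    realSegment a b ⊆ realSegment c d :=
  image_mono (Icc_subset_Icc h₁ h₂)

/-- Solving `(z - a) / (z - b) = t` for real `t ≤ 0` gives `z = (a - t b) / (1 - t)`, a point of the
segment. Hence the principal logarithm of the ratio is analytic off `[a, b]`, and the only cut of
`bandSqrt` is the band. -/
lemma ratio_mem_slitPlane {a b : ℝ} (hab : a < b) {z : ℂ} (hz : z ∉ realSegment a b) :
    (z - a) / (z - b) ∈ Complex.slitPlane := by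
  have hb : z - b ≠ 0 := sub_ne_zero_of_notMem_realSegment hz (right_mem_Icc.2 hab.le)
  rw [Complex.mem_slitPlane_iff_not_le_zero]
  intro h
  obtain ⟨h1, h2⟩ := Complex.le_def.1 h
  set t : ℝ := ((z - a) / (z - b)).re with ht
  have hw : (z - a) / (z - b) = (t : ℂ) := by
    apply Complex.ext
    · simp [ht]
    · simpa using h2
  have ht0 : t ≤ 0 := by simpa using h1
  rw [div_eq_iff hb] at hw
  apply hz
  have h1t : (0 : ℝ) < 1 - t := by linarith
  refine ⟨(a - t * b) / (1 - t), ⟨?_, ?_⟩, ?_⟩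
  · rw [le_div_iff₀ h1t]; nlinarith
  · rw [div_le_iff₀ h1t]; nlinarith
  · have h1t' : (1 : ℂ) - t ≠ 0 := by
      exact_mod_cast h1t.ne'
    simp only
    push_cast
    rw [div_eq_iff h1t']
    linear_combination -hw

lemma sqrtRatio_sq {a b : ℝ} (hab : a < b) {z : ℂ} (hz : z ∉ realSegment a b) :
    sqrtRatio a b z ^ 2 = (z - a) / (z - b) := by
  rw [sqrtRatio, ← Complex.exp_nat_mul]
  push_cast
  rw [mul_div_cancel₀ _ (two_ne_zero),
    Complex.exp_log (Complex.slitPlane_ne_zero (ratio_mem_slitPlane hab hz))]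

/-- The ratio has argument strictly inside `(-π, π)`, and halving it leads to the right half-plane.
This picks the root inside the unit disc in `integral_arcsineMeasure_inv`. -/
lemma sqrtRatio_re_pos {a b : ℝ} (hab : a < b) {z : ℂ} (hz : z ∉ realSegment a b) :
    0 < (sqrtRatio a b z).re := by
  have h := ratio_mem_slitPlane hab hz
  have h1 := Complex.mem_slitPlane_iff_arg.1 h
  have h2 := Complex.neg_pi_lt_arg ((z - a) / (z - b))
  have h3 := Complex.arg_le_pi ((z - a) / (z - b))
  have h4 := lt_of_le_of_ne h3 h1.1
  rw [sqrtRatio, Complex.exp_re]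
  have him : (Complex.log ((z - a) / (z - b)) / 2).im = ((z - a) / (z - b)).arg / 2 := by
    rw [← Complex.log_im]; simp
  rw [him]
  exact mul_pos (Real.exp_pos _) (Real.cos_pos_of_mem_Ioo ⟨by linarith, by linarith⟩)

lemma bandSqrt_sq {a b : ℝ} (hab : a < b) {z : ℂ} (hz : z ∉ realSegment a b) :
    bandSqrt a b z ^ 2 = (z - a) * (z - b) := by
  have hb : z - b ≠ 0 := sub_ne_zero_of_notMem_realSegment hz (right_mem_Icc.2 hab.le)
  rw [bandSqrt, mul_pow, sqrtRatio_sq hab hz]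
  field_simp

lemma bandSqrt_ne_zero {a b : ℝ} (hab : a < b) {z : ℂ} (hz : z ∉ realSegment a b) :
    bandSqrt a b z ≠ 0 :=
  mul_ne_zero (sub_ne_zero_of_notMem_realSegment hz (right_mem_Icc.2 hab.le))
    (Complex.exp_ne_zero _)

lemma differentiableAt_bandSqrt {a b : ℝ} (hab : a < b) {z : ℂ} (hz : z ∉ realSegment a b) :
    DifferentiableAt ℂ (bandSqrt a b) z := by
  have hb : z - b ≠ 0 := sub_ne_zero_of_notMem_realSegment hz (right_mem_Icc.2 hab.le)
  have h1 : DifferentiableAt ℂ (fun z : ℂ => (z - a) / (z - b)) z :=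
    (differentiableAt_id.sub_const _).div (differentiableAt_id.sub_const _) hb
  exact (differentiableAt_id.sub_const _).mul
    (((h1.clog (ratio_mem_slitPlane hab hz)).div_const 2).cexp)

lemma sqrtRatio_ofReal {a b x : ℝ} (hx : 0 < (x - a) / (x - b)) :
    sqrtRatio a b x = (Real.exp (Real.log ((x - a) / (x - b)) / 2) : ℝ) := by
  rw [sqrtRatio]
  push_cast
  rw [Complex.ofReal_log hx.le]
  push_cast
  rfl

lemma bandSqrt_ofReal_of_gt {a b x : ℝ} (hab : a < b) (hx : b < x) :
    bandSqrt a b x = (Real.sqrt ((x - a) * (x - b)) : ℝ) := by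
  have h1 : 0 < x - b := by linarith
  have h2 : 0 < x - a := by linarith
  have h3 : 0 < (x - a) / (x - b) := div_pos h2 h1
  rw [bandSqrt, sqrtRatio_ofReal h3, ← Complex.ofReal_sub, ← Complex.ofReal_mul]
  congr 1
  symm
  rw [Real.sqrt_eq_iff_mul_self_eq (by positivity) (by positivity), Real.exp_half,
    Real.exp_log h3]
  have := Real.mul_self_sqrt h3.le
  rw [mul_mul_mul_comm, this]
  field_simp

/-- The factor `x - b` is negative while the root of the ratio stays positive. This sign makes `√R`
negative in the gap, where only one of its two factors is of this kind, and positive to the left of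
both bands. -/
lemma bandSqrt_ofReal_of_lt {a b x : ℝ} (hab : a < b) (hx : x < a) :
    bandSqrt a b x = -(Real.sqrt ((a - x) * (b - x)) : ℝ) := by
  have h1 : 0 < b - x := by linarith
  have h2 : 0 < a - x := by linarith
  have h3 : 0 < (x - a) / (x - b) := div_pos_of_neg_of_neg (by linarith) (by linarith)
  rw [bandSqrt, sqrtRatio_ofReal h3, ← Complex.ofReal_sub, ← Complex.ofReal_mul,
    ← Complex.ofReal_neg]
  congr 1
  rw [← neg_eq_iff_eq_neg]
  symm
  have h4 : 0 ≤ -((x - b) * Real.exp (Real.log ((x - a) / (x - b)) / 2)) := by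
    have := Real.exp_pos (Real.log ((x - a) / (x - b)) / 2)
    nlinarith
  rw [Real.sqrt_eq_iff_mul_self_eq (by positivity) h4, Real.exp_half, Real.exp_log h3]
  have := Real.mul_self_sqrt h3.le
  have h5 : x - b ≠ 0 := by linarith
  rw [neg_mul_neg, mul_mul_mul_comm, this]
  field_simp
  ring

/-! ### The arcsine law -/

/-- The arcsine law on `[a, b]`. -/
def arcsineMeasure (a b : ℝ) : Measure ℝ :=
  (volume.restrict (Ioo a b)).withDensity
    (fun y => ENNReal.ofReal (1 / (Real.pi * Real.sqrt ((y - a) * (b - y)))))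

lemma measurable_arcsine_density (a b : ℝ) :
    Measurable (fun y : ℝ => 1 / (Real.pi * Real.sqrt ((y - a) * (b - y)))) := by
  fun_prop

lemma arcsine_density_nonneg (a b y : ℝ) : 0 ≤ 1 / (Real.pi * Real.sqrt ((y - a) * (b - y))) := by
  positivity

lemma integral_arcsineMeasure {E : Type*} [NormedAddCommGroup E] [NormedSpace ℝ E] (a b : ℝ)
    (f : ℝ → E) :
    ∫ y, f y ∂(arcsineMeasure a b)
      = ∫ y in Ioo a b, (1 / (Real.pi * Real.sqrt ((y - a) * (b - y)))) • f y := by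
  rw [arcsineMeasure, integral_withDensity_eq_integral_toReal_smul]
  · refine integral_congr_ae (Eventually.of_forall fun y => ?_)
    simp only [ENNReal.toReal_ofReal (arcsine_density_nonneg a b y)]
  · exact (measurable_arcsine_density a b).ennreal_ofReal
  · exact Eventually.of_forall fun y => ENNReal.ofReal_lt_top

lemma cos_param_image {a b : ℝ} (hab : a < b) :
    (fun θ => (a + b) / 2 - (b - a) / 2 * Real.cos θ) '' Ioo 0 Real.pi = Ioo a b := by
  ext y
  constructor
  · rintro ⟨θ, hθ, rfl⟩
    have h1 : Real.cos θ < 1 := by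
      rw [← Real.cos_zero]
      exact Real.cos_lt_cos_of_nonneg_of_le_pi le_rfl hθ.2.le hθ.1
    have h2 : -1 < Real.cos θ := by
      rw [← Real.cos_pi]
      exact Real.cos_lt_cos_of_nonneg_of_le_pi hθ.1.le le_rfl hθ.2
    constructor <;> simp only <;> nlinarith
  · rintro ⟨h1, h2⟩
    have hba : 0 < b - a := by linarith
    refine ⟨Real.arccos ((a + b - 2 * y) / (b - a)), ⟨?_, ?_⟩, ?_⟩
    · rw [Real.arccos_pos, div_lt_one hba]; linarith
    · rw [Real.arccos_lt_pi, lt_div_iff₀ hba]; linarith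
    · simp only
      rw [Real.cos_arccos]
      · field_simp; ring
      · rw [le_div_iff₀ hba]; linarith
      · rw [div_le_one hba]; linarith

/-- The arcsine law is the image of the uniform law on `(0, π)`. -/
lemma integral_arcsineMeasure_eq_integral_cos {E : Type*} [NormedAddCommGroup E]
    [NormedSpace ℝ E] {a b : ℝ} (hab : a < b) (f : ℝ → E) :
    ∫ y, f y ∂(arcsineMeasure a b)
      = (1 / Real.pi) • ∫ θ in Ioo 0 Real.pi, f ((a + b) / 2 - (b - a) / 2 * Real.cos θ) := by
  have hba : 0 < b - a := by linarith
  rw [integral_arcsineMeasure, ← cos_param_image hab,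
    integral_image_eq_integral_abs_deriv_smul (f' := fun θ => (b - a) / 2 * Real.sin θ)
      measurableSet_Ioo, ← integral_smul]
  · refine setIntegral_congr_fun measurableSet_Ioo fun θ hθ => ?_
    have hs : 0 < Real.sin θ := Real.sin_pos_of_mem_Ioo hθ
    have h1 : ((a + b) / 2 - (b - a) / 2 * Real.cos θ - a)
        * (b - ((a + b) / 2 - (b - a) / 2 * Real.cos θ)) = ((b - a) / 2 * Real.sin θ) ^ 2 := by
      linear_combination (-((b - a) / 2) ^ 2) * (Real.sin_sq_add_cos_sq θ)
    rw [h1, Real.sqrt_sq (by positivity), abs_of_pos (by positivity), smul_smul]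
    congr 1
    have := Real.pi_pos
    field_simp
  · intro θ _
    have := ((Real.hasDerivAt_cos θ).const_mul ((b - a) / 2)).const_sub ((a + b) / 2)
    refine HasDerivAt.hasDerivWithinAt ?_
    convert this using 1
    ring
  · intro θ hθ φ hφ h
    have : Real.cos θ = Real.cos φ := by
      have h' : (b - a) / 2 ≠ 0 := by positivity
      apply mul_left_cancel₀ h'
      linarith [h]
    exact Real.injOn_cos (Ioo_subset_Icc_self hθ) (Ioo_subset_Icc_self hφ) this

lemma integral_one_arcsineMeasure {a b : ℝ} (hab : a < b) :
    ∫ _, (1 : ℝ) ∂(arcsineMeasure a b) = 1 := by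
  rw [integral_arcsineMeasure_eq_integral_cos hab]
  simp [Real.pi_pos.le, Real.pi_pos.ne']

lemma isProbabilityMeasure_arcsineMeasure {a b : ℝ} (hab : a < b) :
    IsProbabilityMeasure (arcsineMeasure a b) := by
  constructor
  have h := integral_one_arcsineMeasure hab
  rw [integral_const, smul_eq_mul, mul_one, Measure.real] at h
  rwa [ENNReal.toReal_eq_one_iff] at h

/-- The integral of a non-integrable function is `0` by convention, so the total mass `1` already
forces integrability. The same device serves `integrable_bandDensity` and
`IsAdmissibleDensity.integrable`. -/
lemma integrableOn_arcsine_density {a b : ℝ} (hab : a < b) :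
    IntegrableOn (fun y : ℝ => 1 / (Real.pi * Real.sqrt ((y - a) * (b - y)))) (Ioo a b) := by
  have h := integral_one_arcsineMeasure hab
  rw [integral_arcsineMeasure] at h
  simp only [smul_eq_mul, mul_one] at h
  by_contra h'
  rw [integral_undef h'] at h
  exact zero_ne_one h

lemma ae_arcsineMeasure_mem (a b : ℝ) : ∀ᵐ y ∂(arcsineMeasure a b), y ∈ Ioo a b :=
  (withDensity_absolutelyContinuous _ _).ae_le (ae_restrict_mem measurableSet_Ioo)

instance noAtoms_arcsineMeasure (a b : ℝ) : NullSingletonClass (arcsineMeasure a b) where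
  measure_singleton x :=
    withDensity_absolutelyContinuous _ _ (measure_singleton x)

/-- Cauchy's formula: the first factor has its pole inside the disc, and the second is holomorphic
on the closed disc because `‖η w‖ < 1` there. -/
lemma circleIntegral_inv_mul_inv {η : ℂ} (hη : ‖η‖ < 1) :
    (∮ w in C(0, 1), (w - η)⁻¹ * (1 - η * w)⁻¹) = 2 * Real.pi * Complex.I * (1 - η ^ 2)⁻¹ := by
  have hne : ∀ w ∈ Metric.closedBall (0 : ℂ) 1, 1 - η * w ≠ 0 := by
    intro w hw h
    have hw' : ‖w‖ ≤ 1 := by simpa using hw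
    have h1 : ‖η * w‖ < 1 := by
      rw [norm_mul]
      nlinarith [norm_nonneg η, norm_nonneg w]
    rw [← sub_eq_zero.1 h] at h1
    simp at h1
  have hd : DifferentiableOn ℂ (fun w => (1 - η * w)⁻¹) (Metric.closedBall 0 1) := by
    intro w hw
    have : DifferentiableAt ℂ (fun w => (1 - η * w)) w := by fun_prop
    exact (this.inv (hne w hw)).differentiableWithinAt
  have := hd.circleIntegral_sub_inv_smul (w := η) (by simpa using hη)
  simp only [smul_eq_mul] at this
  rw [this]
  ring

/-- The Stieltjes transform of the arcsine law. -/
lemma integral_arcsineMeasure_inv {a b : ℝ} (hab : a < b) {z : ℂ} (hz : z ∉ realSegment a b) :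
    ∫ y, 1 / (z - (y : ℂ)) ∂(arcsineMeasure a b) = 1 / bandSqrt a b z := by
  set q := sqrtRatio a b z with hq
  have hqre : 0 < q.re := sqrtRatio_re_pos hab hz
  have hb : z - b ≠ 0 := sub_ne_zero_of_notMem_realSegment hz (right_mem_Icc.2 hab.le)
  have hqsq : q ^ 2 * (z - b) = z - a := by
    rw [hq, sqrtRatio_sq hab hz, div_mul_cancel₀ _ hb]
  have hq0 : q ≠ 0 := Complex.exp_ne_zero _
  have hq1 : 1 + q ≠ 0 := by
    intro h
    have := congrArg Complex.re h
    simp at this; linarith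
  have hbaC : (b : ℂ) - a ≠ 0 := by
    rw [sub_ne_zero]; exact_mod_cast hab.ne'
  -- With `y` on the cosine parametrization and `w = e^{iθ}`, `z - y` becomes a multiple of `(w - η)
  -- (1 - η w) / w`: `η` is the Joukowski coordinate of `z` inside the unit disc. `Re q > 0` gives
  -- `‖η‖ < 1`, and `hw` is the relation `q² (z - b) = z - a` rewritten in `η`.
  set η := (1 - q) / (1 + q) with hηdef
  have hη : ‖η‖ < 1 := by
    rw [hηdef, norm_div, div_lt_one (norm_pos_iff.2 hq1)]
    rw [← sq_lt_sq₀ (norm_nonneg _) (norm_nonneg _), Complex.sq_norm, Complex.sq_norm,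
      Complex.normSq_apply, Complex.normSq_apply]
    simp
    nlinarith
  have hη2 : (1 - η ^ 2)⁻¹ = (1 + q) ^ 2 / (4 * q) := by
    have : 1 - η ^ 2 = 4 * q / (1 + q) ^ 2 := by
      rw [hηdef]; field_simp; ring
    rw [this, inv_div]
  have hw : -2 * η * (z - (a + b) / 2) = (b - a) / 2 * (η ^ 2 + 1) := by
    rw [hηdef]
    field_simp
    linear_combination (4 : ℂ) * hqsq
  have hInt : ∀ θ : ℝ, 1 / (z - (((a + b) / 2 - (b - a) / 2 * Real.cos θ : ℝ) : ℂ))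
      = (-4 * η / ((b - a) * Complex.I)) * (deriv (circleMap 0 1) θ •
        ((circleMap 0 1 θ - η)⁻¹ * (1 - η * circleMap 0 1 θ)⁻¹)) := by
    intro θ
    have hc : circleMap 0 1 θ = Complex.exp (θ * Complex.I) := by simp [circleMap]
    rw [deriv_circleMap, hc]
    set w := Complex.exp (θ * Complex.I) with hwdef
    have hw0 : w ≠ 0 := Complex.exp_ne_zero _
    have hcos : (Real.cos θ : ℂ) = (w + w⁻¹) / 2 := by
      rw [Complex.ofReal_cos, Complex.cos, hwdef, ← Complex.exp_neg]
      ring_nf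
    have hwn : ‖w‖ = 1 := Complex.norm_exp_ofReal_mul_I θ
    have h1 : w - η ≠ 0 := by
      intro h
      rw [← sub_eq_zero.1 h] at hη
      linarith
    have h2 : 1 - η * w ≠ 0 := by
      intro h
      have h3 : ‖η * w‖ = 1 := by rw [← sub_eq_zero.1 h]; simp
      rw [norm_mul, hwn, mul_one] at h3
      linarith
    have h4 : -2 * η * (z - (((a + b) / 2 - (b - a) / 2 * Real.cos θ : ℝ) : ℂ)) * w
        = (b - a) / 2 * ((w - η) * (1 - η * w)) := by
      push_cast
      rw [← Complex.ofReal_cos, hcos]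
      have : w * w⁻¹ = 1 := mul_inv_cancel₀ hw0
      linear_combination w * hw - η * (b - a) / 2 * this
    have h5 : z - (((a + b) / 2 - (b - a) / 2 * Real.cos θ : ℝ) : ℂ) ≠ 0 := by
      intro h
      rw [h] at h4
      have : ((b : ℂ) - a) / 2 * ((w - η) * (1 - η * w)) ≠ 0 :=
        mul_ne_zero (div_ne_zero hbaC two_ne_zero) (mul_ne_zero h1 h2)
      apply this
      rw [← h4]; ring
    have hI := Complex.I_ne_zero
    generalize z - (((a + b) / 2 - (b - a) / 2 * Real.cos θ : ℝ) : ℂ) = v at h4 h5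
    clear_value η w
    rw [smul_eq_mul, div_eq_iff h5]
    field_simp
    linear_combination -2 * h4
  -- The cosine is symmetric about `π`, so the half circle contributes half of the full one, to
  -- which Cauchy's formula applies.
  have hper : ∫ θ in (0 : ℝ)..Real.pi,
        1 / (z - (((a + b) / 2 - (b - a) / 2 * Real.cos θ : ℝ) : ℂ))
      = (1 / 2) * ∫ θ in (0 : ℝ)..(2 * Real.pi),
        1 / (z - (((a + b) / 2 - (b - a) / 2 * Real.cos θ : ℝ) : ℂ)) := by
    have hcont : Continuous fun θ : ℝ =>
        1 / (z - (((a + b) / 2 - (b - a) / 2 * Real.cos θ : ℝ) : ℂ)) := by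
      refine continuous_const.div (by fun_prop) fun θ => ?_
      refine sub_ne_zero_of_notMem_realSegment hz ⟨?_, ?_⟩
      · nlinarith [Real.cos_le_one θ]
      · nlinarith [Real.neg_one_le_cos θ]
    have h2 := intervalIntegral.integral_comp_sub_left (a := Real.pi) (b := 2 * Real.pi)
      (fun θ : ℝ => 1 / (z - (((a + b) / 2 - (b - a) / 2 * Real.cos θ : ℝ) : ℂ))) (2 * Real.pi)
    simp only [Real.cos_two_pi_sub, sub_self] at h2
    rw [show 2 * Real.pi - Real.pi = Real.pi by ring] at h2
    rw [← intervalIntegral.integral_add_adjacent_intervals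
      (hcont.intervalIntegrable 0 Real.pi) (hcont.intervalIntegrable Real.pi (2 * Real.pi)), h2]
    ring
  rw [integral_arcsineMeasure_eq_integral_cos hab, ← integral_Ioc_eq_integral_Ioo,
    ← intervalIntegral.integral_of_le Real.pi_pos.le, hper]
  simp_rw [hInt]
  rw [intervalIntegral.integral_const_mul]
  have hcirc := circleIntegral_inv_mul_inv hη
  rw [circleIntegral] at hcirc
  rw [hcirc, hη2, bandSqrt, ← hq, hηdef]
  have hpi : (Real.pi : ℂ) ≠ 0 := by exact_mod_cast Real.pi_pos.ne'
  have hI := Complex.I_ne_zero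
  rw [Complex.real_smul]
  push_cast
  field_simp
  linear_combination hqsq

lemma integral_arcsineMeasure_inv_of_gt {a b x : ℝ} (hab : a < b) (hx : b < x) :
    ∫ y, 1 / (x - y) ∂(arcsineMeasure a b) = 1 / Real.sqrt ((x - a) * (x - b)) := by
  have h := integral_arcsineMeasure_inv hab
    (ofReal_notMem_realSegment (x := x) fun h => hx.not_ge h.2)
  rw [bandSqrt_ofReal_of_gt hab hx] at h
  apply Complex.ofReal_injective
  rw [← integral_complex_ofReal]
  push_cast
  exact h

lemma integral_arcsineMeasure_inv_of_lt {a b x : ℝ} (hab : a < b) (hx : x < a) :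
    ∫ y, 1 / (y - x) ∂(arcsineMeasure a b) = 1 / Real.sqrt ((a - x) * (b - x)) := by
  have h := integral_arcsineMeasure_inv hab
    (ofReal_notMem_realSegment (x := x) fun h => hx.not_ge h.1)
  rw [bandSqrt_ofReal_of_lt hab hx, ← neg_inj, ← integral_neg] at h
  apply Complex.ofReal_injective
  rw [← integral_complex_ofReal]
  push_cast
  calc _ = ∫ y, -(1 / ((x : ℂ) - (y : ℂ))) ∂(arcsineMeasure a b) := by
        refine integral_congr_ae (Eventually.of_forall fun y => ?_)
        simp only
        rw [← div_neg, neg_sub]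
    _ = _ := by rw [h, div_neg, neg_neg]

/-! ### Mixtures of uniform laws with arcsine endpoints -/

instance sFinite_arcsineMeasure (a b : ℝ) : SFinite (arcsineMeasure a b) := by
  unfold arcsineMeasure; infer_instance

/-- The joint law of two independent arcsine variables on `[α, α']` and `[β', β]`. -/
def bandPair (α α' β' β : ℝ) : Measure (ℝ × ℝ) :=
  (arcsineMeasure α α').prod (arcsineMeasure β' β)

/-- The density at `x` of the uniform law on `[p.1, p.2]`. -/
def uniformDensity (x : ℝ) (p : ℝ × ℝ) : ℝ :=
  if p.1 ≤ x ∧ x < p.2 then 1 / (p.2 - p.1) else 0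

/-- The density of the mixture of uniform laws with independent arcsine endpoints. -/
def bandDensity (α α' β' β x : ℝ) : ℝ := ∫ p, uniformDensity x p ∂(bandPair α α' β' β)

/-- The height of the plateau of `bandDensity`. -/
def bandHeight (α α' β' β : ℝ) : ℝ := ∫ p : ℝ × ℝ, 1 / (p.2 - p.1) ∂(bandPair α α' β' β)

lemma isProbabilityMeasure_bandPair {α α' β' β : ℝ} (h₁ : α < α') (h₃ : β' < β) :
    IsProbabilityMeasure (bandPair α α' β' β) := by
  have := isProbabilityMeasure_arcsineMeasure h₁
  have := isProbabilityMeasure_arcsineMeasure h₃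
  unfold bandPair
  infer_instance

lemma ae_bandPair_mem (α α' β' β : ℝ) :
    ∀ᵐ p ∂(bandPair α α' β' β), p.1 ∈ Ioo α α' ∧ p.2 ∈ Ioo β' β :=
  (Measure.quasiMeasurePreserving_fst.ae (ae_arcsineMeasure_mem α α')).and
    (Measure.quasiMeasurePreserving_snd.ae (ae_arcsineMeasure_mem β' β))

lemma ae_bandPair_ne (α α' β' β x : ℝ) :
    ∀ᵐ p ∂(bandPair α α' β' β), p.1 ≠ x ∧ p.2 ≠ x := by
  have h (a b : ℝ) : ∀ᵐ y ∂(arcsineMeasure a b), y ≠ x :=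
    compl_mem_ae_iff.2 (measure_singleton x)
  exact (Measure.quasiMeasurePreserving_fst.ae (h α α')).and
    (Measure.quasiMeasurePreserving_snd.ae (h β' β))

lemma measurable_uniformDensity : Measurable (Function.uncurry uniformDensity) := by
  unfold uniformDensity Function.uncurry
  refine Measurable.ite ?_ (by fun_prop) measurable_const
  exact (measurableSet_le measurable_snd.fst measurable_fst).inter
    (measurableSet_lt measurable_fst measurable_snd.snd)

lemma measurable_uniformDensity_right (x : ℝ) : Measurable (uniformDensity x) :=
  measurable_uniformDensity.comp measurable_prodMk_left

lemma uniformDensity_nonneg (x : ℝ) (p : ℝ × ℝ) : 0 ≤ uniformDensity x p := by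
  unfold uniformDensity
  split_ifs with h
  · have : 0 < p.2 - p.1 := by linarith [h.1, h.2]
    positivity
  · exact le_rfl

lemma inv_gap_le {α α' β' β : ℝ} (h₂ : α' < β') {p : ℝ × ℝ}
    (hp : p.1 ∈ Ioo α α' ∧ p.2 ∈ Ioo β' β) : 1 / (p.2 - p.1) ≤ 1 / (β' - α') := by
  have h1 := hp.1.2
  have h2 := hp.2.1
  apply one_div_le_one_div_of_le <;> linarith

lemma uniformDensity_le {α α' β' β : ℝ} (h₂ : α' < β') {p : ℝ × ℝ}
    (hp : p.1 ∈ Ioo α α' ∧ p.2 ∈ Ioo β' β) (x : ℝ) :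
    uniformDensity x p ≤ (Icc α β).indicator (fun _ => 1 / (β' - α')) x := by
  have h1 := hp.1.1
  have h2 := hp.2.2
  unfold uniformDensity
  split_ifs with h
  · rw [indicator_of_mem (by constructor <;> linarith [h.1, h.2])]
    exact inv_gap_le h₂ hp
  · apply indicator_nonneg
    intro _ _
    have : 0 < β' - α' := by linarith
    positivity

lemma uniformDensity_le' {α α' β' β : ℝ} (h₂ : α' < β') {p : ℝ × ℝ}
    (hp : p.1 ∈ Ioo α α' ∧ p.2 ∈ Ioo β' β) (x : ℝ) :
    uniformDensity x p ≤ 1 / (p.2 - p.1) := by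
  unfold uniformDensity
  split_ifs with h
  · exact le_rfl
  · have h1 := hp.1.2
    have h2 := hp.2.1
    have : 0 < p.2 - p.1 := by linarith
    positivity

/-- Since `g` is bounded below, the end point singularities are no worse than those of the arcsine
density. This covers both bands, the gap, and the elliptic integrands. -/
lemma integrableOn_inv_sqrt_arcsine_mul {a b c : ℝ} (hab : a < b) (hc : 0 < c) {g : ℝ → ℝ}
    (hg : Measurable g) (hgc : ∀ y ∈ Ioo a b, c ≤ g y) :
    IntegrableOn (fun y => 1 / Real.sqrt ((y - a) * (b - y) * g y)) (Ioo a b) := by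
  have h := (integrableOn_arcsine_density hab).const_mul (Real.pi / Real.sqrt c)
  refine h.mono' (Measurable.aestronglyMeasurable (by fun_prop)) ?_
  filter_upwards [ae_restrict_mem measurableSet_Ioo] with y hy
  have e1 : 0 < y - a := by linarith [hy.1]
  have e2 : 0 < b - y := by linarith [hy.2]
  have e3 := hgc y hy
  rw [Real.norm_of_nonneg (by positivity), Real.sqrt_mul (by positivity)]
  have hpi := Real.pi_pos
  have e8 : 0 < Real.sqrt ((y - a) * (b - y)) := by positivity
  have e9 : Real.pi / Real.sqrt c * (1 / (Real.pi * Real.sqrt ((y - a) * (b - y))))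
      = 1 / (Real.sqrt ((y - a) * (b - y)) * Real.sqrt c) := by
    field_simp
  rw [e9]
  gcongr

lemma integrable_inv_gap {α α' β' β : ℝ} (h₁ : α < α') (h₂ : α' < β') (h₃ : β' < β) :
    Integrable (fun p : ℝ × ℝ => 1 / (p.2 - p.1)) (bandPair α α' β' β) := by
  have := isProbabilityMeasure_bandPair h₁ h₃
  refine Integrable.of_bound (C := 1 / (β' - α')) ?_ ?_
  · exact Measurable.aestronglyMeasurable (by fun_prop)
  · filter_upwards [ae_bandPair_mem α α' β' β] with p hp
    have h1 := hp.1.2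
    have h2 := hp.2.1
    have : 0 < p.2 - p.1 := by linarith
    rw [Real.norm_of_nonneg (by positivity)]
    exact inv_gap_le h₂ hp

lemma integrable_uniformDensity {α α' β' β : ℝ} (h₁ : α < α') (h₂ : α' < β') (h₃ : β' < β)
    (x : ℝ) :
    Integrable (uniformDensity x) (bandPair α α' β' β) := by
  refine (integrable_inv_gap h₁ h₂ h₃).mono'
    (measurable_uniformDensity_right x).aestronglyMeasurable ?_
  filter_upwards [ae_bandPair_mem α α' β' β] with p hp
  rw [Real.norm_of_nonneg (uniformDensity_nonneg x p)]
  exact uniformDensity_le' h₂ hp x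

lemma bandDensity_nonneg (α α' β' β : ℝ) (x : ℝ) : 0 ≤ bandDensity α α' β' β x :=
  integral_nonneg fun p => uniformDensity_nonneg x p

lemma bandDensity_le {α α' β' β : ℝ} (h₁ : α < α') (h₂ : α' < β') (h₃ : β' < β)
    (x : ℝ) : bandDensity α α' β' β x ≤ bandHeight α α' β' β := by
  refine integral_mono_ae (integrable_uniformDensity h₁ h₂ h₃ x) (integrable_inv_gap h₁ h₂ h₃) ?_
  filter_upwards [ae_bandPair_mem α α' β' β] with p hp
  exact uniformDensity_le' h₂ hp x

lemma bandDensity_eq_height {α α' β' β : ℝ} {x : ℝ} (hx : x ∈ Icc α' β') :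
    bandDensity α α' β' β x = bandHeight α α' β' β := by
  refine integral_congr_ae ?_
  filter_upwards [ae_bandPair_mem α α' β' β] with p hp
  rw [uniformDensity, if_pos ⟨hp.1.2.le.trans hx.1, hx.2.trans_lt hp.2.1⟩]

lemma bandDensity_eq_zero {α α' β' β : ℝ} {x : ℝ} (hx : x ∉ Ioo α β) :
    bandDensity α α' β' β x = 0 := by
  rw [bandDensity, ← integral_zero (ℝ × ℝ) ℝ (μ := bandPair α α' β' β)]
  refine integral_congr_ae ?_
  filter_upwards [ae_bandPair_mem α α' β' β] with p hp
  rw [uniformDensity, if_neg]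
  rintro ⟨h, h'⟩
  exact hx ⟨hp.1.1.trans_le h, h'.trans hp.2.2⟩

/-- For fixed `p`, the uniform density is locally constant in `x` away from `p.1` and `p.2`. The
arcsine laws have no atoms, so at each `x` almost every `p` qualifies, and dominated convergence
applies. -/
lemma continuous_bandDensity {α α' β' β : ℝ} (h₁ : α < α') (h₂ : α' < β') (h₃ : β' < β) :
    Continuous (bandDensity α α' β' β) := by
  rw [continuous_iff_continuousAt]
  intro x
  refine continuousAt_of_dominated (bound := fun p => 1 / (p.2 - p.1)) ?_ ?_
    (integrable_inv_gap h₁ h₂ h₃) ?_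
  · exact Eventually.of_forall fun y => (measurable_uniformDensity_right y).aestronglyMeasurable
  · refine Eventually.of_forall fun y => ?_
    filter_upwards [ae_bandPair_mem α α' β' β] with p hp
    rw [Real.norm_of_nonneg (uniformDensity_nonneg y p)]
    exact uniformDensity_le' h₂ hp y
  · filter_upwards [ae_bandPair_mem α α' β' β, ae_bandPair_ne α α' β' β x] with p _ hne
    have hc : ∀ᶠ y in 𝓝 x, uniformDensity y p = uniformDensity x p := by
      have e1 : ∀ᶠ y in 𝓝 x, (p.1 ≤ y ↔ p.1 ≤ x) := by
        rcases lt_or_gt_of_ne hne.1 with h | h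
        · filter_upwards [lt_mem_nhds h] with y hy
          exact iff_of_true hy.le h.le
        · filter_upwards [gt_mem_nhds h] with y hy
          exact iff_of_false hy.not_ge h.not_ge
      have e2 : ∀ᶠ y in 𝓝 x, (y < p.2 ↔ x < p.2) := by
        rcases lt_or_gt_of_ne hne.2 with h | h
        · filter_upwards [lt_mem_nhds h] with y hy
          exact iff_of_false hy.not_gt h.not_gt
        · filter_upwards [gt_mem_nhds h] with y hy
          exact iff_of_true hy h
      filter_upwards [e1, e2] with y hy1 hy2
      simp only [uniformDensity, hy1, hy2]
    exact (continuousAt_const (y := uniformDensity x p)).congr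
      (hc.mono fun y hy => hy.symm)

/-- Integration against `bandDensity` averages the means over the intervals `[p.1, p.2]`. -/
lemma integral_bandDensity_smul {α α' β' β : ℝ} (h₁ : α < α') (h₂ : α' < β') (h₃ : β' < β)
    {E : Type*} [NormedAddCommGroup E] [NormedSpace ℝ E]
    [CompleteSpace E] {F : ℝ → E} (hF : IntegrableOn F (Icc α β)) :
    ∫ x, bandDensity α α' β' β x • F x
      = ∫ p : ℝ × ℝ, (1 / (p.2 - p.1)) • (∫ x in p.1..p.2, F x) ∂(bandPair α α' β' β) := by
  have := isProbabilityMeasure_bandPair h₁ h₃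
  -- `F` is integrable on `[α, β]` only. The density vanishes outside, so `F` may be truncated
  -- before Fubini is used.
  set G : ℝ → E := (Icc α β).indicator F with hG
  have hGi : Integrable G := hF.integrable_indicator measurableSet_Icc
  have hInt : Integrable (Function.uncurry fun (x : ℝ) (p : ℝ × ℝ) => uniformDensity x p • G x)
      ((volume : Measure ℝ).prod (bandPair α α' β' β)) := by
    have hG1 : Integrable (fun q : ℝ × ℝ × ℝ => G q.1)
        ((volume : Measure ℝ).prod (bandPair α α' β' β)) := hGi.comp_fst _
    refine Integrable.bdd_smul (C := 1 / (β' - α')) hG1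
      measurable_uniformDensity.aestronglyMeasurable ?_
    · filter_upwards [Measure.quasiMeasurePreserving_snd.ae (ae_bandPair_mem α α' β' β)] with q hq
      rw [Real.norm_of_nonneg (uniformDensity_nonneg _ _)]
      refine (uniformDensity_le h₂ hq q.1).trans (indicator_le_self' ?_ _)
      intro _ _
      have : 0 < β' - α' := by linarith
      positivity
  calc ∫ x, bandDensity α α' β' β x • F x
      = ∫ x, ∫ p, uniformDensity x p • G x ∂(bandPair α α' β' β) := by
        congr 1
        ext x
        rw [integral_smul_const]
        by_cases hx : x ∈ Icc α β
        · rw [hG, indicator_of_mem hx]; rfl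
        · rw [bandDensity_eq_zero (fun h => hx (Ioo_subset_Icc_self h)), hG,
            indicator_of_notMem hx]
          simp
    _ = ∫ p, (∫ x, uniformDensity x p • G x) ∂(bandPair α α' β' β) := integral_integral_swap hInt
    _ = _ := by
        refine integral_congr_ae ?_
        filter_upwards [ae_bandPair_mem α α' β' β] with p hp
        have h12 : p.1 ≤ p.2 := by linarith [hp.1.2, hp.2.1]
        rw [intervalIntegral.integral_of_le h12, ← integral_Ico_eq_integral_Ioc,
          ← integral_indicator measurableSet_Ico, ← integral_smul]
        congr 1
        ext x
        unfold uniformDensity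
        by_cases hx : p.1 ≤ x ∧ x < p.2
        · rw [if_pos hx, indicator_of_mem (show x ∈ Ico p.1 p.2 from hx), hG, indicator_of_mem]
          exact ⟨hp.1.1.le.trans hx.1, hx.2.le.trans hp.2.2.le⟩
        · rw [if_neg hx, indicator_of_notMem (show x ∉ Ico p.1 p.2 from hx)]
          simp

lemma integral_bandDensity {α α' β' β : ℝ} (h₁ : α < α') (h₂ : α' < β') (h₃ : β' < β) :
    ∫ x, bandDensity α α' β' β x = 1 := by
  have := isProbabilityMeasure_bandPair h₁ h₃
  have h := integral_bandDensity_smul h₁ h₂ h₃ (F := fun _ => (1 : ℝ))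
    (continuousOn_const.integrableOn_Icc)
  simp only [smul_eq_mul, mul_one, intervalIntegral.integral_const] at h
  rw [h]
  have : ∫ p : ℝ × ℝ, 1 / (p.2 - p.1) * (p.2 - p.1) ∂(bandPair α α' β' β)
      = ∫ p : ℝ × ℝ, 1 ∂(bandPair α α' β' β) := by
    refine integral_congr_ae ?_
    filter_upwards [ae_bandPair_mem α α' β' β] with p hp
    have : p.2 - p.1 ≠ 0 := by linarith [hp.1.2, hp.2.1]
    field_simp
  rw [this]
  simp

/-! ### Explicit formulas for the density -/

lemma intervalIntegrable_left_band {α α' β' β : ℝ} (h₁ : α < α') (h₂ : α' < β') (h₃ : β' < β) :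
    IntervalIntegrable (fun y => 1 / Real.sqrt ((y - α) * (α' - y) * (β' - y) * (β - y)))
      volume α α' := by
  rw [intervalIntegrable_iff_integrableOn_Ioo_of_le h₁.le]
  refine (integrableOn_inv_sqrt_arcsine_mul h₁
    (mul_pos (sub_pos.2 h₂) (sub_pos.2 (h₂.trans h₃))) (g := fun y => (β' - y) * (β - y))
    (by fun_prop) fun y hy => ?_).congr_fun (fun y _ => ?_) measurableSet_Ioo
  · have := hy.2
    have e5 : 0 < β' - α' := by linarith
    have e6 : 0 < β - α' := by linarith
    gcongr
    linarith
  · simp only [mul_assoc]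

lemma intervalIntegrable_right_band {α α' β' β : ℝ} (h₁ : α < α') (h₂ : α' < β') (h₃ : β' < β) :
    IntervalIntegrable (fun y => 1 / Real.sqrt ((y - α) * (y - α') * (y - β') * (β - y)))
      volume β' β := by
  rw [intervalIntegrable_iff_integrableOn_Ioo_of_le h₃.le]
  refine (integrableOn_inv_sqrt_arcsine_mul h₃
    (mul_pos (sub_pos.2 (h₁.trans h₂)) (sub_pos.2 h₂)) (g := fun y => (y - α) * (y - α'))
    (by fun_prop) fun y hy => ?_).congr_fun (fun y _ => ?_) measurableSet_Ioo
  · have := hy.1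
    have e5 : 0 < β' - α' := by linarith
    have e6 : 0 < β' - α := by linarith
    gcongr
    linarith
  · simp only
    congr 2
    ring

/-- For `x` in the left band the right end point always exceeds `x`. Integrating it out leaves the
arcsine transform on `[β', β]` at the left end point `y`, namely `1 / √((β' - y) (β - y))`; the
condition `y ≤ x` cuts off the remaining arcsine integral. -/
lemma bandDensity_left {α α' β' β : ℝ} (h₁ : α < α') (h₂ : α' < β') (h₃ : β' < β)
    {x : ℝ} (hx : x ∈ Icc α α') :
    bandDensity α α' β' β x
      = 1 / Real.pi * ∫ y in α..x, 1 / Real.sqrt ((y - α) * (α' - y) * (β' - y) * (β - y)) := by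
  have hInt := integrable_uniformDensity h₁ h₂ h₃ x
  rw [bandDensity]
  unfold bandPair at hInt ⊢
  rw [integral_prod _ hInt]
  have hin : ∀ᵐ y' ∂(arcsineMeasure α α'),
      ∫ y, uniformDensity x (y', y) ∂(arcsineMeasure β' β)
        = (Iic x).indicator (fun y' => 1 / Real.sqrt ((β' - y') * (β - y'))) y' := by
    filter_upwards [ae_arcsineMeasure_mem α α'] with y' hy'
    by_cases hyx : y' ≤ x
    · rw [indicator_of_mem (show y' ∈ Iic x from hyx),
        ← integral_arcsineMeasure_inv_of_lt h₃ (hy'.2.trans h₂)]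
      refine integral_congr_ae ?_
      filter_upwards [ae_arcsineMeasure_mem β' β] with y hy
      rw [uniformDensity, if_pos ⟨hyx, (hx.2.trans_lt h₂).trans hy.1⟩]
    · rw [indicator_of_notMem (show y' ∉ Iic x from hyx), ← integral_zero ℝ ℝ]
      congr 1
      ext y
      rw [uniformDensity, if_neg fun h => hyx h.1]
  rw [integral_congr_ae hin, integral_arcsineMeasure, intervalIntegral.integral_of_le hx.1,
    ← integral_const_mul]
  calc _ = ∫ y in Ioo α α', (Iic x).indicator (fun y => 1 / Real.pi *
          (1 / Real.sqrt ((y - α) * (α' - y) * (β' - y) * (β - y)))) y := by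
        refine setIntegral_congr_fun measurableSet_Ioo fun y hy => ?_
        have e1 : 0 < y - α := by linarith [hy.1]
        have e2 : 0 < α' - y := by linarith [hy.2]
        by_cases hyx : y ∈ Iic x
        · simp only [indicator_of_mem hyx, smul_eq_mul]
          rw [mul_assoc ((y - α) * (α' - y)), Real.sqrt_mul (by positivity : 0 ≤ (y - α) * (α' - y))]
          field_simp
        · simp only [indicator_of_notMem hyx, smul_zero]
    _ = ∫ y in Ioo α α' ∩ Iic x, 1 / Real.pi *
          (1 / Real.sqrt ((y - α) * (α' - y) * (β' - y) * (β - y))) := by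
        rw [setIntegral_indicator measurableSet_Iic]
    _ = _ := by
        refine setIntegral_congr_set ?_
        have : ∀ᵐ y : ℝ, y ≠ α' := compl_mem_ae_iff.2 (measure_singleton α')
        filter_upwards [this] with y hy
        refine propext ⟨fun h => ⟨h.1.1, h.2⟩, fun h => ⟨⟨h.1, ?_⟩, h.2⟩⟩
        exact lt_of_le_of_ne (h.2.trans hx.2) hy

lemma bandDensity_right {α α' β' β : ℝ} (h₁ : α < α') (h₂ : α' < β') (h₃ : β' < β)
    {x : ℝ} (hx : x ∈ Icc β' β) :
    bandDensity α α' β' β x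
      = 1 / Real.pi * ∫ y in x..β, 1 / Real.sqrt ((y - α) * (y - α') * (y - β') * (β - y)) := by
  have hInt := integrable_uniformDensity h₁ h₂ h₃ x
  rw [bandDensity]
  unfold bandPair at hInt ⊢
  rw [integral_prod_symm _ hInt]
  have hin : ∀ᵐ y ∂(arcsineMeasure β' β),
      ∫ y', uniformDensity x (y', y) ∂(arcsineMeasure α α')
        = (Ioi x).indicator (fun y => 1 / Real.sqrt ((y - α) * (y - α'))) y := by
    filter_upwards [ae_arcsineMeasure_mem β' β] with y hy
    by_cases hyx : x < y
    · rw [indicator_of_mem (show y ∈ Ioi x from hyx),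
        ← integral_arcsineMeasure_inv_of_gt h₁ (h₂.trans hy.1)]
      refine integral_congr_ae ?_
      filter_upwards [ae_arcsineMeasure_mem α α'] with y' hy'
      rw [uniformDensity, if_pos ⟨(hy'.2.trans h₂).le.trans hx.1, hyx⟩]
    · rw [indicator_of_notMem (show y ∉ Ioi x from hyx), ← integral_zero ℝ ℝ]
      congr 1
      ext y'
      rw [uniformDensity, if_neg fun h => hyx h.2]
  rw [integral_congr_ae hin, integral_arcsineMeasure, intervalIntegral.integral_of_le hx.2,
    ← integral_const_mul]
  calc _ = ∫ y in Ioo β' β, (Ioi x).indicator (fun y => 1 / Real.pi *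
          (1 / Real.sqrt ((y - α) * (y - α') * (y - β') * (β - y)))) y := by
        refine setIntegral_congr_fun measurableSet_Ioo fun y hy => ?_
        have e1 : 0 < y - β' := by linarith [hy.1]
        have e2 : 0 < β - y := by linarith [hy.2]
        by_cases hyx : y ∈ Ioi x
        · simp only [indicator_of_mem hyx, smul_eq_mul]
          rw [mul_assoc ((y - α) * (y - α')), mul_comm ((y - α) * (y - α')),
            Real.sqrt_mul (by positivity : 0 ≤ (y - β') * (β - y))]
          field_simp
        · simp only [indicator_of_notMem hyx, smul_zero]
    _ = ∫ y in Ioo β' β ∩ Ioi x, 1 / Real.pi *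
          (1 / Real.sqrt ((y - α) * (y - α') * (y - β') * (β - y))) := by
        rw [setIntegral_indicator measurableSet_Ioi]
    _ = _ := by
        refine setIntegral_congr_set ?_
        have : ∀ᵐ y : ℝ, y ≠ β := compl_mem_ae_iff.2 (measure_singleton β)
        filter_upwards [this] with y hy
        refine propext ⟨fun h => ⟨h.2, h.1.2.le⟩, fun h => ⟨⟨hx.1.trans_lt h.1, ?_⟩, h.1⟩⟩
        exact lt_of_le_of_ne h.2 hy

/-- The plateau height is the value at `α'`. Both strict inequalities say that the positive
integrand has positive integral, over `[α, x]` and over `[x, α']`. -/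
lemma bandDensity_mem_of_left {α α' β' β : ℝ} (h₁ : α < α') (h₂ : α' < β') (h₃ : β' < β)
    {x : ℝ} (hx : x ∈ Ioo α α') :
    0 < bandDensity α α' β' β x ∧ bandDensity α α' β' β x < bandHeight α α' β' β := by
  have hi := intervalIntegrable_left_band h₁ h₂ h₃
  have hpos : ∀ y ∈ Ioo α α', 0 < 1 / Real.sqrt ((y - α) * (α' - y) * (β' - y) * (β - y)) := by
    intro y hy
    have e1 : 0 < y - α := by linarith [hy.1]
    have e2 : 0 < α' - y := by linarith [hy.2]
    have e3 : 0 < β' - y := by linarith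
    have e4 : 0 < β - y := by linarith
    positivity
  have i1 := hi.mono_set (c := α) (d := x)
    (by rw [uIcc_of_le hx.1.le, uIcc_of_le h₁.le]; exact Icc_subset_Icc_right hx.2.le)
  have i2 := hi.mono_set (c := x) (d := α')
    (by rw [uIcc_of_le hx.2.le, uIcc_of_le h₁.le]; exact Icc_subset_Icc_left hx.1.le)
  have p1 := intervalIntegral.intervalIntegral_pos_of_pos_on i1
    (fun y hy => hpos y ⟨hy.1, hy.2.trans hx.2⟩) hx.1
  have p2 := intervalIntegral.intervalIntegral_pos_of_pos_on i2
    (fun y hy => hpos y ⟨hx.1.trans hy.1, hy.2⟩) hx.2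
  have hpi := Real.pi_pos
  rw [← bandDensity_eq_height (left_mem_Icc.2 h₂.le),
    bandDensity_left h₁ h₂ h₃ (right_mem_Icc.2 h₁.le),
    bandDensity_left h₁ h₂ h₃ (Ioo_subset_Icc_self hx),
    ← intervalIntegral.integral_add_adjacent_intervals i1 i2]
  refine ⟨by positivity, ?_⟩
  gcongr
  linarith

lemma bandDensity_mem_of_right {α α' β' β : ℝ} (h₁ : α < α') (h₂ : α' < β') (h₃ : β' < β)
    {x : ℝ} (hx : x ∈ Ioo β' β) :
    0 < bandDensity α α' β' β x ∧ bandDensity α α' β' β x < bandHeight α α' β' β := by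
  have hi := intervalIntegrable_right_band h₁ h₂ h₃
  have hpos : ∀ y ∈ Ioo β' β, 0 < 1 / Real.sqrt ((y - α) * (y - α') * (y - β') * (β - y)) := by
    intro y hy
    have e1 : 0 < y - β' := by linarith [hy.1]
    have e2 : 0 < β - y := by linarith [hy.2]
    have e3 : 0 < y - α' := by linarith
    have e4 : 0 < y - α := by linarith
    positivity
  have i1 := hi.mono_set (c := β') (d := x)
    (by rw [uIcc_of_le hx.1.le, uIcc_of_le h₃.le]; exact Icc_subset_Icc_right hx.2.le)
  have i2 := hi.mono_set (c := x) (d := β)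
    (by rw [uIcc_of_le hx.2.le, uIcc_of_le h₃.le]; exact Icc_subset_Icc_left hx.1.le)
  have p1 := intervalIntegral.intervalIntegral_pos_of_pos_on i1
    (fun y hy => hpos y ⟨hy.1, hy.2.trans hx.2⟩) hx.1
  have p2 := intervalIntegral.intervalIntegral_pos_of_pos_on i2
    (fun y hy => hpos y ⟨hx.1.trans hy.1, hy.2⟩) hx.2
  have hpi := Real.pi_pos
  rw [← bandDensity_eq_height (right_mem_Icc.2 h₂.le),
    bandDensity_right h₁ h₂ h₃ (left_mem_Icc.2 h₃.le),
    bandDensity_right h₁ h₂ h₃ (Ioo_subset_Icc_self hx),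
    ← intervalIntegral.integral_add_adjacent_intervals i1 i2]
  refine ⟨by positivity, ?_⟩
  gcongr
  linarith

lemma bandHeight_pos {α α' β' β : ℝ} (h₁ : α < α') (h₂ : α' < β') (h₃ : β' < β) :
    0 < bandHeight α α' β' β := by
  have h := bandDensity_mem_of_left h₁ h₂ h₃ (x := (α + α') / 2) ⟨by linarith, by linarith⟩
  exact h.1.trans h.2

lemma bandDensity_pos {α α' β' β : ℝ} (h₁ : α < α') (h₂ : α' < β') (h₃ : β' < β)
    {x : ℝ} (hx : x ∈ Ioo α β) : 0 < bandDensity α α' β' β x := by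
  rcases lt_or_ge x α' with h | h
  · exact (bandDensity_mem_of_left h₁ h₂ h₃ ⟨hx.1, h⟩).1
  rcases le_or_gt x β' with h' | h'
  · rw [bandDensity_eq_height ⟨h, h'⟩]
    exact bandHeight_pos h₁ h₂ h₃
  · exact (bandDensity_mem_of_right h₁ h₂ h₃ ⟨h', hx.2⟩).1

lemma setOf_bandDensity_eq_height {α α' β' β : ℝ} (h₁ : α < α') (h₂ : α' < β') (h₃ : β' < β) :
    {x | bandDensity α α' β' β x = bandHeight α α' β' β} = Icc α' β' := by
  ext x
  refine ⟨fun hx => ?_, fun hx => bandDensity_eq_height hx⟩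
  have hx : bandDensity α α' β' β x = bandHeight α α' β' β := hx
  have hpos := bandHeight_pos h₁ h₂ h₃
  have hmem : x ∈ Ioo α β := by
    by_contra h
    rw [bandDensity_eq_zero h] at hx
    linarith
  constructor
  · by_contra! h
    exact (bandDensity_mem_of_left h₁ h₂ h₃ ⟨hmem.1, h⟩).2.ne hx
  · by_contra! h
    exact (bandDensity_mem_of_right h₁ h₂ h₃ ⟨h, hmem.2⟩).2.ne hx

lemma integrable_bandDensity {α α' β' β : ℝ} (h₁ : α < α') (h₂ : α' < β') (h₃ : β' < β) :
    Integrable (bandDensity α α' β' β) := by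
  have h := integral_bandDensity h₁ h₂ h₃
  by_contra h'
  rw [integral_undef h'] at h
  exact zero_ne_one h

/-! ### The resolvent -/

/-- The square root of `(z - α) (z - α') (z - β') (z - β)` cut along the two bands. -/
def quarticSqrt (α α' β' β : ℝ) (z : ℂ) : ℂ := bandSqrt α α' z * bandSqrt β' β z

lemma notMem_left_right {α α' β' β : ℝ} (h₁ : α < α') (h₂ : α' < β') (h₃ : β' < β) {z : ℂ}
    (hz : z ∉ realSegment α β) : z ∉ realSegment α α' ∧ z ∉ realSegment β' β :=
  ⟨fun h => hz (realSegment_mono le_rfl (h₂.trans h₃).le h),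
    fun h => hz (realSegment_mono (h₁.trans h₂).le le_rfl h)⟩

lemma isSqrtSheet_quarticSqrt {α α' β' β : ℝ} (h₁ : α < α') (h₂ : α' < β') (h₃ : β' < β) :
    IsSqrtSheet α α' β' β (quarticSqrt α α' β' β) where
  analytic z hz := by
    rw [mem_compl_iff, mem_union, not_or] at hz
    exact ((differentiableAt_bandSqrt h₁ hz.1).mul
      (differentiableAt_bandSqrt h₃ hz.2)).differentiableWithinAt
  sq_eq z hz := by
    rw [mem_compl_iff, mem_union, not_or] at hz
    rw [quarticSqrt, mul_pow, bandSqrt_sq h₁ hz.1, bandSqrt_sq h₃ hz.2]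
    ring
  pos x hx := by
    have e1 : 0 < x - α := by linarith
    have e2 : 0 < x - α' := by linarith
    have e3 : 0 < x - β' := by linarith
    have e4 : 0 < x - β := by linarith
    refine ⟨_, ?_, by rw [quarticSqrt, bandSqrt_ofReal_of_gt h₁ (h₂.trans (h₃.trans hx)),
      bandSqrt_ofReal_of_gt h₃ hx, ← Complex.ofReal_mul]⟩
    positivity

lemma quarticSqrt_ne_zero {α α' β' β : ℝ} (h₁ : α < α') (h₃ : β' < β) {z : ℂ}
    (hz : z ∉ realSegment α α') (hz' : z ∉ realSegment β' β) : quarticSqrt α α' β' β z ≠ 0 :=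
  mul_ne_zero (bandSqrt_ne_zero h₁ hz) (bandSqrt_ne_zero h₃ hz')

/-- The Stieltjes transform of a density. -/
def stieltjes (ρ : ℝ → ℝ) (z : ℂ) : ℂ := ∫ x, ρ x • (1 / (z - (x : ℂ)))

lemma hasDerivAt_stieltjes {ρ : ℝ → ℝ} {a b : ℝ} (hρ : Integrable ρ)
    (hρ0 : ∀ x, x ∉ Icc a b → ρ x = 0) {z : ℂ} (hz : z ∉ realSegment a b) :
    HasDerivAt (stieltjes ρ) (-∫ x, ρ x • (1 / (z - (x : ℂ)) ^ 2)) z := by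
  obtain ⟨ε, hε, hball⟩ := Metric.isOpen_iff.1 (isClosed_realSegment a b).isOpen_compl z hz
  have hfar : ∀ x ∈ Icc a b, ∀ w ∈ Metric.ball z (ε / 2), ε / 2 ≤ ‖w - x‖ := by
    intro x hx w hw
    by_contra! h
    have hxz : (x : ℂ) ∈ Metric.ball z ε := by
      rw [Metric.mem_ball, dist_eq_norm] at hw ⊢
      calc ‖(x : ℂ) - z‖ = ‖(w - z) - (w - x)‖ := by ring_nf
        _ ≤ ‖w - z‖ + ‖w - x‖ := norm_sub_le _ _
        _ < ε := by linarith
    exact hball hxz ⟨x, hx, rfl⟩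
  have hmeas : ∀ n : ℕ, ∀ w : ℂ, AEStronglyMeasurable (fun x : ℝ => ρ x • (1 / (w - (x : ℂ)) ^ n)) :=
    fun n w => hρ.aestronglyMeasurable.smul (Measurable.aestronglyMeasurable (by fun_prop))
  have hbound : ∀ n : ℕ, ∀ x : ℝ, ∀ w ∈ Metric.ball z (ε / 2),
      ‖ρ x • (1 / (w - (x : ℂ)) ^ n)‖ ≤ (1 / (ε / 2) ^ n) * ‖ρ x‖ := by
    intro n x w hw
    by_cases hx : x ∈ Icc a b
    · rw [norm_smul, norm_div, norm_one, norm_pow, mul_comm]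
      gcongr
      exact hfar x hx w hw
    · rw [hρ0 x hx]; simp
  have h := (hasDerivAt_integral_of_dominated_loc_of_deriv_le (μ := volume) (x₀ := z)
    (F := fun (w : ℂ) (x : ℝ) => ρ x • (1 / (w - (x : ℂ))))
    (F' := fun (w : ℂ) (x : ℝ) => -(ρ x • (1 / (w - (x : ℂ)) ^ 2)))
    (bound := fun x => (1 / (ε / 2) ^ 2) * ‖ρ x‖)
    (Metric.ball_mem_nhds z (half_pos hε)) ?_ ?_ ?_ ?_ ?_ ?_).2
  · rw [integral_neg] at h
    exact h
  · exact Eventually.of_forall fun w => by simpa using hmeas 1 w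
  · refine (hρ.norm.const_mul (1 / (ε / 2) ^ 1)).mono' (by simpa using hmeas 1 z) ?_
    exact Eventually.of_forall fun x => by
      simpa using hbound 1 x z (Metric.mem_ball_self (half_pos hε))
  · exact (hmeas 2 z).neg
  · refine Eventually.of_forall fun x w hw => ?_
    rw [norm_neg]
    exact hbound 2 x w hw
  · exact hρ.norm.const_mul _
  · refine Eventually.of_forall fun x w hw => ?_
    by_cases hx : x ∈ Icc a b
    · have hne : w - x ≠ 0 := by
        rw [← norm_pos_iff]
        exact (half_pos hε).trans_le (hfar x hx w hw)
      have h1 : HasDerivAt (fun w : ℂ => 1 / (w - (x : ℂ))) (-(1 / (w - (x : ℂ)) ^ 2)) w := by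
        have := ((hasDerivAt_id w).sub_const (x : ℂ)).fun_inv hne
        simpa [one_div, neg_div] using this
      have h2 := h1.fun_const_smul (ρ x)
      rwa [smul_neg] at h2
    · rw [hρ0 x hx]
      simpa using hasDerivAt_const w (0 : ℂ)

lemma tendsto_stieltjes {ρ : ℝ → ℝ} {a b : ℝ} (hρ : Integrable ρ)
    (hρ0 : ∀ x, x ∉ Icc a b → ρ x = 0) : Tendsto (stieltjes ρ) (Bornology.cobounded ℂ) (𝓝 0) := by
  set M := max |a| |b| with hM
  have hM0 : ∀ x ∈ Icc a b, |x| ≤ M := fun x hx => abs_le_max_abs_abs hx.1 hx.2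
  have hb : ∀ z : ℂ, M + 1 ≤ ‖z‖ → ‖stieltjes ρ z‖ ≤ (∫ x, ‖ρ x‖) * (‖z‖ - M)⁻¹ := by
    intro z hz
    have hpos : 0 < ‖z‖ - M := by linarith
    have hle : ∀ x, ‖ρ x • (1 / (z - (x : ℂ)))‖ ≤ ‖ρ x‖ * (‖z‖ - M)⁻¹ := by
      intro x
      by_cases hx : x ∈ Icc a b
      · rw [norm_smul, one_div, norm_inv]
        gcongr
        have h1 := norm_sub_norm_le z (x : ℂ)
        have h2 : ‖(x : ℂ)‖ ≤ M := by simpa using hM0 x hx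
        linarith
      · rw [hρ0 x hx]; simp
    rw [stieltjes, ← integral_mul_const]
    exact norm_integral_le_of_norm_le (hρ.norm.mul_const _) (Eventually.of_forall hle)
  have hlim : Tendsto (fun z : ℂ => (∫ x, ‖ρ x‖) * (‖z‖ - M)⁻¹) (Bornology.cobounded ℂ) (𝓝 0) := by
    have h1 : Tendsto (fun z : ℂ => ‖z‖ - M) (Bornology.cobounded ℂ) atTop :=
      tendsto_atTop_add_const_right _ _ tendsto_norm_cobounded_atTop
    simpa using h1.inv_tendsto_atTop.const_mul (∫ x, ‖ρ x‖)
  refine squeeze_zero_norm' ?_ hlim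
  filter_upwards [tendsto_norm_cobounded_atTop.eventually_ge_atTop (M + 1)] with z hz
  exact hb z hz

/-- On one interval, `1 / (p.2 - p.1) * ∫ 1 / (z - x)²` equals `1 / ((z - p.1) (z - p.2))`: the
length cancels. The integrand is then a product in the two independent end points, and its mean is
the product of two arcsine transforms. -/
lemma hasDerivAt_stieltjes_bandDensity {α α' β' β : ℝ} (h₁ : α < α') (h₂ : α' < β')
    (h₃ : β' < β) {z : ℂ} (hz : z ∉ realSegment α β) :
    HasDerivAt (stieltjes (bandDensity α α' β' β)) (-(1 / quarticSqrt α α' β' β z)) z := by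
  have h := hasDerivAt_stieltjes (integrable_bandDensity h₁ h₂ h₃)
    (fun x hx => bandDensity_eq_zero fun h => hx (Ioo_subset_Icc_self h)) hz
  have hzx : ∀ x ∈ Icc α β, z - (x : ℂ) ≠ 0 := fun x hx => sub_ne_zero_of_notMem_realSegment hz hx
  have hcont : ContinuousOn (fun x : ℝ => 1 / (z - (x : ℂ)) ^ 2) (Icc α β) :=
    continuousOn_const.div (by fun_prop) fun x hx => pow_ne_zero 2 (hzx x hx)
  rw [integral_bandDensity_smul h₁ h₂ h₃ hcont.integrableOn_Icc] at h
  convert h using 2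
  obtain ⟨hl, hr⟩ := notMem_left_right h₁ h₂ h₃ hz
  rw [quarticSqrt, ← one_div_mul_one_div, ← integral_arcsineMeasure_inv h₁ hl,
    ← integral_arcsineMeasure_inv h₃ hr, ← integral_prod_mul (L := ℂ)]
  refine integral_congr_ae ?_
  filter_upwards [ae_bandPair_mem α α' β' β] with p hp
  have hp1 : p.1 ∈ Icc α β := ⟨hp.1.1.le, by linarith [hp.1.2]⟩
  have hp2 : p.2 ∈ Icc α β := ⟨by linarith [hp.2.1], hp.2.2.le⟩
  have h12 : p.1 < p.2 := by linarith [hp.1.2, hp.2.1]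
  have hsub : Icc p.1 p.2 ⊆ Icc α β := Icc_subset_Icc hp1.1 hp2.2
  have hInt : ∫ x in p.1..p.2, 1 / (z - (x : ℂ)) ^ 2 = 1 / (z - (p.2 : ℂ)) - 1 / (z - (p.1 : ℂ)) := by
    refine intervalIntegral.integral_eq_sub_of_hasDerivAt
      (f := fun x : ℝ => 1 / (z - (x : ℂ))) (fun x hx => ?_) (ContinuousOn.intervalIntegrable ?_)
    · rw [uIcc_of_le h12.le] at hx
      have h1 : HasDerivAt (fun x : ℝ => z - (x : ℂ)) (-1) x :=
        (Complex.ofRealCLM.hasDerivAt (x := x)).const_sub z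
      have := h1.fun_inv (hzx x (hsub hx))
      simpa [one_div, neg_div] using this
    · rw [uIcc_of_le h12.le]
      exact hcont.mono hsub
  rw [hInt, Complex.real_smul]
  have e1 := hzx _ hp1
  have e2 := hzx _ hp2
  have e3 : (p.2 : ℂ) - p.1 ≠ 0 := by
    rw [sub_ne_zero]; exact_mod_cast h12.ne'
  push_cast
  field_simp
  ring

/-! ### Integrals along paths to infinity -/

lemma exists_isPathToInfinity {a b : ℝ} {z : ℂ} (hz : z ∉ realSegment a b) :
    ∃ c : ℝ → ℂ, IsPathToInfinity (realSegment a b)ᶜ z c := by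
  have main : ∀ d : ℂ, d ≠ 0 → (∀ s : ℝ, 0 ≤ s → z + s * d ∉ realSegment a b) →
      IsPathToInfinity (realSegment a b)ᶜ z (fun s : ℝ => z + s * d) := by
    intro d hd hmem
    refine ⟨?_, by simp, hmem, ?_⟩
    · have : ContDiff ℝ 1 (fun s : ℝ => z + (s : ℂ) * d) :=
        contDiff_const.add (Complex.ofRealCLM.contDiff.mul contDiff_const)
      exact this.contDiffOn
    · have h1 : Tendsto (fun s : ℝ => s * ‖d‖ - ‖z‖) atTop atTop :=
        tendsto_atTop_add_const_right _ _ (tendsto_id.atTop_mul_const (norm_pos_iff.2 hd))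
      refine tendsto_atTop_mono' _ ?_ h1
      filter_upwards [eventually_ge_atTop 0] with s hs
      have h2 : ‖(s : ℂ) * d‖ = s * ‖d‖ := by simp [abs_of_nonneg hs]
      have h3 := norm_sub_le (z + s * d) z
      rw [add_sub_cancel_left, h2] at h3
      linarith
  -- A half-line avoids the segment: horizontal and pointing away from it if `z` is real, vertical
  -- and pointing away from the axis otherwise.
  by_cases him : z.im = 0
  · have hzre : z = (z.re : ℂ) := by
      apply Complex.ext <;> simp [him]
    have hre : z.re ∉ Icc a b := fun h => hz ⟨z.re, h, hzre.symm⟩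
    rw [mem_Icc, not_and_or, not_le, not_le] at hre
    rcases hre with h | h
    · refine ⟨_, main (-1) (by simp) fun s hs => ?_⟩
      rw [hzre, show (z.re : ℂ) + s * (-1) = ((z.re - s : ℝ) : ℂ) by push_cast; ring]
      exact ofReal_notMem_realSegment fun h' => by linarith [h'.1]
    · refine ⟨_, main 1 (by simp) fun s hs => ?_⟩
      rw [hzre, show (z.re : ℂ) + s * 1 = ((z.re + s : ℝ) : ℂ) by push_cast; ring]
      exact ofReal_notMem_realSegment fun h' => by linarith [h'.2]
  · refine ⟨_, main (z.im * Complex.I) (by simp [him]) fun s hs => ?_⟩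
    refine notMem_realSegment_of_im_ne_zero ?_
    have : (z + s * (z.im * Complex.I)).im = z.im * (1 + s) := by simp; ring
    rw [this]
    exact mul_ne_zero him (by positivity)

/-- Here `-ω` is a global primitive of `f` on `U`, so every path gives `ω z - ω (c T)`, and the
second term vanishes in the limit. No deformation of contours is needed. -/
lemma integralToInfinityEq_of_hasDerivAt {U : Set ℂ} {f ω : ℂ → ℂ} {z : ℂ}
    (hne : ∃ c : ℝ → ℂ, IsPathToInfinity U z c) (hω : ∀ w ∈ U, HasDerivAt ω (-f w) w)
    (hf : ContinuousOn f U) (hlim : Tendsto ω (Bornology.cobounded ℂ) (𝓝 0)) :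
    IntegralToInfinityEq U f z (ω z) := by
  refine ⟨hne, fun c hc => ?_⟩
  have hcT : Tendsto (fun T : ℝ => ω z - ω (c T)) atTop (𝓝 (ω z)) := by
    have h1 : Tendsto c atTop (Bornology.cobounded ℂ) :=
      tendsto_norm_atTop_iff_cobounded.1 hc.tendsto
    simpa using (hlim.comp h1).const_sub (ω z)
  refine hcT.congr' ?_
  filter_upwards [eventually_gt_atTop 0] with T hT
  have hcc : ContinuousOn c (Icc 0 T) := hc.contDiffOn.continuousOn.mono Icc_subset_Ici_self
  have hmaps : MapsTo c (Icc 0 T) U := fun s hs => hc.mem s hs.1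
  -- Nothing is assumed about `c` on negative times, so `deriv c 0` is uncontrolled. The one-sided
  -- derivative is continuous up to `0` and agrees with `deriv c` on the open interval, which is
  -- enough for integrability.
  have hdc : ContinuousOn (derivWithin c (Ici 0)) (Icc 0 T) :=
    (hc.contDiffOn.continuousOn_derivWithin (uniqueDiffOn_Ici 0) le_rfl).mono Icc_subset_Ici_self
  have hωc : ContinuousOn ω U := fun w hw => (hω w hw).continuousAt.continuousWithinAt
  have hd : ∀ s ∈ Ioo 0 T, HasDerivAt c (deriv c s) s := fun s hs =>
    ((hc.contDiffOn.differentiableOn one_ne_zero).differentiableAt (Ici_mem_nhds hs.1)).hasDerivAt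
  have key := intervalIntegral.integral_eq_sub_of_hasDerivAt_of_le hT.le
    (f := fun s => -ω (c s)) (f' := fun s => f (c s) * deriv c s)
    ((hωc.comp hcc hmaps).neg) (fun s hs => ?_) ?_
  · rw [key, hc.start]; ring
  · have := ((hω (c s) (hc.mem s hs.1.le)).comp s (hd s hs)).neg
    rw [neg_mul, neg_neg] at this
    exact this
  · rw [intervalIntegrable_iff_integrableOn_Ioo_of_le hT.le]
    have hi : IntegrableOn (fun s => f (c s) * derivWithin c (Ici 0) s) (Ioo 0 T) :=
      (((hf.comp hcc hmaps).mul hdc).integrableOn_Icc).mono_set Ioo_subset_Icc_self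
    refine hi.congr_fun (fun s hs => ?_) measurableSet_Ioo
    simp only
    rw [derivWithin_of_mem_nhds (Ici_mem_nhds hs.1)]

lemma integralToInfinityEq_stieltjes_bandDensity {α α' β' β : ℝ} (h₁ : α < α') (h₂ : α' < β')
    (h₃ : β' < β) {z : ℂ} (hz : z ∉ realSegment α β) :
    IntegralToInfinityEq (realSegment α β)ᶜ (fun w => 1 / quarticSqrt α α' β' β w) z
      (stieltjes (bandDensity α α' β' β) z) := by
  refine integralToInfinityEq_of_hasDerivAt (exists_isPathToInfinity hz)
    (fun w hw => hasDerivAt_stieltjes_bandDensity h₁ h₂ h₃ hw) ?_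
    (tendsto_stieltjes (integrable_bandDensity h₁ h₂ h₃)
      fun x hx => bandDensity_eq_zero fun h => hx (Ioo_subset_Icc_self h))
  refine continuousOn_const.div ?_ fun w hw => ?_
  · refine (isSqrtSheet_quarticSqrt h₁ h₂ h₃).analytic.continuousOn.mono fun w hw => ?_
    obtain ⟨hl, hr⟩ := notMem_left_right h₁ h₂ h₃ hw
    simp [hl, hr]
  · obtain ⟨hl, hr⟩ := notMem_left_right h₁ h₂ h₃ hw
    exact quarticSqrt_ne_zero h₁ h₃ hl hr

lemma measureResolvent_withDensity {ρ : ℝ → ℝ} (hm : Measurable ρ) (hρ : ∀ x, 0 ≤ ρ x) (z : ℂ) :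
    measureResolvent (volume.withDensity fun x => ENNReal.ofReal (ρ x)) z = stieltjes ρ z := by
  rw [measureResolvent, stieltjes, integral_withDensity_eq_integral_toReal_smul]
  · simp only [ENNReal.toReal_ofReal (hρ _)]
  · exact hm.ennreal_ofReal
  · exact Eventually.of_forall fun y => ENNReal.ofReal_lt_top

/-! ### Boundary values on the real line -/

/-- `1 / √|R|` on the real line, where `R(s) = (s - α) (s - α') (s - β') (s - β)`. -/
def invSqrtAbs (α α' β' β s : ℝ) : ℝ :=
  1 / Real.sqrt |(s - α) * (s - α') * (s - β') * (s - β)|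

/-- The real part of the boundary values of `1 / √R` on the real line. -/
def bandField (α α' β' β s : ℝ) : ℝ :=
  if s < α ∨ β < s then invSqrtAbs α α' β' β s
  else if α' < s ∧ s < β' then -invSqrtAbs α α' β' β s else 0

lemma invSqrtAbs_nonneg (α α' β' β s : ℝ) : 0 ≤ invSqrtAbs α α' β' β s := by
  unfold invSqrtAbs; positivity

lemma measurable_invSqrtAbs (α α' β' β : ℝ) : Measurable (invSqrtAbs α α' β' β) := by
  unfold invSqrtAbs
  refine measurable_const.div (Measurable.sqrt (Continuous.measurable ?_))
  fun_prop

lemma measurable_bandField (α α' β' β : ℝ) : Measurable (bandField α α' β' β) := by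
  have h := measurable_invSqrtAbs α α' β' β
  refine Measurable.ite ?_ h (Measurable.ite ?_ h.neg measurable_const)
  · exact measurableSet_Iio.union measurableSet_Ioi
  · exact measurableSet_Ioo

lemma norm_bandField_le (α α' β' β s : ℝ) :
    ‖bandField α α' β' β s‖ ≤ invSqrtAbs α α' β' β s := by
  have h := invSqrtAbs_nonneg α α' β' β s
  unfold bandField
  split_ifs
  · rw [Real.norm_of_nonneg h]
  · rw [norm_neg, Real.norm_of_nonneg h]
  · simpa using h

lemma integrableOn_invSqrtAbs_left {α α' β' β : ℝ} (h₁ : α < α') (h₂ : α' < β') (h₃ : β' < β) :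
    IntegrableOn (invSqrtAbs α α' β' β) (Ioo α α') := by
  have h := intervalIntegrable_left_band h₁ h₂ h₃
  rw [intervalIntegrable_iff_integrableOn_Ioo_of_le h₁.le] at h
  refine h.congr_fun (fun s hs => ?_) measurableSet_Ioo
  have e1 : 0 < s - α := by linarith [hs.1]
  have e2 : 0 < α' - s := by linarith [hs.2]
  have e3 : 0 < β' - s := by linarith
  have e4 : 0 < β - s := by linarith
  simp only [invSqrtAbs]
  rw [← abs_of_pos (show 0 < (s - α) * (α' - s) * (β' - s) * (β - s) by positivity), ← abs_neg]
  congr 3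
  ring

lemma integrableOn_invSqrtAbs_right {α α' β' β : ℝ} (h₁ : α < α') (h₂ : α' < β') (h₃ : β' < β) :
    IntegrableOn (invSqrtAbs α α' β' β) (Ioo β' β) := by
  have h := intervalIntegrable_right_band h₁ h₂ h₃
  rw [intervalIntegrable_iff_integrableOn_Ioo_of_le h₃.le] at h
  refine h.congr_fun (fun s hs => ?_) measurableSet_Ioo
  have e1 : 0 < s - β' := by linarith [hs.1]
  have e2 : 0 < β - s := by linarith [hs.2]
  have e3 : 0 < s - α' := by linarith
  have e4 : 0 < s - α := by linarith
  simp only [invSqrtAbs]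
  rw [← abs_of_pos (show 0 < (s - α) * (s - α') * (s - β') * (β - s) by positivity), ← abs_neg]
  congr 3
  ring

lemma integrableOn_invSqrtAbs_gap {α α' β' β : ℝ} (h₁ : α < α') (h₂ : α' < β') (h₃ : β' < β) :
    IntegrableOn (invSqrtAbs α α' β' β) (Ioo α' β') := by
  refine (integrableOn_inv_sqrt_arcsine_mul h₂
    (mul_pos (sub_pos.2 h₁) (sub_pos.2 h₃)) (g := fun y => (y - α) * (β - y))
    (by fun_prop) fun y hy => ?_).congr_fun (fun s hs => ?_) measurableSet_Ioo
  · obtain ⟨e1, e2⟩ := hy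
    have e5 : 0 < α' - α := by linarith
    have e6 : 0 < β - β' := by linarith
    gcongr
    linarith
  · have e1 : 0 < s - α' := by linarith [hs.1]
    have e2 : 0 < β' - s := by linarith [hs.2]
    have e3 : 0 < s - α := by linarith
    have e4 : 0 < β - s := by linarith
    simp only [invSqrtAbs]
    rw [← abs_of_pos (show 0 < (s - α') * (β' - s) * ((s - α) * (β - s)) by positivity)]
    congr 3
    ring

lemma ae_ne_endpoints (α α' β' β : ℝ) : ∀ᵐ s : ℝ, s ≠ α ∧ s ≠ α' ∧ s ≠ β' ∧ s ≠ β := by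
  have h (x : ℝ) : ∀ᵐ y : ℝ, y ≠ x := compl_mem_ae_iff.2 (measure_singleton x)
  filter_upwards [h α, h α', h β', h β] with s a b c d
  exact ⟨a, b, c, d⟩

lemma integrable_invSqrtAbs {α α' β' β : ℝ} (h₁ : α < α') (h₂ : α' < β') (h₃ : β' < β)
    (hL : IntegrableOn (invSqrtAbs α α' β' β) (Iio α))
    (hR : IntegrableOn (invSqrtAbs α α' β' β) (Ioi β)) :
    Integrable (invSqrtAbs α α' β' β) := by
  have h := (((hL.union (integrableOn_invSqrtAbs_left h₁ h₂ h₃)).union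
    (integrableOn_invSqrtAbs_gap h₁ h₂ h₃)).union
    (integrableOn_invSqrtAbs_right h₁ h₂ h₃)).union hR
  rw [← integrableOn_univ]
  refine h.congr_set_ae ?_
  filter_upwards [ae_ne_endpoints α α' β' β] with s hs
  refine propext ⟨fun _ => ?_, fun _ => trivial⟩
  change s ∈ (((Iio α ∪ Ioo α α') ∪ Ioo α' β') ∪ Ioo β' β) ∪ Ioi β
  simp only [mem_union, mem_Iio, mem_Ioo, mem_Ioi]
  rcases lt_or_gt_of_ne hs.1 with a | a
  · tauto
  rcases lt_or_gt_of_ne hs.2.1 with b | b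
  · tauto
  rcases lt_or_gt_of_ne hs.2.2.1 with c | c
  · tauto
  rcases lt_or_gt_of_ne hs.2.2.2 with d | d
  · tauto
  · tauto

lemma integrable_bandField {α α' β' β : ℝ} (hN : Integrable (invSqrtAbs α α' β' β)) :
    Integrable (bandField α α' β' β) :=
  hN.mono' (measurable_bandField α α' β' β).aestronglyMeasurable
    (Eventually.of_forall (norm_bandField_le α α' β' β))

lemma add_mul_I_im_ne {s ε : ℝ} (hε : 0 < ε) : ((s : ℂ) + ε * Complex.I).im ≠ 0 := by
  simpa using hε.ne'

/-- Leaving the real line vertically only increases the distance to each branch point. This gives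
one dominating function for all `ε`. -/
lemma norm_inv_quarticSqrt_le {α α' β' β : ℝ} (h₁ : α < α') (h₂ : α' < β') (h₃ : β' < β)
    {s ε : ℝ} (hε : 0 < ε) (hs : s ≠ α ∧ s ≠ α' ∧ s ≠ β' ∧ s ≠ β) :
    ‖1 / quarticSqrt α α' β' β (s + ε * Complex.I)‖ ≤ invSqrtAbs α α' β' β s := by
  have him := add_mul_I_im_ne (s := s) hε
  have hsq := (isSqrtSheet_quarticSqrt h₁ h₂ h₃).sq_eq (s + ε * Complex.I) (by
    simp [notMem_realSegment_of_im_ne_zero him])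
  have hle : ∀ e : ℝ, |s - e| ≤ ‖(s : ℂ) + ε * Complex.I - e‖ := by
    intro e
    simpa using Complex.abs_re_le_norm ((s : ℂ) + ε * Complex.I - e)
  have hpos : 0 < |(s - α) * (s - α') * (s - β') * (s - β)| := by
    rw [abs_pos]
    obtain ⟨a, b, c, d⟩ := hs
    exact mul_ne_zero (mul_ne_zero (mul_ne_zero (sub_ne_zero.2 a) (sub_ne_zero.2 b))
      (sub_ne_zero.2 c)) (sub_ne_zero.2 d)
  rw [invSqrtAbs, norm_div, norm_one]
  refine one_div_le_one_div_of_le (Real.sqrt_pos.2 hpos) ?_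
  rw [Real.sqrt_le_left (norm_nonneg _), ← norm_pow, hsq]
  simp only [norm_mul, abs_mul]
  gcongr <;> exact hle _

/-- `(Re w)² = (‖w²‖ + Re w²) / 2`, whose limit is `0` when `w²` tends to a nonpositive real. On a
band this gives the real part of the boundary value without deciding the sign of the imaginary part.
-/
lemma re_tendsto_zero_of_sq_tendsto {ι : Type*} {l : Filter ι} {w : ι → ℂ} {r : ℝ} (hr : r ≤ 0)
    (h : Tendsto (fun i => w i ^ 2) l (𝓝 (r : ℂ))) : Tendsto (fun i => (w i).re) l (𝓝 0) := by
  have h1 : Tendsto (fun i => Real.sqrt ((‖w i ^ 2‖ + (w i ^ 2).re) / 2)) l (𝓝 0) := by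
    have h2 := ((h.norm.add ((Complex.continuous_re.tendsto _).comp h)).div_const 2).sqrt
    simpa [abs_of_nonpos hr] using h2
  rw [tendsto_zero_iff_abs_tendsto_zero]
  refine h1.congr fun i => ?_
  rw [Function.comp_apply, ← Real.sqrt_sq_eq_abs]
  congr 1
  rw [norm_pow, Complex.sq_norm, Complex.normSq_apply, sq (w i), Complex.mul_re]
  ring

/-- Off the bands `√R` is continuous and real, with the sign of the product of its two factors. On
the bands `R < 0`, so the boundary values of `1 / √R` are purely imaginary. -/
lemma tendsto_re_inv_quarticSqrt {α α' β' β : ℝ} (h₁ : α < α') (h₂ : α' < β') (h₃ : β' < β)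
    {s : ℝ} (hs : s ≠ α ∧ s ≠ α' ∧ s ≠ β' ∧ s ≠ β) :
    Tendsto (fun ε : ℝ => (1 / quarticSqrt α α' β' β (s + ε * Complex.I)).re) (𝓝[>] 0)
      (𝓝 (bandField α α' β' β s)) := by
  have hpath : Tendsto (fun ε : ℝ => (s : ℂ) + ε * Complex.I) (𝓝[>] 0) (𝓝 s) := by
    have : Continuous (fun ε : ℝ => (s : ℂ) + ε * Complex.I) := by fun_prop
    have h := this.tendsto 0
    simp only [Complex.ofReal_zero, zero_mul, add_zero] at h
    exact h.mono_left nhdsWithin_le_nhds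
  have hsheet := isSqrtSheet_quarticSqrt h₁ h₂ h₃
  have hoff : ∀ (v : ℝ), quarticSqrt α α' β' β s = (v : ℂ) → s ∉ Icc α α' → s ∉ Icc β' β →
      Tendsto (fun ε : ℝ => (1 / quarticSqrt α α' β' β (s + ε * Complex.I)).re) (𝓝[>] 0)
        (𝓝 (1 / v)) := by
    intro v hv hl hr
    have hl' := ofReal_notMem_realSegment hl
    have hr' := ofReal_notMem_realSegment hr
    have hc : ContinuousAt (quarticSqrt α α' β' β) s :=
      ((differentiableAt_bandSqrt h₁ hl').mul (differentiableAt_bandSqrt h₃ hr')).continuousAt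
    have h1 := (tendsto_const_nhds (x := (1 : ℂ))).div (hc.tendsto.comp hpath)
      (quarticSqrt_ne_zero h₁ h₃ hl' hr')
    have h2 := (Complex.continuous_re.tendsto _).comp h1
    rw [hv, ← Complex.ofReal_one, ← Complex.ofReal_div, Complex.ofReal_re] at h2
    exact h2
  have hband : (s - α) * (s - α') * (s - β') * (s - β) < 0 → bandField α α' β' β s = 0 →
      Tendsto (fun ε : ℝ => (1 / quarticSqrt α α' β' β (s + ε * Complex.I)).re) (𝓝[>] 0)
        (𝓝 (bandField α α' β' β s)) := by
    intro hneg h0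
    rw [h0]
    refine re_tendsto_zero_of_sq_tendsto
      (r := 1 / ((s - α) * (s - α') * (s - β') * (s - β))) (one_div_neg.2 hneg).le ?_
    have hR : Tendsto (fun ε : ℝ => 1 / (((s : ℂ) + ε * Complex.I - α) * (s + ε * Complex.I - α')
        * (s + ε * Complex.I - β') * (s + ε * Complex.I - β))) (𝓝[>] 0)
        (𝓝 ((1 / ((s - α) * (s - α') * (s - β') * (s - β)) : ℝ) : ℂ)) := by
      push_cast
      refine tendsto_const_nhds.div ((((hpath.sub_const _).mul (hpath.sub_const _)).mul
        (hpath.sub_const _)).mul (hpath.sub_const _)) ?_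
      exact_mod_cast hneg.ne
    refine hR.congr' ?_
    filter_upwards [self_mem_nhdsWithin] with ε hε
    have him := add_mul_I_im_ne (s := s) hε
    rw [div_pow, one_pow, hsheet.sq_eq _ (by simp [notMem_realSegment_of_im_ne_zero him])]
  obtain ⟨n1, n2, n3, n4⟩ := hs
  rcases lt_or_gt_of_ne n1 with a | a
  · have e1 : 0 < α - s := by linarith
    have e2 : 0 < α' - s := by linarith
    have e3 : 0 < β' - s := by linarith
    have e4 : 0 < β - s := by linarith
    convert hoff (Real.sqrt ((α - s) * (α' - s)) * Real.sqrt ((β' - s) * (β - s))) ?_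
      (fun h => a.not_ge h.1) (fun h => by linarith [h.1]) using 2
    · rw [bandField, if_pos (Or.inl a), invSqrtAbs, ← Real.sqrt_mul (by positivity),
        ← abs_of_pos (show 0 < (α - s) * (α' - s) * ((β' - s) * (β - s)) by positivity)]
      congr 3; ring
    · rw [quarticSqrt, bandSqrt_ofReal_of_lt h₁ a, bandSqrt_ofReal_of_lt h₃ (by linarith)]
      push_cast; ring
  rcases lt_or_gt_of_ne n2 with b | b
  · have e1 : 0 < s - α := by linarith
    have e2 : 0 < α' - s := by linarith
    have e3 : 0 < β' - s := by linarith
    have e4 : 0 < β - s := by linarith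
    refine hband ?_ ?_
    · have : 0 < (s - α) * (α' - s) * (β' - s) * (β - s) := by positivity
      linarith
    · rw [bandField, if_neg (by rintro (h | h) <;> linarith), if_neg (by rintro ⟨h, _⟩; linarith)]
  rcases lt_or_gt_of_ne n3 with c | c
  · have e1 : 0 < s - α := by linarith
    have e2 : 0 < s - α' := by linarith
    have e3 : 0 < β' - s := by linarith
    have e4 : 0 < β - s := by linarith
    convert hoff (-(Real.sqrt ((s - α) * (s - α')) * Real.sqrt ((β' - s) * (β - s)))) ?_
      (fun h => b.not_ge h.2) (fun h => by linarith [h.1]) using 2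
    · rw [bandField, if_neg (by rintro (h | h) <;> linarith), if_pos ⟨b, c⟩, invSqrtAbs,
        ← Real.sqrt_mul (by positivity), div_neg,
        ← abs_of_pos (show 0 < (s - α) * (s - α') * ((β' - s) * (β - s)) by positivity)]
      congr 4; ring
    · rw [quarticSqrt, bandSqrt_ofReal_of_gt h₁ b, bandSqrt_ofReal_of_lt h₃ c]
      push_cast; ring
  rcases lt_or_gt_of_ne n4 with d | d
  · have e1 : 0 < s - α := by linarith
    have e2 : 0 < s - α' := by linarith
    have e3 : 0 < s - β' := by linarith
    have e4 : 0 < β - s := by linarith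
    refine hband ?_ ?_
    · have : 0 < (s - α) * (s - α') * (s - β') * (β - s) := by positivity
      linarith
    · rw [bandField, if_neg (by rintro (h | h) <;> linarith), if_neg (by rintro ⟨_, h⟩; linarith)]
  · have e1 : 0 < s - α := by linarith
    have e2 : 0 < s - α' := by linarith
    have e3 : 0 < s - β' := by linarith
    have e4 : 0 < s - β := by linarith
    convert hoff (Real.sqrt ((s - α) * (s - α')) * Real.sqrt ((s - β') * (s - β))) ?_
      (fun h => by linarith [h.2]) (fun h => by linarith [h.2]) using 2
    · rw [bandField, if_pos (Or.inr d), invSqrtAbs, ← Real.sqrt_mul (by positivity),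
        ← abs_of_pos (show 0 < (s - α) * (s - α') * ((s - β') * (s - β)) by positivity)]
      congr 3; ring
    · rw [quarticSqrt, bandSqrt_ofReal_of_gt h₁ (by linarith), bandSqrt_ofReal_of_gt h₃ d]
      push_cast; ring

lemma tendsto_add_mul_I_cobounded (ε : ℝ) {l : Filter ℝ} (hl : Tendsto (fun s : ℝ => |s|) l atTop) :
    Tendsto (fun s : ℝ => (s : ℂ) + ε * Complex.I) l (Bornology.cobounded ℂ) := by
  rw [← tendsto_norm_atTop_iff_cobounded]
  refine tendsto_atTop_mono (fun s => ?_) hl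
  simpa using Complex.abs_re_le_norm ((s : ℂ) + ε * Complex.I)

lemma hasDerivAt_stieltjes_line {α α' β' β : ℝ} (h₁ : α < α') (h₂ : α' < β') (h₃ : β' < β)
    {ε : ℝ} (hε : 0 < ε) (s : ℝ) :
    HasDerivAt (fun s : ℝ => stieltjes (bandDensity α α' β' β) (s + ε * Complex.I))
      (-(1 / quarticSqrt α α' β' β (s + ε * Complex.I))) s := by
  have h := hasDerivAt_stieltjes_bandDensity h₁ h₂ h₃ (z := s + ε * Complex.I)
    (notMem_realSegment_of_im_ne_zero (add_mul_I_im_ne hε))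
  have hl : HasDerivAt (fun s : ℝ => (s : ℂ) + ε * Complex.I) 1 s :=
    (Complex.ofRealCLM.hasDerivAt (x := s)).add_const _
  have h' := h.comp s hl
  rw [mul_one] at h'
  exact h'

lemma integrable_inv_quarticSqrt_line {α α' β' β : ℝ} (h₁ : α < α') (h₂ : α' < β') (h₃ : β' < β)
    (hN : Integrable (invSqrtAbs α α' β' β)) {ε : ℝ} (hε : 0 < ε) :
    Integrable (fun s : ℝ => 1 / quarticSqrt α α' β' β (s + ε * Complex.I)) := by
  refine hN.mono' ?_ ?_
  · have hc : Continuous (fun s : ℝ => 1 / quarticSqrt α α' β' β (s + ε * Complex.I)) := by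
      rw [continuous_iff_continuousAt]
      intro s
      have him := add_mul_I_im_ne (s := s) hε
      have hl : ((s : ℂ) + ε * Complex.I) ∉ realSegment α α' := notMem_realSegment_of_im_ne_zero him
      have hr : ((s : ℂ) + ε * Complex.I) ∉ realSegment β' β := notMem_realSegment_of_im_ne_zero him
      have hq : ContinuousAt (quarticSqrt α α' β' β) ((s : ℂ) + ε * Complex.I) :=
        ((differentiableAt_bandSqrt h₁ hl).mul (differentiableAt_bandSqrt h₃ hr)).continuousAt
      refine continuousAt_const.div (ContinuousAt.comp (g := quarticSqrt α α' β' β) hq ?_)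
        (quarticSqrt_ne_zero h₁ h₃ hl hr)
      fun_prop
    exact hc.aestronglyMeasurable
  · filter_upwards [ae_ne_endpoints α α' β' β] with s hs
    exact norm_inv_quarticSqrt_le h₁ h₂ h₃ hε hs

lemma tendsto_stieltjes_bandDensity {α α' β' β : ℝ} (h₁ : α < α') (h₂ : α' < β') (h₃ : β' < β) :
    Tendsto (stieltjes (bandDensity α α' β' β)) (Bornology.cobounded ℂ) (𝓝 0) :=
  tendsto_stieltjes (integrable_bandDensity h₁ h₂ h₃)
    fun _ hx => bandDensity_eq_zero fun h => hx (Ioo_subset_Icc_self h)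

lemma stieltjes_eq_integral_Ioi {α α' β' β : ℝ} (h₁ : α < α') (h₂ : α' < β') (h₃ : β' < β)
    (hN : Integrable (invSqrtAbs α α' β' β)) {ε : ℝ} (hε : 0 < ε) (x : ℝ) :
    (stieltjes (bandDensity α α' β' β) (x + ε * Complex.I)).re
      = ∫ s in Ioi x, (1 / quarticSqrt α α' β' β (s + ε * Complex.I)).re := by
  have hi := integrable_inv_quarticSqrt_line h₁ h₂ h₃ hN hε
  have h := integral_Ioi_of_hasDerivAt_of_tendsto' (a := x)
    (fun s _ => hasDerivAt_stieltjes_line h₁ h₂ h₃ hε s) hi.neg.integrableOn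
    ((tendsto_stieltjes_bandDensity h₁ h₂ h₃).comp
      (tendsto_add_mul_I_cobounded ε tendsto_abs_atTop_atTop))
  rw [integral_neg, zero_sub, neg_inj] at h
  rw [← h]
  exact (Complex.reCLM.integral_comp_comm hi.integrableOn).symm

/-- The resolvent vanishes at both ends of the horizontal line, so its derivative integrates to
zero. In the limit this lets `bandForce` be computed from the left as well as from the right. -/
lemma integral_re_inv_quarticSqrt {α α' β' β : ℝ} (h₁ : α < α') (h₂ : α' < β') (h₃ : β' < β)
    (hN : Integrable (invSqrtAbs α α' β' β)) {ε : ℝ} (hε : 0 < ε) :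
    ∫ s : ℝ, (1 / quarticSqrt α α' β' β (s + ε * Complex.I)).re = 0 := by
  have hi := integrable_inv_quarticSqrt_line h₁ h₂ h₃ hN hε
  have h := integral_of_hasDerivAt_of_tendsto
    (fun s => hasDerivAt_stieltjes_line h₁ h₂ h₃ hε s) hi.neg
    ((tendsto_stieltjes_bandDensity h₁ h₂ h₃).comp
      (tendsto_add_mul_I_cobounded ε tendsto_abs_atBot_atTop))
    ((tendsto_stieltjes_bandDensity h₁ h₂ h₃).comp
      (tendsto_add_mul_I_cobounded ε tendsto_abs_atTop_atTop))
  rw [integral_neg, sub_zero, neg_eq_zero] at h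
  have h2 := Complex.reCLM.integral_comp_comm hi
  rw [h] at h2
  simpa using h2

/-- The principal value of the resolvent on the real line. -/
def bandForce (α α' β' β x : ℝ) : ℝ := ∫ s in Ioi x, bandField α α' β' β s

lemma tendsto_setIntegral_re_inv_quarticSqrt {α α' β' β : ℝ} (h₁ : α < α') (h₂ : α' < β')
    (h₃ : β' < β) (hN : Integrable (invSqrtAbs α α' β' β)) (S : Set ℝ) :
    Tendsto (fun ε : ℝ => ∫ s in S, (1 / quarticSqrt α α' β' β (s + ε * Complex.I)).re) (𝓝[>] 0)
      (𝓝 (∫ s in S, bandField α α' β' β s)) := by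
  refine tendsto_integral_filter_of_dominated_convergence (invSqrtAbs α α' β' β) ?_ ?_
    hN.integrableOn ?_
  · filter_upwards [self_mem_nhdsWithin] with ε hε
    exact (integrable_inv_quarticSqrt_line h₁ h₂ h₃ hN hε).re.integrableOn.aestronglyMeasurable
  · filter_upwards [self_mem_nhdsWithin] with ε hε
    filter_upwards [ae_restrict_of_ae (ae_ne_endpoints α α' β' β)] with s hs
    exact (Complex.abs_re_le_norm _).trans (norm_inv_quarticSqrt_le h₁ h₂ h₃ hε hs)
  · filter_upwards [ae_restrict_of_ae (ae_ne_endpoints α α' β' β)] with s hs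
    exact tendsto_re_inv_quarticSqrt h₁ h₂ h₃ hs

lemma integral_bandField {α α' β' β : ℝ} (h₁ : α < α') (h₂ : α' < β') (h₃ : β' < β)
    (hN : Integrable (invSqrtAbs α α' β' β)) : ∫ s, bandField α α' β' β s = 0 := by
  have h := tendsto_setIntegral_re_inv_quarticSqrt h₁ h₂ h₃ hN univ
  simp only [Measure.restrict_univ] at h
  refine tendsto_nhds_unique (h.congr' (f₂ := fun _ => 0) ?_) tendsto_const_nhds
  filter_upwards [self_mem_nhdsWithin] with ε hε
  exact integral_re_inv_quarticSqrt h₁ h₂ h₃ hN hε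

lemma tendsto_re_stieltjes {α α' β' β : ℝ} (h₁ : α < α') (h₂ : α' < β') (h₃ : β' < β)
    (hN : Integrable (invSqrtAbs α α' β' β)) (x : ℝ) :
    Tendsto (fun ε : ℝ => (stieltjes (bandDensity α α' β' β) (x + ε * Complex.I)).re) (𝓝[>] 0)
      (𝓝 (bandForce α α' β' β x)) := by
  refine (tendsto_setIntegral_re_inv_quarticSqrt h₁ h₂ h₃ hN (Ioi x)).congr' ?_
  filter_upwards [self_mem_nhdsWithin] with ε hε
  exact (stieltjes_eq_integral_Ioi h₁ h₂ h₃ hN hε x).symm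

lemma abs_re_stieltjes_le {α α' β' β : ℝ} (h₁ : α < α') (h₂ : α' < β') (h₃ : β' < β)
    (hN : Integrable (invSqrtAbs α α' β' β)) {ε : ℝ} (hε : 0 < ε) (x : ℝ) :
    |(stieltjes (bandDensity α α' β' β) (x + ε * Complex.I)).re|
      ≤ ∫ s, invSqrtAbs α α' β' β s := by
  rw [stieltjes_eq_integral_Ioi h₁ h₂ h₃ hN hε]
  rw [← Real.norm_eq_abs]
  refine (norm_integral_le_of_norm_le (hN.integrableOn (s := Ioi x)) ?_).trans
    (setIntegral_le_integral hN (Eventually.of_forall (invSqrtAbs_nonneg α α' β' β)))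
  filter_upwards [ae_restrict_of_ae (ae_ne_endpoints α α' β' β)] with s hs
  exact (Complex.abs_re_le_norm _).trans (norm_inv_quarticSqrt_le h₁ h₂ h₃ hε hs)

/-! ### The logarithmic potential -/

/-- The logarithmic potential of a density. -/
def logPotential (ρ : ℝ → ℝ) (x : ℝ) : ℝ := ∫ y, ρ y * Real.log (1 / |x - y|)

lemma integrableOn_log_abs_sub (x a b : ℝ) :
    IntegrableOn (fun y => Real.log |x - y|) (Icc a b) := by
  rcases le_or_gt a b with hab | hab
  · have h : IntervalIntegrable (fun y => Real.log (x - y)) volume a b := by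
      have := (intervalIntegral.intervalIntegrable_log' (a := x - a) (b := x - b))
      simpa using this.comp_sub_left x
    rw [intervalIntegrable_iff_integrableOn_Icc_of_le hab] at h
    simpa using h
  · rw [Icc_eq_empty hab.not_ge]
    exact integrableOn_empty

lemma integrable_mul_of_eq_zero_off {ρ g : ℝ → ℝ} {a b : ℝ} (hρ : Continuous ρ)
    (hρ0 : ∀ x, x ∉ Icc a b → ρ x = 0) (hg : IntegrableOn g (Icc a b)) :
    Integrable (fun y => ρ y * g y) := by
  have h1 : IntegrableOn (fun y => ρ y * g y) (Icc a b) :=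
    hg.continuousOn_mul hρ.continuousOn isCompact_Icc
  refine (integrableOn_iff_integrable_of_support_subset fun y hy => ?_).1 h1
  by_contra h
  exact hy (by simp [hρ0 y h])

lemma integrable_mul_log_abs_sub {ρ : ℝ → ℝ} {a b : ℝ} (hρ : Continuous ρ)
    (hρ0 : ∀ x, x ∉ Icc a b → ρ x = 0) (x : ℝ) :
    Integrable (fun y => ρ y * Real.log |x - y|) :=
  integrable_mul_of_eq_zero_off hρ hρ0 (integrableOn_log_abs_sub x a b)

lemma integrable_mul_log_sq_add {ρ : ℝ → ℝ} {a b : ℝ} (hρ : Continuous ρ)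
    (hρ0 : ∀ x, x ∉ Icc a b → ρ x = 0) (x : ℝ) {ε : ℝ} (hε : 0 < ε) :
    Integrable (fun y => ρ y * Real.log ((x - y) ^ 2 + ε ^ 2)) := by
  refine integrable_mul_of_eq_zero_off hρ hρ0 (Continuous.integrableOn_Icc ?_)
  exact Continuous.log (by fun_prop) fun y => by positivity

/-- The logarithmic potential regularized at scale `ε`. -/
def smoothPotential (ρ : ℝ → ℝ) (ε x : ℝ) : ℝ := -∫ y, ρ y * (Real.log ((x - y) ^ 2 + ε ^ 2) / 2)

lemma hasDerivAt_smoothPotential {ρ : ℝ → ℝ} {a b : ℝ} (hρ : Continuous ρ)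
    (hρ0 : ∀ x, x ∉ Icc a b → ρ x = 0) {ε : ℝ} (hε : 0 < ε) (x : ℝ) :
    HasDerivAt (smoothPotential ρ ε) (-(stieltjes ρ (x + ε * Complex.I)).re) x := by
  have hρi : Integrable ρ := by
    simpa using integrable_mul_of_eq_zero_off (g := fun _ => 1) hρ hρ0
      continuous_const.integrableOn_Icc
  have hre : (stieltjes ρ (x + ε * Complex.I)).re
      = ∫ y, ρ y * ((x - y) / ((x - y) ^ 2 + ε ^ 2)) := by
    have hi : Integrable (fun y : ℝ => ρ y • (1 / ((x : ℂ) + ε * Complex.I - (y : ℂ)))) := by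
      refine Integrable.mono' (hρi.norm.mul_const (1 / ε)) ?_ (Eventually.of_forall fun y => ?_)
      · exact hρ.aestronglyMeasurable.smul (Measurable.aestronglyMeasurable (by fun_prop))
      · rw [norm_smul, norm_div, norm_one]
        gcongr
        simpa [abs_of_pos hε] using Complex.abs_im_le_norm ((x : ℂ) + ε * Complex.I - y)
    have h2 := Complex.reCLM.integral_comp_comm hi
    rw [stieltjes]
    refine h2.symm.trans ?_
    congr 1
    ext y
    simp [Complex.normSq_apply]
    left
    ring_nf
  rw [hre]
  refine HasDerivAt.fun_neg ?_
  refine (hasDerivAt_integral_of_dominated_loc_of_deriv_le (μ := volume) (x₀ := x)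
    (F := fun (x y : ℝ) => ρ y * (Real.log ((x - y) ^ 2 + ε ^ 2) / 2))
    (F' := fun (x y : ℝ) => ρ y * ((x - y) / ((x - y) ^ 2 + ε ^ 2)))
    (bound := fun y => ‖ρ y‖ * (1 / ε)) univ_mem ?_ ?_ ?_ ?_ ?_ ?_).2
  · exact Eventually.of_forall fun x => hρ.aestronglyMeasurable.mul
      (Measurable.aestronglyMeasurable (by fun_prop))
  · have h := (integrable_mul_log_sq_add hρ hρ0 x hε).div_const 2
    simpa only [mul_div_assoc] using h
  · exact hρ.aestronglyMeasurable.mul (Measurable.aestronglyMeasurable (by fun_prop))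
  · refine Eventually.of_forall fun y x _ => ?_
    rw [norm_mul]
    gcongr
    rw [Real.norm_eq_abs, abs_div, abs_of_pos (show 0 < (x - y) ^ 2 + ε ^ 2 by positivity),
      div_le_div_iff₀ (by positivity) hε]
    nlinarith [sq_nonneg (|x - y| - ε), sq_abs (x - y), abs_nonneg (x - y)]
  · exact hρi.norm.mul_const _
  · refine Eventually.of_forall fun y x _ => ?_
    have h1 : HasDerivAt (fun x : ℝ => (x - y) ^ 2 + ε ^ 2) (2 * (x - y)) x := by
      have := (((hasDerivAt_id x).sub_const y).fun_pow 2).add_const (ε ^ 2)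
      simpa using this
    have h2 := ((h1.log (by positivity)).div_const 2).const_mul (ρ y)
    rw [mul_div_assoc, mul_div_right_comm, div_self two_ne_zero, one_mul] at h2
    exact h2

lemma tendsto_smoothPotential {ρ : ℝ → ℝ} {a b : ℝ} (hρ : Continuous ρ)
    (hρ0 : ∀ x, x ∉ Icc a b → ρ x = 0) (x : ℝ) :
    Tendsto (fun ε => smoothPotential ρ ε x) (𝓝[>] 0) (𝓝 (logPotential ρ x)) := by
  have hlog : logPotential ρ x = -∫ y, ρ y * Real.log |x - y| := by
    rw [logPotential, ← integral_neg]
    congr 1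
    ext y
    rw [one_div, Real.log_inv, mul_neg]
  rw [hlog]
  refine Tendsto.neg ?_
  -- For `ε < 1` the regularized logarithm lies between `2 log |x - y|` and `(x - y)² + 1`. Both are
  -- integrable against `ρ`.
  have hsq : Integrable (fun y => ρ y * ((x - y) ^ 2 + 1)) :=
    integrable_mul_of_eq_zero_off hρ hρ0 (Continuous.integrableOn_Icc (by fun_prop))
  refine tendsto_integral_filter_of_dominated_convergence
    (fun y => ‖ρ y * Real.log |x - y|‖ + ‖ρ y * ((x - y) ^ 2 + 1)‖) ?_ ?_
    ((integrable_mul_log_abs_sub hρ hρ0 x).norm.add hsq.norm) ?_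
  · exact Eventually.of_forall fun ε => hρ.aestronglyMeasurable.mul
      (Measurable.aestronglyMeasurable (by fun_prop))
  · filter_upwards [Ioo_mem_nhdsGT (zero_lt_one (α := ℝ))] with ε hε
    have hxy : ∀ᵐ y : ℝ, y ≠ x := compl_mem_ae_iff.2 (measure_singleton x)
    filter_upwards [hxy] with y hy
    rw [norm_mul, norm_mul, norm_mul, ← mul_add]
    gcongr
    have hpos : 0 < |x - y| := abs_pos.2 (sub_ne_zero.2 hy.symm)
    have h1 : Real.log (|x - y| ^ 2) = 2 * Real.log |x - y| := by
      rw [Real.log_pow]; norm_num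
    have h2 : Real.log (|x - y| ^ 2) ≤ Real.log ((x - y) ^ 2 + ε ^ 2) := by
      apply Real.log_le_log (by positivity)
      rw [sq_abs]
      nlinarith [sq_nonneg ε]
    have h3 : Real.log ((x - y) ^ 2 + ε ^ 2) ≤ (x - y) ^ 2 + 1 := by
      have h4 := Real.log_le_sub_one_of_pos (show 0 < (x - y) ^ 2 + ε ^ 2 by
        have := hε.1; positivity)
      nlinarith [hε.1, hε.2]
    have h5 : 0 ≤ (x - y) ^ 2 + 1 := by positivity
    rw [Real.norm_eq_abs, Real.norm_eq_abs, Real.norm_of_nonneg h5, abs_le]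
    constructor
    · linarith [neg_abs_le (Real.log |x - y|)]
    · linarith [abs_nonneg (Real.log |x - y|)]
  · have hxy : ∀ᵐ y : ℝ, y ≠ x := compl_mem_ae_iff.2 (measure_singleton x)
    filter_upwards [hxy] with y hy
    have hpos : 0 < |x - y| := abs_pos.2 (sub_ne_zero.2 hy.symm)
    have hc : Tendsto (fun ε : ℝ => (x - y) ^ 2 + ε ^ 2) (𝓝[>] 0) (𝓝 (|x - y| ^ 2)) := by
      have : Continuous (fun ε : ℝ => (x - y) ^ 2 + ε ^ 2) := by fun_prop
      have h := this.tendsto 0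
      simp only [ne_eq, OfNat.ofNat_ne_zero, not_false_eq_true, zero_pow, add_zero] at h
      rw [sq_abs]
      exact h.mono_left nhdsWithin_le_nhds
    have h := ((hc.log (by positivity)).div_const 2).const_mul (ρ y)
    rw [Real.log_pow] at h
    simpa using h

/-- Differentiating under the singular logarithm is avoided. The regularized potential has
derivative `-Re ω(s + iε)`, which is bounded uniformly by the integral of `1 / √|R|`, so its
increments converge to those of the limit. -/
lemma logPotential_bandDensity_sub {α α' β' β : ℝ} (h₁ : α < α') (h₂ : α' < β') (h₃ : β' < β)
    (hN : Integrable (invSqrtAbs α α' β' β)) (x y : ℝ) :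
    logPotential (bandDensity α α' β' β) y - logPotential (bandDensity α α' β' β) x
      = -∫ s in x..y, bandForce α α' β' β s := by
  set ρ := bandDensity α α' β' β with hρdef
  have hρ : Continuous ρ := continuous_bandDensity h₁ h₂ h₃
  have hρ0 : ∀ x, x ∉ Icc α β → ρ x = 0 :=
    fun _ hx => bandDensity_eq_zero fun h => hx (Ioo_subset_Icc_self h)
  have hL := (tendsto_smoothPotential hρ hρ0 y).sub (tendsto_smoothPotential hρ hρ0 x)
  have hcont : ∀ ε : ℝ, 0 < ε → Continuous fun s : ℝ => (stieltjes ρ (s + ε * Complex.I)).re := by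
    intro ε hε
    refine Complex.continuous_re.comp (continuous_iff_continuousAt.2 fun s => ?_)
    exact (hasDerivAt_stieltjes_line h₁ h₂ h₃ hε s).continuousAt
  have hR : Tendsto (fun ε : ℝ => -∫ s in x..y, (stieltjes ρ (s + ε * Complex.I)).re) (𝓝[>] 0)
      (𝓝 (-∫ s in x..y, bandForce α α' β' β s)) := by
    refine Tendsto.neg (intervalIntegral.tendsto_integral_filter_of_dominated_convergence
      (fun _ => ∫ s, invSqrtAbs α α' β' β s) ?_ ?_ (by simp) ?_)
    · filter_upwards [self_mem_nhdsWithin] with ε hε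
      exact (hcont ε hε).aestronglyMeasurable
    · filter_upwards [self_mem_nhdsWithin] with ε hε
      exact Eventually.of_forall fun s _ => abs_re_stieltjes_le h₁ h₂ h₃ hN hε s
    · exact Eventually.of_forall fun s _ => tendsto_re_stieltjes h₁ h₂ h₃ hN s
  refine tendsto_nhds_unique hL (hR.congr' ?_)
  filter_upwards [self_mem_nhdsWithin] with ε hε
  rw [← intervalIntegral.integral_neg]
  exact intervalIntegral.integral_eq_sub_of_hasDerivAt
    (fun s _ => hasDerivAt_smoothPotential hρ hρ0 hε s) ((hcont ε hε).neg.intervalIntegrable _ _)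

/-! ### The force on the line -/

lemma bandField_of_gap {α α' β' β s : ℝ} (h₁ : α < α') (h₃ : β' < β) (hs : s ∈ Ioo α' β') :
    bandField α α' β' β s = -invSqrtAbs α α' β' β s := by
  rw [bandField, if_neg (by rintro (h | h) <;> linarith [hs.1, hs.2]),
    if_pos ⟨hs.1, hs.2⟩]

lemma bandField_le_indicator_Ioi {α α' β' β s : ℝ} (h₁ : α < α') (hs : α' < s) :
    bandField α α' β' β s ≤ (Ioi β).indicator (invSqrtAbs α α' β' β) s := by
  have hn := invSqrtAbs_nonneg α α' β' β s
  unfold bandField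
  by_cases h : β < s
  · rw [if_pos (Or.inr h), indicator_of_mem (show s ∈ Ioi β from h)]
  · rw [if_neg (by rintro (h' | h'); exacts [by linarith, h h']),
      indicator_of_notMem (show s ∉ Ioi β from h)]
    split_ifs
    · linarith
    · exact le_rfl

lemma bandField_le_indicator_Iio {α α' β' β s : ℝ} (h₃ : β' < β) (hs : s < β') :
    bandField α α' β' β s ≤ (Iio α).indicator (invSqrtAbs α α' β' β) s := by
  have hn := invSqrtAbs_nonneg α α' β' β s
  unfold bandField
  by_cases h : s < α
  · rw [if_pos (Or.inl h), indicator_of_mem (show s ∈ Iio α from h)]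
  · rw [if_neg (by rintro (h' | h'); exacts [h h', by linarith]),
      indicator_of_notMem (show s ∉ Iio α from h)]
    split_ifs
    · linarith
    · exact le_rfl

/-- To the right of `α'` the field is nonpositive until `β`, so only the tail beyond `β` can
contribute positively. The bound becomes an equality on the right band, where no gap remains ahead.
-/
lemma bandForce_le {α α' β' β : ℝ} (h₁ : α < α')
    (hN : Integrable (invSqrtAbs α α' β' β)) {x : ℝ} (hx : α' ≤ x) :
    bandForce α α' β' β x ≤ ∫ s in Ioi β, invSqrtAbs α α' β' β s := by
  rw [← integral_indicator measurableSet_Ioi]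
  have hi := hN.indicator (measurableSet_Ioi (a := β))
  refine (setIntegral_mono_on (integrable_bandField hN).integrableOn hi.integrableOn
    measurableSet_Ioi fun s hs => bandField_le_indicator_Ioi h₁ (hx.trans_lt hs)).trans ?_
  exact setIntegral_le_integral hi (Eventually.of_forall fun s =>
    indicator_nonneg (fun s _ => invSqrtAbs_nonneg α α' β' β s) s)

lemma bandForce_eq_of_right {α α' β' β : ℝ} (h₁ : α < α') (h₂ : α' < β') {x : ℝ}
    (hx : x ∈ Icc β' β) :
    bandForce α α' β' β x = ∫ s in Ioi β, invSqrtAbs α α' β' β s := by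
  have hsub : Ioi x ∩ Ioi β = Ioi β := inter_eq_right.2 (Ioi_subset_Ioi hx.2)
  rw [bandForce, ← hsub, ← setIntegral_indicator measurableSet_Ioi]
  refine setIntegral_congr_fun measurableSet_Ioi fun s (hs : x < s) => ?_
  have hβ := hx.1
  simp only [bandField]
  by_cases h : β < s
  · rw [if_pos (Or.inr h), indicator_of_mem (show s ∈ Ioi β from h)]
  · rw [if_neg (by rintro (h' | h'); exacts [by linarith, h h']),
      indicator_of_notMem (show s ∉ Ioi β from h), if_neg (by rintro ⟨_, h'⟩; linarith)]

lemma bandForce_eq_neg_integral_Iic {α α' β' β : ℝ} (h₁ : α < α') (h₂ : α' < β') (h₃ : β' < β)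
    (hN : Integrable (invSqrtAbs α α' β' β)) (x : ℝ) :
    bandForce α α' β' β x = -∫ s in Iic x, bandField α α' β' β s := by
  have hi := integrable_bandField hN
  have h := integral_bandField h₁ h₂ h₃ hN
  rw [← intervalIntegral.integral_Iic_add_Ioi (b := x) hi.integrableOn hi.integrableOn] at h
  rw [bandForce]
  linarith

lemma neg_le_bandForce {α α' β' β : ℝ} (h₁ : α < α') (h₂ : α' < β') (h₃ : β' < β)
    (hN : Integrable (invSqrtAbs α α' β' β)) {x : ℝ} (hx : x ≤ β') :
    -(∫ s in Iio α, invSqrtAbs α α' β' β s) ≤ bandForce α α' β' β x := by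
  rw [bandForce_eq_neg_integral_Iic h₁ h₂ h₃ hN, neg_le_neg_iff,
    ← integral_indicator measurableSet_Iio, integral_Iic_eq_integral_Iio]
  have hi := hN.indicator (measurableSet_Iio (a := α))
  refine (setIntegral_mono_on (integrable_bandField hN).integrableOn hi.integrableOn
    measurableSet_Iio fun s hs => bandField_le_indicator_Iio h₃ (lt_of_lt_of_le hs hx)).trans ?_
  exact setIntegral_le_integral hi (Eventually.of_forall fun s =>
    indicator_nonneg (fun s _ => invSqrtAbs_nonneg α α' β' β s) s)

lemma bandForce_eq_of_left {α α' β' β : ℝ} (h₁ : α < α') (h₂ : α' < β') (h₃ : β' < β)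
    (hN : Integrable (invSqrtAbs α α' β' β)) {x : ℝ} (hx : x ∈ Icc α α') :
    bandForce α α' β' β x = -∫ s in Iio α, invSqrtAbs α α' β' β s := by
  have hsub : Iio x ∩ Iio α = Iio α := inter_eq_right.2 (Iio_subset_Iio hx.1)
  rw [bandForce_eq_neg_integral_Iic h₁ h₂ h₃ hN, integral_Iic_eq_integral_Iio, ← hsub,
    ← setIntegral_indicator measurableSet_Iio]
  congr 1
  refine setIntegral_congr_fun measurableSet_Iio fun s (hs : s < x) => ?_
  have hα := hx.2
  simp only [bandField]
  by_cases h : s < α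
  · rw [if_pos (Or.inl h), indicator_of_mem (show s ∈ Iio α from h)]
  · rw [if_neg (by rintro (h' | h'); exacts [h h', by linarith]),
      indicator_of_notMem (show s ∉ Iio α from h), if_neg (by rintro ⟨h', _⟩; linarith)]

lemma bandForce_sub {α α' β' β : ℝ} (hN : Integrable (invSqrtAbs α α' β' β)) {x y : ℝ}
    (hxy : x ≤ y) :
    bandForce α α' β' β x - bandForce α α' β' β y = ∫ s in x..y, bandField α α' β' β s := by
  have hi := integrable_bandField hN
  rw [bandForce, bandForce, intervalIntegral.integral_of_le hxy, ← Ioc_union_Ioi_eq_Ioi hxy,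
    setIntegral_union (Ioc_disjoint_Ioi le_rfl) measurableSet_Ioi hi.integrableOn hi.integrableOn]
  ring

lemma continuous_bandForce {α α' β' β : ℝ} (hN : Integrable (invSqrtAbs α α' β' β)) :
    Continuous (bandForce α α' β' β) := by
  have hi := integrable_bandField hN
  have h : bandForce α α' β' β
      = fun x => bandForce α α' β' β 0 - ∫ s in (0 : ℝ)..x, bandField α α' β' β s := by
    ext x
    rcases le_total 0 x with h | h
    · rw [← bandForce_sub hN h]; ring
    · rw [intervalIntegral.integral_symm, ← bandForce_sub hN h]; ring
  rw [h]
  exact continuous_const.sub (intervalIntegral.continuous_primitive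
    (fun a b => hi.intervalIntegrable) 0)

lemma integral_bandField_gap_neg {α α' β' β : ℝ} (h₁ : α < α') (h₃ : β' < β)
    (hN : Integrable (invSqrtAbs α α' β' β)) {x y : ℝ} (hx : α' ≤ x) (hxy : x < y) (hy : y ≤ β') :
    ∫ s in x..y, bandField α α' β' β s < 0 := by
  rw [← neg_pos, ← intervalIntegral.integral_neg]
  refine intervalIntegral.intervalIntegral_pos_of_pos_on
    (integrable_bandField hN).neg.intervalIntegrable (fun s hs => ?_) hxy
  have hs' : s ∈ Ioo α' β' := ⟨hx.trans_lt hs.1, hs.2.trans_le hy⟩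
  obtain ⟨e1, e2⟩ := hs'
  rw [bandField_of_gap h₁ h₃ ⟨e1, e2⟩, neg_neg, invSqrtAbs]
  have : (s - α) * (s - α') * (s - β') * (s - β) ≠ 0 := by
    refine mul_ne_zero (mul_ne_zero (mul_ne_zero ?_ ?_) ?_) ?_ <;> rw [sub_ne_zero]
    exacts [by linarith, by linarith, by linarith, by linarith]
  positivity

/-! ### The Euler–Lagrange conditions -/

/-- The equations that determine the end points of the two bands. -/
structure IsMatched (γ ζ α α' β' β : ℝ) : Prop where
  left_lt : α < α'
  gap_lt : α' < β'
  right_lt : β' < β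
  tail_right : ∫ s in Ioi β, invSqrtAbs α α' β' β s = (1 - ζ) / 2
  tail_left : ∫ s in Iio α, invSqrtAbs α α' β' β s = (1 + ζ) / 2
  height : bandHeight α α' β' β = 1 / (2 * γ)
  balance : α' + β' = ζ * (β' - α') + 2 * ∫ s in α'..β', bandForce α α' β' β s

/-- The effective potential of a density in the external field `|x| - ζ x`. -/
def effectivePotential (ζ : ℝ) (ρ : ℝ → ℝ) (x : ℝ) : ℝ :=
  2 * logPotential ρ x + (|x| - ζ * x)

/-- As `|ζ| < 1`, the prescribed tail integrals are nonzero, so they are not the default value of a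
divergent integral. No decay estimate for `1 / √|R|` is needed. -/
lemma integrable_invSqrtAbs_of_tails {α α' β' β ζ : ℝ} (h₁ : α < α') (h₂ : α' < β') (h₃ : β' < β)
    (hζ : ζ ∈ Ioo (-1) 1) (hR : ∫ s in Ioi β, invSqrtAbs α α' β' β s = (1 - ζ) / 2)
    (hL : ∫ s in Iio α, invSqrtAbs α α' β' β s = (1 + ζ) / 2) :
    Integrable (invSqrtAbs α α' β' β) := by
  refine integrable_invSqrtAbs h₁ h₂ h₃ ?_ ?_
  · by_contra h
    rw [integral_undef h] at hL
    linarith [hζ.1]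
  · by_contra h
    rw [integral_undef h] at hR
    linarith [hζ.2]

/-- Across the gap the force increases strictly, from minus the left tail to the right tail. Its
mean therefore lies strictly between these two values. -/
lemma integral_bandForce_gap_mem {α α' β' β : ℝ} (h₁ : α < α') (h₂ : α' < β') (h₃ : β' < β)
    (hN : Integrable (invSqrtAbs α α' β' β)) :
    ∫ s in α'..β', bandForce α α' β' β s ∈
      Ioo (-(∫ s in Iio α, invSqrtAbs α α' β' β s) * (β' - α'))
        ((∫ s in Ioi β, invSqrtAbs α α' β' β s) * (β' - α')) := by
  have hc := continuous_bandForce hN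
  constructor
  · have hpos : 0 < ∫ s in α'..β', (bandForce α α' β' β s - bandForce α α' β' β α') := by
      refine intervalIntegral.intervalIntegral_pos_of_pos_on
        ((hc.sub continuous_const).intervalIntegrable _ _) (fun x hx => ?_) h₂
      have h := integral_bandField_gap_neg h₁ h₃ hN le_rfl hx.1 hx.2.le
      rw [← bandForce_sub hN hx.1.le] at h
      linarith
    rw [intervalIntegral.integral_sub (hc.intervalIntegrable _ _)
      (continuous_const.intervalIntegrable _ _), intervalIntegral.integral_const, smul_eq_mul,
      bandForce_eq_of_left h₁ h₂ h₃ hN (right_mem_Icc.2 h₁.le)] at hpos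
    linarith
  · have hpos : 0 < ∫ s in α'..β', (bandForce α α' β' β β' - bandForce α α' β' β s) := by
      refine intervalIntegral.intervalIntegral_pos_of_pos_on
        ((continuous_const.sub hc).intervalIntegrable _ _) (fun x hx => ?_) h₂
      have h := integral_bandField_gap_neg h₁ h₃ hN hx.1.le hx.2 le_rfl
      rw [← bandForce_sub hN hx.2.le] at h
      linarith
    rw [intervalIntegral.integral_sub (continuous_const.intervalIntegrable _ _)
      (hc.intervalIntegrable _ _), intervalIntegral.integral_const, smul_eq_mul,
      bandForce_eq_of_right h₁ h₂ (left_mem_Icc.2 h₃.le)] at hpos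
    linarith

namespace IsMatched

variable {γ ζ α α' β' β : ℝ}

lemma integrable (h : IsMatched γ ζ α α' β' β) (hζ : ζ ∈ Ioo (-1) 1) :
    Integrable (invSqrtAbs α α' β' β) :=
  integrable_invSqrtAbs_of_tails h.left_lt h.gap_lt h.right_lt hζ h.tail_right h.tail_left

/-- Let `m` be the mean force over the gap. The balance reads `α' + β' = (ζ + 2 m) (β' - α')`, and
`-(1 + ζ) / 2 < m < (1 - ζ) / 2` puts the factor `ζ + 2 m` strictly inside `(-1, 1)`. -/
lemma zero_mem_gap (h : IsMatched γ ζ α α' β' β) (hζ : ζ ∈ Ioo (-1) 1) : α' < 0 ∧ 0 < β' := by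
  have hb := h.balance
  have hm := integral_bandForce_gap_mem h.left_lt h.gap_lt h.right_lt (h.integrable hζ)
  rw [h.tail_right, h.tail_left] at hm
  obtain ⟨hm1, hm2⟩ := hm
  constructor <;> nlinarith

lemma effectivePotential_sub_of_nonneg (h : IsMatched γ ζ α α' β' β) (hζ : ζ ∈ Ioo (-1) 1)
    {x y : ℝ} (hx : 0 ≤ x) (hy : 0 ≤ y) :
    effectivePotential ζ (bandDensity α α' β' β) y - effectivePotential ζ (bandDensity α α' β' β) x
      = 2 * ∫ s in x..y, ((1 - ζ) / 2 - bandForce α α' β' β s) := by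
  have hN := h.integrable hζ
  have hU := logPotential_bandDensity_sub h.left_lt h.gap_lt h.right_lt hN x y
  rw [intervalIntegral.integral_sub (continuous_const.intervalIntegrable _ _)
    ((continuous_bandForce hN).intervalIntegrable _ _), intervalIntegral.integral_const, smul_eq_mul,
    effectivePotential, effectivePotential, abs_of_nonneg hx, abs_of_nonneg hy]
  linear_combination 2 * hU

lemma effectivePotential_sub_of_nonpos (h : IsMatched γ ζ α α' β' β) (hζ : ζ ∈ Ioo (-1) 1)
    {x y : ℝ} (hx : x ≤ 0) (hy : y ≤ 0) :
    effectivePotential ζ (bandDensity α α' β' β) y - effectivePotential ζ (bandDensity α α' β' β) x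
      = -2 * ∫ s in x..y, (bandForce α α' β' β s + (1 + ζ) / 2) := by
  have hN := h.integrable hζ
  have hU := logPotential_bandDensity_sub h.left_lt h.gap_lt h.right_lt hN x y
  rw [intervalIntegral.integral_add ((continuous_bandForce hN).intervalIntegrable _ _)
    (continuous_const.intervalIntegrable _ _), intervalIntegral.integral_const, smul_eq_mul,
    effectivePotential, effectivePotential, abs_of_nonpos hx, abs_of_nonpos hy]
  linear_combination 2 * hU

/-- This is what the balance equation is for. It also uses `α' < 0 < β'`, which fixes the sign of
the kinked field `|x|` at the two points. -/
lemma effectivePotential_left_eq_right (h : IsMatched γ ζ α α' β' β) (hζ : ζ ∈ Ioo (-1) 1) :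
    effectivePotential ζ (bandDensity α α' β' β) α'
      = effectivePotential ζ (bandDensity α α' β' β) β' := by
  have hN := h.integrable hζ
  have hc := continuous_bandForce hN
  obtain ⟨h0, h0'⟩ := h.zero_mem_gap hζ
  have hU := logPotential_bandDensity_sub h.left_lt h.gap_lt h.right_lt hN α' β'
  have hb := h.balance
  rw [effectivePotential, effectivePotential, abs_of_neg h0, abs_of_pos h0']
  linear_combination -hb - 2 * hU

lemma effectivePotential_mono_of_ge (h : IsMatched γ ζ α α' β' β) (hζ : ζ ∈ Ioo (-1) 1)
    {x y : ℝ} (hx : 0 ≤ x) (hxy : x ≤ y) :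
    effectivePotential ζ (bandDensity α α' β' β) x
      ≤ effectivePotential ζ (bandDensity α α' β' β) y := by
  have hN := h.integrable hζ
  rw [← sub_nonneg, h.effectivePotential_sub_of_nonneg hζ hx (hx.trans hxy)]
  refine mul_nonneg zero_le_two (intervalIntegral.integral_nonneg hxy fun s hs => ?_)
  have := bandForce_le h.left_lt hN (x := s) ((h.zero_mem_gap hζ).1.le.trans (hx.trans hs.1))
  rw [h.tail_right] at this
  linarith

lemma effectivePotential_anti_of_le (h : IsMatched γ ζ α α' β' β) (hζ : ζ ∈ Ioo (-1) 1)
    {x y : ℝ} (hy : y ≤ 0) (hxy : x ≤ y) :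
    effectivePotential ζ (bandDensity α α' β' β) y
      ≤ effectivePotential ζ (bandDensity α α' β' β) x := by
  have hN := h.integrable hζ
  rw [← sub_nonpos, h.effectivePotential_sub_of_nonpos hζ (hxy.trans hy) hy]
  refine mul_nonpos_of_nonpos_of_nonneg (by norm_num)
    (intervalIntegral.integral_nonneg hxy fun s hs => ?_)
  have := neg_le_bandForce h.left_lt h.gap_lt h.right_lt hN (x := s)
    (hs.2.trans (hy.trans (h.zero_mem_gap hζ).2.le))
  rw [h.tail_left] at this
  linarith

lemma effectivePotential_of_right (h : IsMatched γ ζ α α' β' β) (hζ : ζ ∈ Ioo (-1) 1)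
    {x : ℝ} (hx : x ∈ Icc β' β) :
    effectivePotential ζ (bandDensity α α' β' β) x
      = effectivePotential ζ (bandDensity α α' β' β) β' := by
  have h0 := (h.zero_mem_gap hζ).2.le
  rw [← sub_eq_zero, h.effectivePotential_sub_of_nonneg hζ h0 (h0.trans hx.1),
    intervalIntegral.integral_congr (g := fun _ => 0), intervalIntegral.integral_zero, mul_zero]
  intro s hs
  rw [uIcc_of_le hx.1] at hs
  simp only
  rw [bandForce_eq_of_right h.left_lt h.gap_lt ⟨hs.1, hs.2.trans hx.2⟩, h.tail_right, sub_self]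

lemma effectivePotential_of_left (h : IsMatched γ ζ α α' β' β) (hζ : ζ ∈ Ioo (-1) 1)
    {x : ℝ} (hx : x ∈ Icc α α') :
    effectivePotential ζ (bandDensity α α' β' β) x
      = effectivePotential ζ (bandDensity α α' β' β) β' := by
  have h0 := (h.zero_mem_gap hζ).1.le
  rw [← h.effectivePotential_left_eq_right hζ, eq_comm, ← sub_eq_zero,
    h.effectivePotential_sub_of_nonpos hζ (hx.2.trans h0) h0,
    intervalIntegral.integral_congr (g := fun _ => 0), intervalIntegral.integral_zero, mul_zero]
  intro s hs
  rw [uIcc_of_le hx.2] at hs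
  simp only
  rw [bandForce_eq_of_left h.left_lt h.gap_lt h.right_lt (h.integrable hζ)
    ⟨hx.1.trans hs.1, hs.2⟩, h.tail_left, neg_add_cancel]

/-- The kink of `|x|` lies in the gap. From it the effective potential climbs towards both ends,
where it takes the common value. -/
lemma effectivePotential_of_gap (h : IsMatched γ ζ α α' β' β) (hζ : ζ ∈ Ioo (-1) 1)
    {x : ℝ} (hx : x ∈ Icc α' β') :
    effectivePotential ζ (bandDensity α α' β' β) x
      ≤ effectivePotential ζ (bandDensity α α' β' β) β' := by
  rcases le_total 0 x with h0 | h0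
  · exact h.effectivePotential_mono_of_ge hζ h0 hx.2
  · rw [← h.effectivePotential_left_eq_right hζ]
    exact h.effectivePotential_anti_of_le hζ h0 hx.1

lemma effectivePotential_of_outside (h : IsMatched γ ζ α α' β' β) (hζ : ζ ∈ Ioo (-1) 1)
    {x : ℝ} (hx : x ∉ Icc α β) :
    effectivePotential ζ (bandDensity α α' β' β) β'
      ≤ effectivePotential ζ (bandDensity α α' β' β) x := by
  obtain ⟨h0, h0'⟩ := h.zero_mem_gap hζ
  rw [mem_Icc, not_and_or, not_le, not_le] at hx
  rcases hx with hx | hx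
  · rw [← h.effectivePotential_left_eq_right hζ]
    exact h.effectivePotential_anti_of_le hζ h0.le (hx.trans h.left_lt).le
  · exact h.effectivePotential_mono_of_ge hζ h0'.le (h.right_lt.trans hx).le

/-- The Euler–Lagrange inequality against any density bounded by the height of the plateau. -/
lemma euler_lagrange (h : IsMatched γ ζ α α' β' β) (hζ : ζ ∈ Ioo (-1) 1) {x r : ℝ}
    (hr0 : 0 ≤ r) (hr : r ≤ 1 / (2 * γ)) :
    0 ≤ (r - bandDensity α α' β' β x) * (effectivePotential ζ (bandDensity α α' β' β) x
      - effectivePotential ζ (bandDensity α α' β' β) β') := by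
  by_cases hx : x ∈ Icc α β
  · rcases le_total x α' with h1 | h1
    · rw [h.effectivePotential_of_left hζ ⟨hx.1, h1⟩, sub_self, mul_zero]
    rcases le_total x β' with h2 | h2
    · rw [bandDensity_eq_height ⟨h1, h2⟩, h.height]
      exact mul_nonneg_of_nonpos_of_nonpos (by linarith)
        (sub_nonpos.2 (h.effectivePotential_of_gap hζ ⟨h1, h2⟩))
    · rw [h.effectivePotential_of_right hζ ⟨h2, hx.2⟩, sub_self, mul_zero]
  · rw [bandDensity_eq_zero fun h => hx (Ioo_subset_Icc_self h), sub_zero]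
    exact mul_nonneg hr0 (sub_nonneg.2 (h.effectivePotential_of_outside hζ hx))

end IsMatched

/-! ### Elliptic integrals -/

/-- The elliptic integrand `1 / √|(1 - u²) (κ² - u²)|`. -/
def ellipticIntegrand (κ u : ℝ) : ℝ := 1 / Real.sqrt |(1 - u ^ 2) * (κ ^ 2 - u ^ 2)|

lemma ellipticIntegrand_nonneg (κ u : ℝ) : 0 ≤ ellipticIntegrand κ u := by
  unfold ellipticIntegrand; positivity

lemma ellipticIntegrand_inner {κ u : ℝ} (hκ : 1 < κ) (hu : u ∈ Ioo (-1 : ℝ) 1) :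
    1 / Real.sqrt ((u - -1) * (1 - u) * (κ ^ 2 - u ^ 2)) = ellipticIntegrand κ u := by
  have e1 : 0 < u - -1 := by linarith [hu.1]
  have e2 : 0 < 1 - u := by linarith [hu.2]
  have e3 : 0 < κ ^ 2 - u ^ 2 := by nlinarith [hu.1, hu.2]
  rw [ellipticIntegrand, ← abs_of_pos (show 0 < (u - -1) * (1 - u) * (κ ^ 2 - u ^ 2) by positivity)]
  congr 3
  ring

lemma ellipticIntegrand_outer {κ u : ℝ} (hu : u ∈ Ioo (-κ) (-1)) :
    1 / Real.sqrt ((u - -κ) * (-1 - u) * ((κ - u) * (1 - u))) = ellipticIntegrand κ u := by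
  have e1 : 0 < u - -κ := by linarith [hu.1]
  have e2 : 0 < -1 - u := by linarith [hu.2]
  have e3 : 0 < κ - u := by linarith [hu.2]
  have e4 : 0 < 1 - u := by linarith [hu.2]
  rw [ellipticIntegrand,
    ← abs_of_pos (show 0 < (u - -κ) * (-1 - u) * ((κ - u) * (1 - u)) by positivity), ← abs_neg]
  congr 3
  ring

lemma integrableOn_ellipticIntegrand_inner {κ : ℝ} (hκ : 1 < κ) :
    IntegrableOn (ellipticIntegrand κ) (Ioo (-1) 1) := by
  refine (integrableOn_inv_sqrt_arcsine_mul (by norm_num) (show 0 < κ ^ 2 - 1 by nlinarith)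
    (g := fun u => κ ^ 2 - u ^ 2) (by fun_prop) fun u hu => ?_).congr_fun
    (fun u hu => ellipticIntegrand_inner hκ hu) measurableSet_Ioo
  nlinarith [hu.1, hu.2]

lemma integrableOn_ellipticIntegrand_outer {κ : ℝ} (hκ : 1 < κ) :
    IntegrableOn (ellipticIntegrand κ) (Ioo (-κ) (-1)) := by
  refine (integrableOn_inv_sqrt_arcsine_mul (by linarith) (show (0 : ℝ) < 4 by norm_num)
    (g := fun u => (κ - u) * (1 - u)) (by fun_prop) fun u hu => ?_).congr_fun
    (fun u hu => ellipticIntegrand_outer hu) measurableSet_Ioo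
  nlinarith [hu.1, hu.2]

/-- The cosine substitution absorbs the end point singularities and fixes the domain. The periods
become integrals over `[0, π]` of functions jointly continuous in `κ` and `θ`. -/
lemma integral_inv_sqrt_arcsine_mul {a b : ℝ} (hab : a < b) (g : ℝ → ℝ) :
    ∫ y in Ioo a b, 1 / Real.sqrt ((y - a) * (b - y) * g y)
      = ∫ θ in (0 : ℝ)..Real.pi,
        1 / Real.sqrt (g ((a + b) / 2 - (b - a) / 2 * Real.cos θ)) := by
  have h := (integral_arcsineMeasure a b fun y => 1 / Real.sqrt (g y)).symm.trans
    (integral_arcsineMeasure_eq_integral_cos hab _)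
  rw [intervalIntegral.integral_of_le Real.pi_pos.le, integral_Ioc_eq_integral_Ioo]
  have hpi := Real.pi_pos.ne'
  calc _ = Real.pi * ∫ y in Ioo a b, (1 / (Real.pi * Real.sqrt ((y - a) * (b - y)))) •
        (1 / Real.sqrt (g y)) := by
        rw [← integral_const_mul]
        refine setIntegral_congr_fun measurableSet_Ioo fun y hy => ?_
        have e1 : 0 < y - a := by linarith [hy.1]
        have e2 : 0 < b - y := by linarith [hy.2]
        simp only [smul_eq_mul]
        rw [Real.sqrt_mul (by positivity)]
        field_simp
    _ = _ := by
        rw [h, smul_eq_mul]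
        field_simp

/-- The real period of the elliptic integrand. -/
def innerPeriod (κ : ℝ) : ℝ := ∫ u in Ioo (-1 : ℝ) 1, ellipticIntegrand κ u

/-- The imaginary period of the elliptic integrand. -/
def outerPeriod (κ : ℝ) : ℝ := ∫ u in Ioo (-κ) (-1), ellipticIntegrand κ u

lemma innerPeriod_eq {κ : ℝ} (hκ : 1 < κ) :
    innerPeriod κ = ∫ θ in (0 : ℝ)..Real.pi, 1 / Real.sqrt (κ ^ 2 - Real.cos θ ^ 2) := by
  rw [innerPeriod, ← setIntegral_congr_fun measurableSet_Ioo
    (fun u hu => ellipticIntegrand_inner hκ hu),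
    integral_inv_sqrt_arcsine_mul (by norm_num) fun u => κ ^ 2 - u ^ 2]
  congr 1
  ext θ
  congr 3
  ring

lemma outerPeriod_eq {κ : ℝ} (hκ : 1 < κ) :
    outerPeriod κ = ∫ θ in (0 : ℝ)..Real.pi,
      1 / Real.sqrt ((κ - ((-κ + -1) / 2 - (-1 - -κ) / 2 * Real.cos θ))
        * (1 - ((-κ + -1) / 2 - (-1 - -κ) / 2 * Real.cos θ))) := by
  rw [outerPeriod, ← setIntegral_congr_fun measurableSet_Ioo
    (fun u hu => ellipticIntegrand_outer hu),
    integral_inv_sqrt_arcsine_mul (by linarith) fun u => (κ - u) * (1 - u)]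

lemma outer_radicand_ge {κ : ℝ} (hκ : 1 < κ) (θ : ℝ) :
    4 ≤ (κ - ((-κ + -1) / 2 - (-1 - -κ) / 2 * Real.cos θ))
        * (1 - ((-κ + -1) / 2 - (-1 - -κ) / 2 * Real.cos θ)) := by
  have h : (-κ + -1) / 2 - (-1 - -κ) / 2 * Real.cos θ ≤ -1 := by
    nlinarith [Real.neg_one_le_cos θ]
  nlinarith

lemma continuous_innerPeriod : Continuous fun κ : Ioi (1 : ℝ) => innerPeriod κ := by
  have h : (fun κ : Ioi (1 : ℝ) => innerPeriod κ) = fun κ : Ioi (1 : ℝ) =>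
      ∫ θ in (0 : ℝ)..Real.pi, 1 / Real.sqrt ((κ : ℝ) ^ 2 - Real.cos θ ^ 2) := by
    ext κ
    exact innerPeriod_eq κ.2
  rw [h]
  refine intervalIntegral.continuous_parametric_intervalIntegral_of_continuous' ?_ _ _
  refine continuous_const.div (by fun_prop) fun p => (Real.sqrt_pos.2 ?_).ne'
  have h1 : (1 : ℝ) < p.1 := p.1.2
  nlinarith [Real.cos_sq_le_one p.2]

lemma continuous_outerPeriod : Continuous fun κ : Ioi (1 : ℝ) => outerPeriod κ := by
  have h : (fun κ : Ioi (1 : ℝ) => outerPeriod κ) = fun κ : Ioi (1 : ℝ) =>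
      ∫ θ in (0 : ℝ)..Real.pi,
      1 / Real.sqrt (((κ : ℝ) - ((-κ + -1) / 2 - (-1 - -κ) / 2 * Real.cos θ))
        * (1 - ((-κ + -1) / 2 - (-1 - -κ) / 2 * Real.cos θ))) := by
    ext κ
    exact outerPeriod_eq κ.2
  rw [h]
  refine intervalIntegral.continuous_parametric_intervalIntegral_of_continuous' ?_ _ _
  refine continuous_const.div (by fun_prop) fun p => (Real.sqrt_pos.2 ?_).ne'
  exact (by norm_num : (0 : ℝ) < 4).trans_le (outer_radicand_ge p.1.2 p.2)

lemma innerPeriod_pos {κ : ℝ} (hκ : 1 < κ) : 0 < innerPeriod κ := by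
  rw [innerPeriod_eq hκ]
  have hpos : ∀ θ : ℝ, 0 < κ ^ 2 - Real.cos θ ^ 2 := fun θ => by
    nlinarith [Real.cos_sq_le_one θ]
  refine intervalIntegral.intervalIntegral_pos_of_pos_on ?_ (fun θ _ => ?_) Real.pi_pos
  · refine Continuous.intervalIntegrable ?_ _ _
    exact continuous_const.div (by fun_prop) fun θ => (Real.sqrt_pos.2 (hpos θ)).ne'
  · have := hpos θ
    positivity

lemma innerPeriod_le {κ : ℝ} (hκ : 2 ≤ κ) : innerPeriod κ ≤ 2 * Real.pi / κ := by
  have hpos : ∀ θ : ℝ, (κ / 2) ^ 2 ≤ κ ^ 2 - Real.cos θ ^ 2 := fun θ => by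
    nlinarith [Real.cos_sq_le_one θ]
  rw [innerPeriod_eq (by linarith)]
  have hκ0 : 0 < κ / 2 := by linarith
  have h1 : ∀ θ : ℝ, 1 / Real.sqrt (κ ^ 2 - Real.cos θ ^ 2) ≤ 2 / κ := fun θ => by
    rw [show 2 / κ = 1 / (κ / 2) by field_simp]
    refine one_div_le_one_div_of_le hκ0 (Real.le_sqrt_of_sq_le (hpos θ))
  have h2 : ∫ θ in (0 : ℝ)..Real.pi, 1 / Real.sqrt (κ ^ 2 - Real.cos θ ^ 2)
      ≤ ∫ θ in (0 : ℝ)..Real.pi, 2 / κ := by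
    refine intervalIntegral.integral_mono_on Real.pi_pos.le ?_ (by simp) fun θ _ => h1 θ
    refine Continuous.intervalIntegrable ?_ _ _
    exact continuous_const.div (by fun_prop) fun θ => (Real.sqrt_pos.2
      (lt_of_lt_of_le (by positivity) (hpos θ))).ne'
  refine h2.trans (le_of_eq ?_)
  rw [intervalIntegral.integral_const, smul_eq_mul]
  ring

lemma outerPeriod_le {κ : ℝ} (hκ : 1 < κ) : outerPeriod κ ≤ Real.pi / 2 := by
  rw [outerPeriod_eq hκ]
  have h2 : ∫ θ in (0 : ℝ)..Real.pi,
      1 / Real.sqrt ((κ - ((-κ + -1) / 2 - (-1 - -κ) / 2 * Real.cos θ))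
        * (1 - ((-κ + -1) / 2 - (-1 - -κ) / 2 * Real.cos θ))) ≤ ∫ θ in (0 : ℝ)..Real.pi, 1 / 2 := by
    refine intervalIntegral.integral_mono_on Real.pi_pos.le ?_ (by simp) fun θ _ => ?_
    · refine Continuous.intervalIntegrable ?_ _ _
      exact continuous_const.div (by fun_prop) fun θ => (Real.sqrt_pos.2
        (lt_of_lt_of_le (by norm_num) (outer_radicand_ge hκ θ))).ne'
    · refine one_div_le_one_div_of_le two_pos (Real.le_sqrt_of_sq_le ?_)
      linarith [outer_radicand_ge hκ θ]
  refine h2.trans (le_of_eq ?_)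
  rw [intervalIntegral.integral_const, smul_eq_mul]
  ring

/-- On `(-κ, -1)` one has `(u² - 1) (κ² - u²) ≤ κ² u²`, so the integrand is at least `1 / (κ |u|)`.
This beats the `O(1 / κ)` bound for the inner period by a logarithm. -/
lemma log_div_le_outerPeriod {κ : ℝ} (hκ : 1 < κ) : Real.log κ / κ ≤ outerPeriod κ := by
  have hκ0 : 0 < κ := by linarith
  have hlog : ∫ u in (-κ)..(-1), (1 / κ) * (-u)⁻¹ = Real.log κ / κ := by
    rw [intervalIntegral.integral_const_mul,
      intervalIntegral.integral_comp_neg (fun u => u⁻¹), integral_inv]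
    · simp; ring
    · rw [neg_neg, neg_neg, uIcc_of_le hκ.le]
      rintro ⟨h, _⟩
      linarith
  rw [← hlog, intervalIntegral.integral_of_le (by linarith), integral_Ioc_eq_integral_Ioo]
  refine setIntegral_mono_on ?_ (integrableOn_ellipticIntegrand_outer hκ) measurableSet_Ioo
    fun u hu => ?_
  · refine (ContinuousOn.integrableOn_Icc ?_).mono_set Ioo_subset_Icc_self
    refine continuousOn_const.mul (ContinuousOn.inv₀ (by fun_prop) fun u hu => ?_)
    linarith [hu.2]
  · have hu0 : 0 < -u := by linarith [hu.2]
    rw [ellipticIntegrand, ← one_div, one_div_mul_one_div]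
    have e1 : 0 < -u - 1 := by linarith [hu.2]
    have e2 : 0 < κ - -u := by linarith [hu.1]
    have e3 : 0 < u ^ 2 - 1 := by nlinarith
    have e4 : 0 < κ ^ 2 - u ^ 2 := by nlinarith
    have habs : |(1 - u ^ 2) * (κ ^ 2 - u ^ 2)| = (u ^ 2 - 1) * (κ ^ 2 - u ^ 2) := by
      rw [← abs_of_pos (mul_pos e3 e4), ← abs_neg]
      congr 1
      ring
    rw [habs]
    refine one_div_le_one_div_of_le (Real.sqrt_pos.2 (mul_pos e3 e4)) ?_
    rw [Real.sqrt_le_left (by positivity)]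
    nlinarith [sq_nonneg u, sq_nonneg κ, mul_pos e3 e4]

/-- On `(0, 1)` the factors of the radicand are at most `2 (κ - u)` and `4 (κ - u)`, so the
integrand is at least `1 / (4 (κ - u))`. The inner period thus blows up as `κ` decreases to `1`,
while the outer one stays below `π / 2`. -/
lemma log_le_innerPeriod {κ : ℝ} (hκ : 1 < κ) (hκ2 : κ ≤ 2) :
    Real.log (κ / (κ - 1)) / 4 ≤ innerPeriod κ := by
  have hlog : ∫ u in (0 : ℝ)..1, (1 / 4) * (κ - u)⁻¹ = Real.log (κ / (κ - 1)) / 4 := by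
    rw [intervalIntegral.integral_const_mul,
      intervalIntegral.integral_comp_sub_left (fun u => u⁻¹), integral_inv]
    · simp; ring
    · rw [uIcc_of_le (by linarith)]
      rintro ⟨h, _⟩
      linarith
  rw [← hlog, intervalIntegral.integral_of_le (by linarith), integral_Ioc_eq_integral_Ioo]
  have hI := integrableOn_ellipticIntegrand_inner hκ
  have hsub : Ioo (0 : ℝ) 1 ⊆ Ioo (-1) 1 := Ioo_subset_Ioo_left (by norm_num)
  refine le_trans (setIntegral_mono_on ?_ (hI.mono_set hsub) measurableSet_Ioo
    fun u hu => ?_) (setIntegral_mono_set hI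
      (Eventually.of_forall (ellipticIntegrand_nonneg κ)) hsub.eventuallyLE)
  · refine (ContinuousOn.integrableOn_Icc ?_).mono_set Ioo_subset_Icc_self
    refine continuousOn_const.mul (ContinuousOn.inv₀ (by fun_prop) fun u hu => ?_)
    linarith [hu.2]
  · have hu0 := hu.1
    have e1 : 0 < 1 - u := by linarith [hu.2]
    have e2 : 0 < κ - u := by linarith [hu.2]
    have e3 : 0 < 1 - u ^ 2 := by nlinarith
    have e4 : 0 < κ ^ 2 - u ^ 2 := by nlinarith
    rw [ellipticIntegrand, ← one_div, one_div_mul_one_div, abs_of_pos (mul_pos e3 e4)]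
    refine one_div_le_one_div_of_le (Real.sqrt_pos.2 (mul_pos e3 e4)) ?_
    rw [Real.sqrt_le_left (by positivity)]
    have f1 : 1 - u ^ 2 ≤ 2 * (κ - u) := by nlinarith
    have f2 : κ ^ 2 - u ^ 2 ≤ 4 * (κ - u) := by nlinarith
    have f3 := mul_le_mul f1 f2 e4.le (by positivity)
    nlinarith [sq_nonneg (κ - u)]

/-- Every positive number is a ratio of periods. -/
lemma exists_period_ratio {τ : ℝ} (hτ : 0 < τ) :
    ∃ κ : ℝ, 1 < κ ∧ outerPeriod κ = τ * innerPeriod κ := by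
  have : PreconnectedSpace (Ioi (1 : ℝ)) := Subtype.preconnectedSpace isPreconnected_Ioi
  have hcont : Continuous fun κ : Ioi (1 : ℝ) => outerPeriod κ - τ * innerPeriod κ :=
    continuous_outerPeriod.sub (continuous_const.mul continuous_innerPeriod)
  have hpi := Real.pi_pos
  suffices h : (0 : ℝ) ∈ range fun κ : Ioi (1 : ℝ) => outerPeriod κ - τ * innerPeriod κ by
    obtain ⟨κ, hκ⟩ := h
    exact ⟨κ, κ.2, by linarith [hκ]⟩
  refine mem_range_of_exists_le_of_exists_ge hcont ?_ ?_
  -- With `κ = 1 + e^{-m}` the logarithm in `log_le_innerPeriod` is at least `m`, and `τ m / 4 = π /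
  -- 2` bounds the outer period.
  · set m := 2 * Real.pi / τ with hm
    have hm0 : 0 < m := by positivity
    have he : 0 < Real.exp (-m) := Real.exp_pos _
    have he1 : Real.exp (-m) ≤ 1 := Real.exp_le_one_iff.2 (by linarith)
    have hκ : 1 < 1 + Real.exp (-m) := by linarith
    refine ⟨⟨1 + Real.exp (-m), hκ⟩, ?_⟩
    simp only
    have h1 := outerPeriod_le hκ
    have h2 := log_le_innerPeriod hκ (by linarith)
    have h3 : m ≤ Real.log ((1 + Real.exp (-m)) / (1 + Real.exp (-m) - 1)) := by
      rw [Real.le_log_iff_exp_le (by rw [add_sub_cancel_left]; positivity), add_sub_cancel_left,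
        le_div_iff₀ he, ← Real.exp_add]
      simp [he.le]
    have h4 : τ * m = 2 * Real.pi := by rw [hm]; field_simp
    nlinarith
  -- For `log κ ≥ 2 π τ`, the bound `τ * (2 π / κ)` for the inner side is at most `log κ / κ`, hence
  -- at most the outer period.
  · set κ := max 2 (Real.exp (2 * Real.pi * τ)) with hκdef
    have hκ2 : 2 ≤ κ := le_max_left _ _
    have hκ : 1 < κ := by linarith
    refine ⟨⟨κ, hκ⟩, ?_⟩
    simp only
    have h1 := innerPeriod_le hκ2
    have h2 := log_div_le_outerPeriod hκ
    have h3 : 2 * Real.pi * τ ≤ Real.log κ := by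
      rw [Real.le_log_iff_exp_le (by linarith)]
      exact le_max_right _ _
    have h4 : τ * innerPeriod κ ≤ Real.log κ / κ := by
      calc τ * innerPeriod κ ≤ τ * (2 * Real.pi / κ) := by gcongr
        _ = (2 * Real.pi * τ) / κ := by ring
        _ ≤ _ := by gcongr
    linarith

/-- The point `p` will be sent to infinity by a Möbius map. It divides `(-1, 1)` into the preimages
of the two tails, so its position prescribes their ratio. -/
lemma exists_partial_period {κ r : ℝ} (hκ : 1 < κ) (hr : r ∈ Ioo (0 : ℝ) 1) :
    ∃ p ∈ Ioo (-1 : ℝ) 1, ∫ u in Ioo (-1) p, ellipticIntegrand κ u = r * innerPeriod κ ∧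
      ∫ u in Ioo p 1, ellipticIntegrand κ u = (1 - r) * innerPeriod κ := by
  have hI := integrableOn_ellipticIntegrand_inner hκ
  have hK := innerPeriod_pos hκ
  have hi : IntervalIntegrable (ellipticIntegrand κ) volume (-1) 1 := by
    rwa [intervalIntegrable_iff_integrableOn_Ioo_of_le (by norm_num)]
  have hKi : ∫ u in (-1 : ℝ)..1, ellipticIntegrand κ u = innerPeriod κ := by
    rw [intervalIntegral.integral_of_le (by norm_num), integral_Ioc_eq_integral_Ioo, innerPeriod]
  have hc : ContinuousOn (fun p => ∫ u in (-1 : ℝ)..p, ellipticIntegrand κ u) (Icc (-1) 1) := by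
    have := intervalIntegral.continuousOn_primitive_interval' hi left_mem_uIcc
    rwa [uIcc_of_le (by norm_num)] at this
  obtain ⟨p, hp, hpr⟩ := intermediate_value_Icc (by norm_num) hc
    (show r * innerPeriod κ ∈ _ by
      rw [intervalIntegral.integral_same, hKi]
      exact ⟨by nlinarith [hr.1], by nlinarith [hr.2]⟩)
  simp only at hpr
  have hp1 : -1 < p := by
    refine lt_of_le_of_ne hp.1 fun h => ?_
    rw [← h, intervalIntegral.integral_same] at hpr
    nlinarith [hr.1]
  have hp2 : p < 1 := by
    refine lt_of_le_of_ne hp.2 fun h => ?_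
    rw [h, hKi] at hpr
    nlinarith [hr.2]
  have hadd := intervalIntegral.integral_add_adjacent_intervals
    (hi.mono_set (c := -1) (d := p) (by
      rw [uIcc_of_le hp.1, uIcc_of_le (by norm_num)]; exact Icc_subset_Icc_right hp.2))
    (hi.mono_set (c := p) (d := 1) (by
      rw [uIcc_of_le hp.2, uIcc_of_le (by norm_num)]; exact Icc_subset_Icc_left hp.1))
  refine ⟨p, ⟨hp1, hp2⟩, ?_, ?_⟩
  · rw [← integral_Ioc_eq_integral_Ioo, ← intervalIntegral.integral_of_le hp.1, hpr]
  · rw [← integral_Ioc_eq_integral_Ioo, ← intervalIntegral.integral_of_le hp.2]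
    linarith

/-! ### Matching the end points -/

lemma bandHeight_eq {α α' β' β : ℝ} (h₁ : α < α') (h₂ : α' < β') (h₃ : β' < β) :
    bandHeight α α' β' β = 1 / Real.pi * ∫ s in Ioo β' β, invSqrtAbs α α' β' β s := by
  rw [← bandDensity_eq_height (right_mem_Icc.2 h₂.le),
    bandDensity_right h₁ h₂ h₃ (left_mem_Icc.2 h₃.le), intervalIntegral.integral_of_le h₃.le,
    integral_Ioc_eq_integral_Ioo]
  congr 1
  refine setIntegral_congr_fun measurableSet_Ioo fun s hs => ?_
  have e1 : 0 < s - β' := by linarith [hs.1]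
  have e2 : 0 < β - s := by linarith [hs.2]
  have e3 : 0 < s - α' := by linarith
  have e4 : 0 < s - α := by linarith
  simp only [invSqrtAbs]
  rw [← abs_of_pos (show 0 < (s - α) * (s - α') * (s - β') * (β - s) by positivity), ← abs_neg]
  congr 3
  ring

lemma setIntegral_comp_add_right (f : ℝ → ℝ) (c : ℝ) (S : Set ℝ) :
    ∫ s in (fun s => s + c) ⁻¹' S, f (s + c) = ∫ s in S, f s :=
  (measurePreserving_add_right volume c).setIntegral_preimage_emb
    (measurableEmbedding_addRight c) f S

lemma invSqrtAbs_add (α α' β' β c s : ℝ) :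
    invSqrtAbs (α + c) (α' + c) (β' + c) (β + c) (s + c) = invSqrtAbs α α' β' β s := by
  simp only [invSqrtAbs, add_sub_add_right_eq_sub]

lemma bandField_add (α α' β' β c s : ℝ) :
    bandField (α + c) (α' + c) (β' + c) (β + c) (s + c) = bandField α α' β' β s := by
  simp only [bandField, invSqrtAbs_add, add_lt_add_iff_right]

lemma bandForce_add (α α' β' β c x : ℝ) :
    bandForce (α + c) (α' + c) (β' + c) (β + c) (x + c) = bandForce α α' β' β x := by
  rw [bandForce, ← setIntegral_comp_add_right _ c]
  simp only [preimage_add_const_Ioi, add_sub_cancel_right, bandField_add]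
  rfl

/-- The balance condition can be enforced by a translation. -/
lemma exists_isMatched_of_tails {γ ζ α α' β' β : ℝ} (h₁ : α < α') (h₂ : α' < β') (h₃ : β' < β)
    (hR : ∫ s in Ioi β, invSqrtAbs α α' β' β s = (1 - ζ) / 2)
    (hL : ∫ s in Iio α, invSqrtAbs α α' β' β s = (1 + ζ) / 2)
    (hH : bandHeight α α' β' β = 1 / (2 * γ)) :
    ∃ a a' b' b, IsMatched γ ζ a a' b' b := by
  -- The right side of the balance is invariant under translation, and `α' + β'` grows by `2 c`.
  set c := (ζ * (β' - α') + 2 * (∫ s in α'..β', bandForce α α' β' β s) - (α' + β')) / 2 with hc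
  refine ⟨α + c, α' + c, β' + c, β + c, by linarith, by linarith, by linarith, ?_, ?_, ?_, ?_⟩
  · rw [← hR, ← setIntegral_comp_add_right _ c]
    simp only [preimage_add_const_Ioi, add_sub_cancel_right, invSqrtAbs_add]
  · rw [← hL, ← setIntegral_comp_add_right _ c]
    simp only [preimage_add_const_Iio, add_sub_cancel_right, invSqrtAbs_add]
  · rw [← hH, bandHeight_eq (by linarith) (by linarith) (by linarith), bandHeight_eq h₁ h₂ h₃,
      ← setIntegral_comp_add_right _ c]
    simp only [preimage_add_const_Ioo, add_sub_cancel_right, invSqrtAbs_add]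
  · have h := intervalIntegral.integral_comp_add_right (a := α') (b := β')
      (bandForce (α + c) (α' + c) (β' + c) (β + c)) c
    simp only [bandForce_add] at h
    rw [← h, hc]
    ring

/-- The elliptic differential is Möbius covariant. Each factor is `L / (p - u) - L / (p - e) = L (u
- e) / ((p - u) (p - e))`; the square root of the product of four produces `L² / (p - u)²`, which
cancels the Jacobian up to `1 / L`. -/
lemma abs_deriv_mul_invSqrtAbs {κ p L u : ℝ} (hκ : 1 < κ) (hp : p ∈ Ioo (-1 : ℝ) 1)
    (hL : 0 < L) (hu : u ≠ p) :
    |L / (p - u) ^ 2| * invSqrtAbs (L / (p - 1)) (L / (p - κ)) (L / (p - -κ)) (L / (p - -1))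
        (L / (p - u))
      = Real.sqrt ((1 - p ^ 2) * (κ ^ 2 - p ^ 2)) / L * ellipticIntegrand κ u := by
  obtain ⟨hp1, hp2⟩ := hp
  have e0 : p - u ≠ 0 := sub_ne_zero.2 hu.symm
  have e1 : p - 1 ≠ 0 := by linarith
  have e2 : p - κ ≠ 0 := by linarith
  have e3 : p - -κ ≠ 0 := by linarith
  have e4 : p - -1 ≠ 0 := by linarith
  have q1 : 0 < 1 - p ^ 2 := by nlinarith
  have q2 : 0 < κ ^ 2 - p ^ 2 := by nlinarith
  have hR : (L / (p - u) - L / (p - 1)) * (L / (p - u) - L / (p - κ)) *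
      (L / (p - u) - L / (p - -κ)) * (L / (p - u) - L / (p - -1))
      = (L ^ 2 / (p - u) ^ 2) ^ 2 * ((1 - u ^ 2) * (κ ^ 2 - u ^ 2))
        / ((1 - p ^ 2) * (κ ^ 2 - p ^ 2)) := by
    have h1 : (1 - p ^ 2) * (κ ^ 2 - p ^ 2) = (p - 1) * (p - κ) * (p - -κ) * (p - -1) := by ring
    rw [h1]
    field_simp
    ring
  have hu2 : 0 < (p - u) ^ 2 := by positivity
  rw [abs_of_pos (show 0 < L / (p - u) ^ 2 by positivity), invSqrtAbs, hR, abs_div, abs_mul,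
    abs_of_pos (mul_pos q1 q2), abs_of_nonneg (sq_nonneg (L ^ 2 / _)),
    Real.sqrt_div (by positivity), Real.sqrt_mul (by positivity), Real.sqrt_sq (by positivity),
    ellipticIntegrand]
  have q3 : 0 < Real.sqrt ((1 - p ^ 2) * (κ ^ 2 - p ^ 2)) := by positivity
  field_simp

lemma setIntegral_invSqrtAbs_moebius {κ p L : ℝ} (hκ : 1 < κ) (hp : p ∈ Ioo (-1 : ℝ) 1)
    (hL : 0 < L) {S : Set ℝ} (hS : MeasurableSet S) (hpS : p ∉ S) :
    ∫ s in (fun u => L / (p - u)) '' S,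
        invSqrtAbs (L / (p - 1)) (L / (p - κ)) (L / (p - -κ)) (L / (p - -1)) s
      = Real.sqrt ((1 - p ^ 2) * (κ ^ 2 - p ^ 2)) / L * ∫ u in S, ellipticIntegrand κ u := by
  have hne : ∀ u ∈ S, p - u ≠ 0 := fun u hu h => hpS (by rwa [sub_eq_zero.1 h])
  rw [integral_image_eq_integral_abs_deriv_smul (f' := fun u => L / (p - u) ^ 2) hS,
    ← integral_const_mul]
  · refine setIntegral_congr_fun hS fun u hu => ?_
    exact abs_deriv_mul_invSqrtAbs hκ hp hL fun h => hpS (h ▸ hu)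
  · intro u hu
    have h := (((hasDerivAt_id u).const_sub p).fun_inv (hne u hu)).const_mul L
    refine HasDerivAt.hasDerivWithinAt ?_
    simpa [div_eq_mul_inv] using h
  · intro u hu v hv huv
    have := hne u hu
    have := hne v hv
    simp only at huv
    field_simp at huv
    linarith

lemma moebius_image_Ioo {p L a b : ℝ} (hL : 0 < L) (ha : a < p) (hb : b < p) :
    (fun u => L / (p - u)) '' Ioo a b = Ioo (L / (p - a)) (L / (p - b)) := by
  have e1 : 0 < p - a := by linarith
  have e2 : 0 < p - b := by linarith
  ext x
  constructor
  · rintro ⟨u, ⟨h1, h2⟩, rfl⟩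
    have e3 : 0 < p - u := by linarith
    constructor
    · exact div_lt_div_of_pos_left hL e3 (by linarith)
    · exact div_lt_div_of_pos_left hL e2 (by linarith)
  · rintro ⟨h1, h2⟩
    have hx : 0 < x := (div_pos hL e1).trans h1
    rw [div_lt_iff₀ e1] at h1
    rw [lt_div_iff₀ e2] at h2
    refine ⟨p - L / x, ⟨?_, ?_⟩, ?_⟩
    · have : L / x < p - a := by rw [div_lt_iff₀ hx]; linarith
      linarith
    · have : p - b < L / x := by rw [lt_div_iff₀ hx]; linarith
      linarith
    · simp only [sub_sub_cancel]
      field_simp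

lemma moebius_image_Ioo_right {p L a : ℝ} (hL : 0 < L) (ha : a < p) :
    (fun u => L / (p - u)) '' Ioo a p = Ioi (L / (p - a)) := by
  have e1 : 0 < p - a := by linarith
  ext x
  constructor
  · rintro ⟨u, ⟨h1, h2⟩, rfl⟩
    have e3 : 0 < p - u := by linarith
    exact div_lt_div_of_pos_left hL e3 (by linarith)
  · intro h1
    have hx : 0 < x := (div_pos hL e1).trans h1
    rw [mem_Ioi, div_lt_iff₀ e1] at h1
    refine ⟨p - L / x, ⟨?_, ?_⟩, ?_⟩
    · have : L / x < p - a := by rw [div_lt_iff₀ hx]; linarith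
      linarith
    · have : 0 < L / x := by positivity
      linarith
    · simp only [sub_sub_cancel]
      field_simp

lemma moebius_image_Ioo_left {p L b : ℝ} (hL : 0 < L) (hb : p < b) :
    (fun u => L / (p - u)) '' Ioo p b = Iio (L / (p - b)) := by
  have h := moebius_image_Ioo_right (p := -p) (a := -b) hL (by linarith)
  have e : L / (p - b) = -(L / (-p - -b)) := by rw [← div_neg]; congr 1; ring
  ext x
  have hx := Set.ext_iff.1 h (-x)
  simp only [mem_image, mem_Ioo, mem_Ioi] at hx
  rw [mem_Iio, e, lt_neg, ← hx]
  constructor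
  · rintro ⟨u, ⟨h1, h2⟩, rfl⟩
    refine ⟨-u, ⟨by linarith, by linarith⟩, ?_⟩
    simp only
    rw [← div_neg]; congr 1; ring
  · rintro ⟨u, ⟨h1, h2⟩, h3⟩
    refine ⟨-u, ⟨by linarith, by linarith⟩, ?_⟩
    simp only
    rw [← neg_inj, ← h3, ← div_neg]; congr 1; ring

/-- The end points of the bands can be matched to any `γ > 0` and `|ζ| < 1`. -/
lemma exists_isMatched {γ ζ : ℝ} (hγ : 0 < γ) (hζ : ζ ∈ Ioo (-1 : ℝ) 1) :
    ∃ α α' β' β, IsMatched γ ζ α α' β' β := by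
  have hpi := Real.pi_pos
  -- After normalization the height is `1 / π` times outer over inner period, and it has to equal `1
  -- / (2γ)`.
  obtain ⟨κ, hκ, hper⟩ := exists_period_ratio (τ := Real.pi / (2 * γ)) (by positivity)
  obtain ⟨p, hp, hpl, hpr⟩ := exists_partial_period (r := (1 - ζ) / 2) hκ
    ⟨by linarith [hζ.2], by linarith [hζ.1]⟩
  have hK := innerPeriod_pos hκ
  have q1 : 0 < 1 - p ^ 2 := by nlinarith [hp.1, hp.2]
  have q2 : 0 < κ ^ 2 - p ^ 2 := by nlinarith
  set Q := Real.sqrt ((1 - p ^ 2) * (κ ^ 2 - p ^ 2)) with hQ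
  have hQ0 : 0 < Q := by positivity
  -- The two tails add up to `Q / L` times the inner period, and this scale makes the sum `1`. The
  -- map `u ↦ L / (p - u)` sends `1, κ, -κ, -1` to `α, α', β', β`; the arc from `κ` through infinity
  -- to `-κ` becomes the gap.
  set L := Q * innerPeriod κ with hL
  have hL0 : 0 < L := by positivity
  have hQL : Q / L = 1 / innerPeriod κ := by rw [hL]; field_simp
  obtain ⟨hp1, hp2⟩ := hp
  have m := fun (S : Set ℝ) => setIntegral_invSqrtAbs_moebius (S := S) hκ ⟨hp1, hp2⟩ hL0
  rw [← hQ, hQL] at m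
  have h₁ : L / (p - 1) < L / (p - κ) := by
    rw [← neg_lt_neg_iff, ← div_neg, ← div_neg]
    exact div_lt_div_of_pos_left hL0 (by linarith) (by linarith)
  have h₂ : L / (p - κ) < L / (p - -κ) :=
    (div_neg_of_pos_of_neg hL0 (by linarith)).trans (div_pos hL0 (by linarith))
  have h₃ : L / (p - -κ) < L / (p - -1) :=
    div_lt_div_of_pos_left hL0 (by linarith) (by linarith)
  refine exists_isMatched_of_tails h₁ h₂ h₃ ?_ ?_ ?_
  · rw [← moebius_image_Ioo_right hL0 hp1, m _ measurableSet_Ioo (by simp), hpl]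
    field_simp
  · rw [← moebius_image_Ioo_left hL0 hp2, m _ measurableSet_Ioo (by simp), hpr]
    field_simp
    ring
  · rw [bandHeight_eq h₁ h₂ h₃, ← moebius_image_Ioo hL0 (by linarith) hp1,
      m _ measurableSet_Ioo (fun h => by linarith [h.2]), ← outerPeriod, hper]
    field_simp

/-! ### Positivity of the logarithmic energy -/

/-- The primitive of `s ↦ (s - d)₊ / s²`, up to a constant. -/
def trianglePrimitive (d s : ℝ) : ℝ := Real.log (max s d) + d / max s d

lemma hasDerivAt_trianglePrimitive {d s : ℝ} (hd : 0 < d) (hs : 0 < s) :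
    HasDerivAt (trianglePrimitive d) (max (s - d) 0 / s ^ 2) s := by
  have hout : HasDerivAt (fun s => Real.log s + d / s) ((s - d) / s ^ 2) s := by
    have h := (Real.hasDerivAt_log hs.ne').add (((hasDerivAt_id s).fun_inv hs.ne').const_mul d)
    refine h.congr_deriv ?_
    simp only [id]
    field_simp
    ring
  rcases lt_trichotomy s d with h | h | h
  · rw [max_eq_right (by linarith), zero_div]
    refine (hasDerivAt_const s (Real.log d + d / d)).congr_of_eventuallyEq ?_
    filter_upwards [gt_mem_nhds h] with u hu
    rw [trianglePrimitive, max_eq_right hu.le]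
  · subst h
    rw [sub_self, zero_div] at hout
    rw [sub_self, max_self, zero_div]
    have hl : HasDerivWithinAt (trianglePrimitive s) 0 (Iic s) s := by
      refine (hasDerivWithinAt_const s (Iic s) (Real.log s + s / s)).congr (fun u hu => ?_) ?_
      · rw [trianglePrimitive, max_eq_right hu]
      · rw [trianglePrimitive, max_self]
    have hr : HasDerivWithinAt (trianglePrimitive s) 0 (Ici s) s := by
      refine hout.hasDerivWithinAt.congr (fun u hu => ?_) ?_
      · rw [trianglePrimitive, max_eq_left hu]
      · rw [trianglePrimitive, max_self]
    have h := hl.union hr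
    rwa [Iic_union_Ici, hasDerivWithinAt_univ] at h
  · rw [max_eq_left (by linarith)]
    refine hout.congr_of_eventuallyEq ?_
    filter_upwards [lt_mem_nhds h] with u hu
    rw [trianglePrimitive, max_eq_left hu.le]

lemma continuous_trianglePrimitive {d : ℝ} (hd : 0 < d) : Continuous (trianglePrimitive d) := by
  have h : ∀ s, max s d ≠ 0 := fun s => (hd.trans_le (le_max_right _ _)).ne'
  unfold trianglePrimitive
  exact (Continuous.log (by fun_prop) h).add (continuous_const.div (by fun_prop) h)

/-- The kernel `((s - d)₊ - (s - 1)₊) / s²`. -/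
def triangleKernel (s d : ℝ) : ℝ := max (s - d) 0 / s ^ 2 - max (s - 1) 0 / s ^ 2

lemma tendsto_trianglePrimitive_sub (d : ℝ) :
    Tendsto (fun s => trianglePrimitive d s - trianglePrimitive 1 s) atTop (𝓝 0) := by
  have h : Tendsto (fun s : ℝ => d / s - 1 / s) atTop (𝓝 0) := by
    simpa using (tendsto_const_nhds.div_atTop tendsto_id).sub
      ((tendsto_const_nhds (x := (1 : ℝ))).div_atTop tendsto_id)
  refine h.congr' ?_
  filter_upwards [eventually_ge_atTop d, eventually_ge_atTop 1] with s h1 h2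
  rw [trianglePrimitive, trianglePrimitive, max_eq_left h1, max_eq_left h2]
  ring

lemma trianglePrimitive_sub_zero {d : ℝ} (hd : 0 < d) :
    trianglePrimitive d 0 - trianglePrimitive 1 0 = Real.log d := by
  rw [trianglePrimitive, trianglePrimitive, max_eq_right hd.le, max_eq_right zero_le_one,
    div_self hd.ne']
  simp

lemma hasDerivAt_trianglePrimitive_sub {d s : ℝ} (hd : 0 < d) (hs : s ∈ Ioi (0 : ℝ)) :
    HasDerivAt (fun s => trianglePrimitive d s - trianglePrimitive 1 s) (triangleKernel s d) s :=
  (hasDerivAt_trianglePrimitive hd hs).sub (hasDerivAt_trianglePrimitive one_pos hs)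

lemma triangleKernel_nonneg {s d : ℝ} (hd : d ≤ 1) : 0 ≤ triangleKernel s d := by
  rw [triangleKernel, ← sub_div]
  refine div_nonneg (sub_nonneg.2 (max_le_max_right _ (by linarith))) (sq_nonneg _)

lemma triangleKernel_nonpos {s d : ℝ} (hd : 1 ≤ d) : triangleKernel s d ≤ 0 := by
  rw [triangleKernel, ← sub_div]
  refine div_nonpos_of_nonpos_of_nonneg (sub_nonpos.2 (max_le_max_right _ (by linarith)))
    (sq_nonneg _)

lemma integrableOn_triangleKernel {d : ℝ} (hd : 0 < d) :
    IntegrableOn (fun s => triangleKernel s d) (Ioi 0) := by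
  have hc : ContinuousWithinAt (fun s => trianglePrimitive d s - trianglePrimitive 1 s)
      (Ici 0) 0 :=
    ((continuous_trianglePrimitive hd).sub
      (continuous_trianglePrimitive one_pos)).continuousWithinAt
  rcases le_total d 1 with h | h
  · exact integrableOn_Ioi_deriv_of_nonneg hc
      (fun s hs => hasDerivAt_trianglePrimitive_sub hd hs)
      (fun s _ => triangleKernel_nonneg h) (tendsto_trianglePrimitive_sub d)
  · exact integrableOn_Ioi_deriv_of_nonpos hc
      (fun s hs => hasDerivAt_trianglePrimitive_sub hd hs)
      (fun s _ => triangleKernel_nonpos h) (tendsto_trianglePrimitive_sub d)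

/-- A superposition of triangles `(s - d)₊ / s²` diverges logarithmically at large `s`. Subtracting
the triangle at `d = 1` makes it converge, and the subtracted term is constant in `d`, hence
invisible to a neutral density. -/
lemma integral_triangleKernel {d : ℝ} (hd : 0 < d) :
    ∫ s in Ioi 0, triangleKernel s d = -Real.log d := by
  have hc : ContinuousWithinAt (fun s => trianglePrimitive d s - trianglePrimitive 1 s)
      (Ici 0) 0 :=
    ((continuous_trianglePrimitive hd).sub
      (continuous_trianglePrimitive one_pos)).continuousWithinAt
  rw [integral_Ioi_of_hasDerivAt_of_tendsto hc
    (fun s hs => hasDerivAt_trianglePrimitive_sub hd hs) (integrableOn_triangleKernel hd)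
    (tendsto_trianglePrimitive_sub d), trianglePrimitive_sub_zero hd, zero_sub]

/-- For fixed `d` the kernel has one sign in `s`. Its `L¹` norm is therefore exactly `|log d|`, so
Fubini in `logEnergy_eq` needs only the integrability of the logarithmic energy. -/
lemma integral_norm_triangleKernel {d : ℝ} (hd : 0 < d) :
    ∫ s in Ioi 0, ‖triangleKernel s d‖ = |Real.log d| := by
  rcases le_total d 1 with h | h
  · simp only [Real.norm_of_nonneg (triangleKernel_nonneg h)]
    rw [integral_triangleKernel hd, abs_of_nonpos (Real.log_nonpos hd.le h)]
  · simp only [Real.norm_of_nonpos (triangleKernel_nonpos h)]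
    rw [integral_neg, integral_triangleKernel hd, abs_of_nonneg (Real.log_nonneg h), neg_neg]

/-- The indicator of the interval `[w, w + s]`. -/
def windowIndicator (s w x : ℝ) : ℝ := if w ≤ x ∧ x ≤ w + s then 1 else 0

lemma measurable_windowIndicator (s : ℝ) :
    Measurable (Function.uncurry (windowIndicator s)) := by
  unfold windowIndicator Function.uncurry
  refine Measurable.ite ?_ measurable_const measurable_const
  exact (measurableSet_le measurable_fst measurable_snd).inter
    (measurableSet_le measurable_snd (measurable_fst.add_const s))

lemma windowIndicator_mul (s w x y : ℝ) :
    windowIndicator s w x * windowIndicator s w y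
      = (Icc (max x y - s) (min x y)).indicator 1 w := by
  unfold windowIndicator indicator
  have : w ∈ Icc (max x y - s) (min x y) ↔ (w ≤ x ∧ x ≤ w + s) ∧ (w ≤ y ∧ y ≤ w + s) := by
    rw [mem_Icc, sub_le_iff_le_add, max_le_iff, le_min_iff]
    tauto
  simp only [this]
  split_ifs <;> simp_all

lemma integrable_windowIndicator_mul (s x y : ℝ) :
    Integrable (fun w => windowIndicator s w x * windowIndicator s w y) := by
  simp only [windowIndicator_mul]
  exact (integrable_indicator_iff measurableSet_Icc).2
    (continuous_const (y := (1 : ℝ))).integrableOn_Icc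

/-- A window of length `s` contains both points when it starts between `max x y - s` and `min x y`.
Those starting points have length `s - |x - y|`, or none. -/
lemma integral_windowIndicator_mul (s x y : ℝ) :
    ∫ w, windowIndicator s w x * windowIndicator s w y = max (s - |x - y|) 0 := by
  simp only [windowIndicator_mul]
  rw [integral_indicator_one measurableSet_Icc, Measure.real, Real.volume_Icc,
    ENNReal.toReal_ofReal']
  congr 1
  rw [← max_sub_min_eq_abs']
  ring

lemma integral_windowIndicator (s w : ℝ) (h : ℝ → ℝ) :
    ∫ x, windowIndicator s w x * h x = ∫ x in Icc w (w + s), h x := by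
  rw [← integral_indicator measurableSet_Icc]
  congr 1
  ext x
  unfold windowIndicator indicator
  simp only [mem_Icc]
  split_ifs <;> simp

/-- The triangular kernel is positive definite. -/
lemma integral_triangle_eq_integral_sq {h : ℝ → ℝ} (hm : Measurable h) (hh : Integrable h)
    (s : ℝ) :
    Integrable (fun w => (∫ x in Icc w (w + s), h x) ^ 2) ∧
    ∫ p : ℝ × ℝ, h p.1 * h p.2 * max (s - |p.1 - p.2|) 0
      = ∫ w, (∫ x in Icc w (w + s), h x) ^ 2 := by
  have hprod : Integrable (fun p : ℝ × ℝ => h p.1 * h p.2) := hh.mul_prod hh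
  have hInt : Integrable (Function.uncurry fun (p : ℝ × ℝ) (w : ℝ) =>
      (h p.1 * h p.2) * (windowIndicator s w p.1 * windowIndicator s w p.2))
      ((volume : Measure (ℝ × ℝ)).prod volume) := by
    have hmeas : Measurable (Function.uncurry fun (p : ℝ × ℝ) (w : ℝ) =>
        (h p.1 * h p.2) * (windowIndicator s w p.1 * windowIndicator s w p.2)) := by
      have h1 : Measurable fun q : (ℝ × ℝ) × ℝ => windowIndicator s q.2 q.1.1 :=
        (measurable_windowIndicator s).comp (measurable_snd.prodMk measurable_fst.fst)
      have h2 : Measurable fun q : (ℝ × ℝ) × ℝ => windowIndicator s q.2 q.1.2 :=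
        (measurable_windowIndicator s).comp (measurable_snd.prodMk measurable_fst.snd)
      exact ((hm.comp measurable_fst.fst).mul (hm.comp measurable_fst.snd)).mul (h1.mul h2)
    rw [integrable_prod_iff hmeas.aestronglyMeasurable]
    refine ⟨Eventually.of_forall fun p =>
      (integrable_windowIndicator_mul s p.1 p.2).const_mul (h p.1 * h p.2), ?_⟩
    have heq : (fun p : ℝ × ℝ => ∫ w, ‖(h p.1 * h p.2) *
        (windowIndicator s w p.1 * windowIndicator s w p.2)‖)
        = fun p : ℝ × ℝ => ‖h p.1 * h p.2‖ * max (s - |p.1 - p.2|) 0 := by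
      ext p
      rw [← integral_windowIndicator_mul, ← integral_const_mul]
      congr 1
      ext w
      have hn : 0 ≤ windowIndicator s w p.1 * windowIndicator s w p.2 := by
        unfold windowIndicator; positivity
      rw [norm_mul (h p.1 * h p.2), Real.norm_of_nonneg hn]
    simp only [Function.uncurry]
    rw [heq]
    refine hprod.norm.mul_bdd (c := max s 0) (Measurable.aestronglyMeasurable (by fun_prop))
      (Eventually.of_forall fun p => ?_)
    rw [Real.norm_of_nonneg (le_max_right _ _)]
    exact max_le_max_right _ (by linarith [abs_nonneg (p.1 - p.2)])
  have hw : ∀ w, ∫ p : ℝ × ℝ, (h p.1 * h p.2) *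
      (windowIndicator s w p.1 * windowIndicator s w p.2) = (∫ x in Icc w (w + s), h x) ^ 2 := by
    intro w
    rw [sq, ← integral_windowIndicator, ← integral_prod_mul, Measure.volume_eq_prod]
    congr 1
    ext p
    ring
  refine ⟨hInt.integral_prod_right.congr (Eventually.of_forall hw), ?_⟩
  calc ∫ p : ℝ × ℝ, h p.1 * h p.2 * max (s - |p.1 - p.2|) 0
      = ∫ p : ℝ × ℝ, ∫ w, (h p.1 * h p.2) *
          (windowIndicator s w p.1 * windowIndicator s w p.2) := by
        congr 1
        ext p
        rw [integral_const_mul, integral_windowIndicator_mul]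
    _ = ∫ w, ∫ p : ℝ × ℝ, (h p.1 * h p.2) *
          (windowIndicator s w p.1 * windowIndicator s w p.2) := integral_integral_swap hInt
    _ = _ := by simp only [hw]

lemma ae_fst_ne_snd : ∀ᵐ p : ℝ × ℝ, p.1 ≠ p.2 := by
  have hmeas : MeasurableSet {p : ℝ × ℝ | p.1 ≠ p.2} :=
    (measurableSet_eq_fun measurable_fst measurable_snd).compl
  rw [Measure.volume_eq_prod, Measure.ae_prod_iff_ae_ae hmeas]
  refine Eventually.of_forall fun x => ?_
  have : ∀ᵐ y : ℝ, y ≠ x := compl_mem_ae_iff.2 (measure_singleton x)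
  filter_upwards [this] with y hy
  exact hy.symm

/-- The mean square of the masses that `h` gives to the windows of length `s`. -/
def windowEnergy (h : ℝ → ℝ) (s : ℝ) : ℝ := ∫ w, (∫ x in Icc w (w + s), h x) ^ 2

/-- The logarithmic energy of a neutral density in terms of the masses of intervals. -/
lemma logEnergy_eq {h : ℝ → ℝ} (hm : Measurable h) (hh : Integrable h) (h0 : ∫ x, h x = 0)
    (hlog : Integrable fun p : ℝ × ℝ => h p.1 * h p.2 * Real.log (1 / |p.1 - p.2|)) :
    IntegrableOn (fun s => windowEnergy h s / s ^ 2) (Ioi 0) ∧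
    ∫ p : ℝ × ℝ, h p.1 * h p.2 * Real.log (1 / |p.1 - p.2|)
      = ∫ s in Ioi 0, windowEnergy h s / s ^ 2 := by
  have hprod : Integrable (fun p : ℝ × ℝ => h p.1 * h p.2) := hh.mul_prod hh
  have hInt : Integrable (Function.uncurry fun (p : ℝ × ℝ) (s : ℝ) =>
      (h p.1 * h p.2) * triangleKernel s |p.1 - p.2|)
      ((volume : Measure (ℝ × ℝ)).prod (volume.restrict (Ioi 0))) := by
    have hmeas : Measurable (Function.uncurry fun (p : ℝ × ℝ) (s : ℝ) =>
        (h p.1 * h p.2) * triangleKernel s |p.1 - p.2|) := by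
      unfold triangleKernel Function.uncurry
      exact ((hm.comp measurable_fst.fst).mul (hm.comp measurable_fst.snd)).mul (by fun_prop)
    rw [integrable_prod_iff hmeas.aestronglyMeasurable]
    constructor
    · filter_upwards [ae_fst_ne_snd] with p hp
      exact (integrableOn_triangleKernel (abs_pos.2 (sub_ne_zero.2 hp))).const_mul (h p.1 * h p.2)
    · refine hlog.norm.congr ?_
      filter_upwards [ae_fst_ne_snd] with p hp
      simp only [Function.uncurry, norm_mul]
      rw [integral_const_mul, integral_norm_triangleKernel (abs_pos.2 (sub_ne_zero.2 hp)),
        one_div, Real.log_inv, norm_neg, Real.norm_eq_abs (Real.log _)]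
  have hs : ∀ s : ℝ, ∫ p : ℝ × ℝ, (h p.1 * h p.2) * triangleKernel s |p.1 - p.2|
      = windowEnergy h s / s ^ 2 := by
    intro s
    rw [windowEnergy, ← (integral_triangle_eq_integral_sq hm hh s).2]
    have h1 : Integrable (fun p : ℝ × ℝ => h p.1 * h p.2 * max (s - |p.1 - p.2|) 0) := by
      refine hprod.mul_bdd (c := max s 0) (Measurable.aestronglyMeasurable (by fun_prop))
        (Eventually.of_forall fun p => ?_)
      rw [Real.norm_of_nonneg (le_max_right _ _)]
      exact max_le_max_right _ (by linarith [abs_nonneg (p.1 - p.2)])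
    calc _ = ∫ p : ℝ × ℝ, (h p.1 * h p.2 * max (s - |p.1 - p.2|) 0 / s ^ 2
          - h p.1 * h p.2 * (max (s - 1) 0 / s ^ 2)) := by
          congr 1
          ext p
          rw [triangleKernel]
          ring
      -- Neutrality enters here: the term with `(s - 1)₊` carries the square of the total mass.
      _ = _ := by
          rw [integral_sub (h1.div_const _) (hprod.mul_const _), integral_div, integral_mul_const,
            Measure.volume_eq_prod, integral_prod_mul, h0]
          ring
  constructor
  · refine hInt.integral_prod_right.congr ?_
    exact Eventually.of_forall hs
  · calc ∫ p : ℝ × ℝ, h p.1 * h p.2 * Real.log (1 / |p.1 - p.2|)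
        = ∫ p : ℝ × ℝ, ∫ s in Ioi 0, (h p.1 * h p.2) * triangleKernel s |p.1 - p.2| := by
          refine integral_congr_ae ?_
          filter_upwards [ae_fst_ne_snd] with p hp
          rw [integral_const_mul, integral_triangleKernel (abs_pos.2 (sub_ne_zero.2 hp)), one_div,
            Real.log_inv]
      _ = ∫ s in Ioi 0, ∫ p : ℝ × ℝ, (h p.1 * h p.2) * triangleKernel s |p.1 - p.2| :=
          integral_integral_swap hInt
      _ = _ := by simp only [hs]

lemma windowEnergy_nonneg (h : ℝ → ℝ) (s : ℝ) : 0 ≤ windowEnergy h s :=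
  integral_nonneg fun _ => sq_nonneg _

lemma logEnergy_nonneg {h : ℝ → ℝ} (hm : Measurable h) (hh : Integrable h) (h0 : ∫ x, h x = 0)
    (hlog : Integrable fun p : ℝ × ℝ => h p.1 * h p.2 * Real.log (1 / |p.1 - p.2|)) :
    0 ≤ ∫ p : ℝ × ℝ, h p.1 * h p.2 * Real.log (1 / |p.1 - p.2|) := by
  rw [(logEnergy_eq hm hh h0 hlog).2]
  exact setIntegral_nonneg measurableSet_Ioi fun s _ =>
    div_nonneg (windowEnergy_nonneg h s) (sq_nonneg s)

lemma continuous_setIntegral_Iic {h : ℝ → ℝ} (hh : Integrable h) :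
    Continuous fun w => ∫ x in Iic w, h x := by
  have : (fun w => ∫ x in Iic w, h x)
      = fun w => (∫ x in Iic 0, h x) + ∫ x in (0 : ℝ)..w, h x := by
    ext w
    rw [← intervalIntegral.integral_Iic_sub_Iic hh.integrableOn hh.integrableOn]
    ring
  rw [this]
  exact continuous_const.add (intervalIntegral.continuous_primitive
    (fun _ _ => hh.intervalIntegrable) 0)

lemma setIntegral_Icc_eq_sub {h : ℝ → ℝ} (hh : Integrable h) {a b : ℝ} (hab : a ≤ b) :
    ∫ x in Icc a b, h x = (∫ x in Iic b, h x) - ∫ x in Iic a, h x := by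
  rw [intervalIntegral.integral_Iic_sub_Iic hh.integrableOn hh.integrableOn,
    intervalIntegral.integral_of_le hab, integral_Icc_eq_integral_Ioc]

/-- A neutral density with vanishing logarithmic energy gives no mass to intervals. -/
lemma setIntegral_eq_zero_of_logEnergy_eq_zero {h : ℝ → ℝ} (hm : Measurable h)
    (hh : Integrable h) (h0 : ∫ x, h x = 0)
    (hlog : Integrable fun p : ℝ × ℝ => h p.1 * h p.2 * Real.log (1 / |p.1 - p.2|))
    (hE : ∫ p : ℝ × ℝ, h p.1 * h p.2 * Real.log (1 / |p.1 - p.2|) = 0) {a b : ℝ} (hab : a < b) :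
    ∫ x in Icc a b, h x = 0 := by
  obtain ⟨hi, heq⟩ := logEnergy_eq hm hh h0 hlog
  rw [heq, setIntegral_eq_zero_iff_of_nonneg_ae
    (Eventually.of_forall fun s => div_nonneg (windowEnergy_nonneg h s) (sq_nonneg s)) hi] at hE
  have hF := continuous_setIntegral_Iic hh
  -- The vanishing energy controls almost every `s`, and then almost every window position.
  -- Continuity of the primitive upgrades first to every position, in particular `a`, and afterwards
  -- to every length, in particular `b - a`.
  have hs : (fun s => (∫ x in Iic (a + s), h x) - ∫ x in Iic a, h x)
      =ᵐ[volume.restrict (Ioi 0)] fun _ => 0 := by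
    filter_upwards [hE, ae_restrict_mem measurableSet_Ioi] with s hs hs0
    have hs0 : 0 < s := hs0
    have hw0 : windowEnergy h s = 0 := by
      simpa [hs0.ne'] using hs
    rw [windowEnergy, integral_eq_zero_iff_of_nonneg (fun _ => sq_nonneg _)
      (integral_triangle_eq_integral_sq hm hh s).1] at hw0
    have hall := Measure.eq_of_ae_eq hw0 ?_ continuous_const
    · have := congrFun hall a
      rw [setIntegral_Icc_eq_sub hh (by linarith)] at this
      simpa using this
    · have : (fun w => (∫ x in Icc w (w + s), h x) ^ 2)
          = fun w => ((∫ x in Iic (w + s), h x) - ∫ x in Iic w, h x) ^ 2 := by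
        ext w
        rw [setIntegral_Icc_eq_sub hh (by linarith)]
      rw [this]
      exact ((hF.comp (continuous_id.add continuous_const)).sub hF).pow 2
  have hc : Continuous fun s => (∫ x in Iic (a + s), h x) - ∫ x in Iic a, h x :=
    (hF.comp (continuous_const.add continuous_id)).sub continuous_const
  have := Measure.eqOn_open_of_ae_eq hs isOpen_Ioi hc.continuousOn continuousOn_const
    (show b - a ∈ Ioi (0 : ℝ) from sub_pos.2 hab)
  simp only [add_sub_cancel] at this
  rw [setIntegral_Icc_eq_sub hh hab.le, this]

/-! ### Densities of admissible measures -/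

/-- Probability densities bounded by `1 / (2γ)`. -/
structure IsAdmissibleDensity (γ : ℝ) (f : ℝ → ℝ) : Prop where
  measurable : Measurable f
  nonneg : ∀ x, 0 ≤ f x
  le : ∀ x, f x ≤ 1 / (2 * γ)
  integral_eq_one : ∫ x, f x = 1

/-- The measure with density `f`. -/
def densityMeasure (f : ℝ → ℝ) : Measure ℝ := volume.withDensity fun x => ENNReal.ofReal (f x)

lemma IsAdmissibleDensity.integrable {γ : ℝ} {f : ℝ → ℝ} (hf : IsAdmissibleDensity γ f) :
    Integrable f := by
  have h := hf.integral_eq_one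
  by_contra h'
  rw [integral_undef h'] at h
  exact zero_ne_one h

lemma IsAdmissibleDensity.densityMeasure_apply {γ : ℝ} {f : ℝ → ℝ} (hf : IsAdmissibleDensity γ f)
    {S : Set ℝ} (hS : MeasurableSet S) : densityMeasure f S = ENNReal.ofReal (∫ x in S, f x) := by
  rw [densityMeasure, withDensity_apply _ hS,
    ofReal_integral_eq_lintegral_ofReal hf.integrable.integrableOn
      (Eventually.of_forall hf.nonneg)]

lemma IsAdmissibleDensity.mem_admissibleMeasures {γ : ℝ} {f : ℝ → ℝ}
    (hf : IsAdmissibleDensity γ f) : densityMeasure f ∈ admissibleMeasures γ := by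
  refine ⟨⟨?_⟩, fun a b hab => ?_⟩
  · rw [hf.densityMeasure_apply MeasurableSet.univ, Measure.restrict_univ, hf.integral_eq_one,
      ENNReal.ofReal_one]
  · rw [hf.densityMeasure_apply measurableSet_Ioo]
    refine ENNReal.ofReal_le_ofReal ?_
    have h := setIntegral_mono_on hf.integrable.integrableOn
      (integrableOn_const (C := 1 / (2 * γ)) (by simp)) measurableSet_Ioo
      fun x (_ : x ∈ Ioo a b) => hf.le x
    rw [setIntegral_const, smul_eq_mul, Real.volume_real_Ioo_of_le hab.le] at h
    rwa [mul_one_div] at h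

lemma measure_Ioc_le_of_mem_admissibleMeasures {γ : ℝ} {ν : Measure ℝ}
    (hν : ν ∈ admissibleMeasures γ) {a b : ℝ} (hab : a ≤ b) :
    ν (Ioc a b) ≤ ENNReal.ofReal ((b - a) / (2 * γ)) := by
  have hlim : Tendsto (fun ε : ℝ => ENNReal.ofReal ((b + ε - a) / (2 * γ))) (𝓝[>] 0)
      (𝓝 (ENNReal.ofReal ((b - a) / (2 * γ)))) := by
    have hc : Continuous fun ε : ℝ => ENNReal.ofReal ((b + ε - a) / (2 * γ)) :=
      ENNReal.continuous_ofReal.comp (by fun_prop)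
    have h := hc.tendsto 0
    rw [add_zero] at h
    exact h.mono_left nhdsWithin_le_nhds
  refine ge_of_tendsto hlim ?_
  filter_upwards [self_mem_nhdsWithin] with ε hε
  have hε : 0 < ε := hε
  have hsub : Ioc a b ⊆ Ioo a (b + ε) := fun x hx => ⟨hx.1, by linarith [hx.2]⟩
  exact (measure_mono hsub).trans
    (hν.2 a (b + ε) (by linarith))

/-- The interval bound says that `x / (2γ)` minus the distribution function is monotone, hence
itself a Stieltjes function. Its measure added to `ν` is a multiple of Lebesgue measure. -/
lemma le_smul_volume_of_mem_admissibleMeasures {γ : ℝ} (hγ : 0 < γ) {ν : Measure ℝ}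
    (hν : ν ∈ admissibleMeasures γ) :
    ν ≤ (Real.toNNReal (1 / (2 * γ))) • (volume : Measure ℝ) := by
  have := hν.1
  have hcdf : ∀ a b, a ≤ b → ProbabilityTheory.cdf ν b - ProbabilityTheory.cdf ν a
      ≤ 1 / (2 * γ) * b - 1 / (2 * γ) * a := by
    intro a b hab
    have h := measure_Ioc_le_of_mem_admissibleMeasures hν hab
    rw [← ProbabilityTheory.measure_cdf ν, StieltjesFunction.measure_Ioc] at h
    have hba : 0 ≤ b - a := by linarith
    rw [ENNReal.ofReal_le_ofReal_iff (by positivity)] at h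
    calc _ ≤ _ := h
      _ = _ := by ring
  let G : StieltjesFunction ℝ :=
    { toFun := fun x => 1 / (2 * γ) * x - ProbabilityTheory.cdf ν x
      mono' := fun a b hab => by linarith [hcdf a b hab]
      right_continuous' := fun x =>
        ((continuous_const.mul continuous_id).continuousWithinAt).sub
          ((ProbabilityTheory.cdf ν).right_continuous x) }
  have hsum : G + ProbabilityTheory.cdf ν
      = Real.toNNReal (1 / (2 * γ)) • StieltjesFunction.id := by
    ext x
    have h0 : 0 ≤ 1 / (2 * γ) := by positivity
    change 1 / (2 * γ) * x - ProbabilityTheory.cdf ν x + ProbabilityTheory.cdf ν x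
      = (Real.toNNReal (1 / (2 * γ)) : ℝ) * x
    rw [Real.coe_toNNReal _ h0]
    ring
  have hmeas := congrArg (fun F : StieltjesFunction ℝ => F.measure) hsum
  rw [StieltjesFunction.measure_add, ProbabilityTheory.measure_cdf, StieltjesFunction.measure_smul,
    ← Real.volume_eq_stieltjes_id] at hmeas
  rw [← hmeas]
  exact Measure.le_add_left le_rfl

lemma exists_density_of_mem_admissibleMeasures {γ : ℝ} (hγ : 0 < γ) {ν : Measure ℝ}
    (hν : ν ∈ admissibleMeasures γ) :
    ∃ f, IsAdmissibleDensity γ f ∧ ν = densityMeasure f := by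
  have := hν.1
  have h0 : 0 ≤ 1 / (2 * γ) := by positivity
  have hle := le_smul_volume_of_mem_admissibleMeasures hγ hν
  have hac : ν ≪ volume :=
    hle.absolutelyContinuous.trans (Measure.AbsolutelyContinuous.rfl.smul_left _)
  have hbound : ν.rnDeriv volume ≤ᵐ[volume] fun _ => ENNReal.ofReal (1 / (2 * γ)) := by
    refine ae_le_of_forall_setLIntegral_le_of_sigmaFinite (Measure.measurable_rnDeriv _ _)
      fun S hS _ => ?_
    rw [Measure.setLIntegral_rnDeriv hac, setLIntegral_const]
    exact (hle S).trans (le_of_eq rfl)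
  have hlt : ∀ᵐ x, ν.rnDeriv volume x < ⊤ := Measure.rnDeriv_lt_top _ _
  -- The Radon–Nikodym derivative is bounded only almost everywhere; the truncation makes the bound
  -- hold at every point.
  set f : ℝ → ℝ := fun x => min (ν.rnDeriv volume x).toReal (1 / (2 * γ)) with hf
  have hfm : Measurable f :=
    ((Measure.measurable_rnDeriv ν volume).ennreal_toReal).min measurable_const
  have hf0 : ∀ x, 0 ≤ f x := fun x => le_min ENNReal.toReal_nonneg h0
  have heq : ν = densityMeasure f := by
    conv_lhs => rw [← Measure.withDensity_rnDeriv_eq ν volume hac]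
    refine withDensity_congr_ae ?_
    filter_upwards [hbound, hlt] with x hx hx'
    have : (ν.rnDeriv volume x).toReal ≤ 1 / (2 * γ) := ENNReal.toReal_le_of_le_ofReal h0 hx
    rw [hf]
    simp only [min_eq_left this, ENNReal.ofReal_toReal hx'.ne]
  refine ⟨f, ⟨hfm, hf0, fun x => min_le_right _ _, ?_⟩, heq⟩
  have h1 : densityMeasure f univ = 1 := by rw [← heq]; exact measure_univ
  rw [densityMeasure, withDensity_apply _ MeasurableSet.univ, Measure.restrict_univ] at h1
  rw [integral_eq_lintegral_of_nonneg_ae (Eventually.of_forall hf0) hfm.aestronglyMeasurable, h1,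
    ENNReal.toReal_one]

/-! ### The energy of a density -/

lemma measurable_log_kernel : Measurable fun p : ℝ × ℝ => Real.log (1 / |p.1 - p.2|) := by
  fun_prop

/-- The kernel splits into an integrable singularity on `[-1, 1]`, handled by convolution with a
bounded density, and linear growth, handled by first moments. -/
lemma abs_log_inv_abs_le (t : ℝ) :
    |Real.log (1 / |t|)| ≤ (Icc (-1 : ℝ) 1).indicator (fun t => ‖Real.log |0 - t|‖) t + |t| := by
  rw [one_div, Real.log_inv, abs_neg]
  by_cases ht : t ∈ Icc (-1 : ℝ) 1
  · rw [indicator_of_mem ht, zero_sub, abs_neg, Real.norm_eq_abs]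
    linarith [abs_nonneg t]
  · rw [indicator_of_notMem ht, zero_add]
    have h1 : 1 ≤ |t| := by
      by_contra! h
      exact ht ⟨(abs_le.1 h.le).1, (abs_le.1 h.le).2⟩
    rw [abs_of_nonneg (Real.log_nonneg h1)]
    linarith [Real.log_le_sub_one_of_pos (show 0 < |t| by linarith)]

/-- Bounded densities with a first moment have finite mutual logarithmic energy. -/
lemma integrable_mul_mul_log {f g : ℝ → ℝ} {C : ℝ} (hf : Integrable f) (hfm : Measurable f)
    (hg : Integrable g) (hgm : Measurable g) (hC : ∀ x, |f x| ≤ C)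
    (hf1 : Integrable fun x => |x| * f x) (hg1 : Integrable fun x => |x| * g x) :
    Integrable fun p : ℝ × ℝ => f p.1 * g p.2 * Real.log (1 / |p.1 - p.2|) := by
  set k : ℝ → ℝ := (Icc (-1 : ℝ) 1).indicator fun t => ‖Real.log |0 - t|‖ with hk
  have hki : Integrable k := by
    rw [hk, integrable_indicator_iff measurableSet_Icc]
    exact (integrableOn_log_abs_sub 0 (-1) 1).norm
  have hk0 : ∀ t, 0 ≤ k t := fun t => indicator_nonneg (fun _ _ => norm_nonneg _) t
  have hconv : Integrable (fun p : ℝ × ℝ => |g p.2| * k (p.1 - p.2)) :=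
    Integrable.convolution_integrand (ContinuousLinearMap.mul ℝ ℝ) (μ := volume) (ν := volume)
      hg.abs hki
  have h1 : Integrable (fun p : ℝ × ℝ => C * (|g p.2| * k (p.1 - p.2))) := hconv.const_mul C
  have h2 : Integrable (fun p : ℝ × ℝ => ‖|p.1| * f p.1‖ * |g p.2|) := hf1.norm.mul_prod hg.abs
  have h3 : Integrable (fun p : ℝ × ℝ => |f p.1| * ‖|p.2| * g p.2‖) := hf.abs.mul_prod hg1.norm
  refine (h1.add (h2.add h3)).mono' ?_ (Eventually.of_forall fun p => ?_)
  · exact (((hfm.comp measurable_fst).mul (hgm.comp measurable_snd)).mul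
      measurable_log_kernel).aestronglyMeasurable
  · simp only [Pi.add_apply, norm_mul, Real.norm_eq_abs, abs_abs]
    have e1 := abs_log_inv_abs_le (p.1 - p.2)
    rw [← hk] at e1
    have e2 : |p.1 - p.2| ≤ |p.1| + |p.2| := abs_sub _ _
    have e3 := hk0 (p.1 - p.2)
    have e4 : |f p.1| * |g p.2| * |Real.log (1 / |p.1 - p.2|)|
        ≤ |f p.1| * |g p.2| * (k (p.1 - p.2) + (|p.1| + |p.2|)) := by
      gcongr
      linarith
    have e5 : |f p.1| * (|g p.2| * k (p.1 - p.2)) ≤ C * (|g p.2| * k (p.1 - p.2)) := by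
      gcongr
      exact hC p.1
    linarith

/-- The mutual logarithmic energy of two densities. -/
def logEnergy (f g : ℝ → ℝ) : ℝ := ∫ p : ℝ × ℝ, f p.1 * g p.2 * Real.log (1 / |p.1 - p.2|)

/-- The energy functional on densities. -/
def densityEnergy (ζ : ℝ) (f : ℝ → ℝ) : ℝ := logEnergy f f + ∫ x, f x * (|x| - ζ * x)

lemma integrable_densityMeasure_iff {f : ℝ → ℝ} (hfm : Measurable f) (hf : ∀ x, 0 ≤ f x)
    {g : ℝ → ℝ} : Integrable g (densityMeasure f) ↔ Integrable fun x => f x * g x := by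
  rw [densityMeasure, integrable_withDensity_iff_integrable_smul' hfm.ennreal_ofReal
    (Eventually.of_forall fun _ => ENNReal.ofReal_lt_top)]
  simp only [ENNReal.toReal_ofReal (hf _), smul_eq_mul]

lemma integral_densityMeasure {f : ℝ → ℝ} (hfm : Measurable f) (hf : ∀ x, 0 ≤ f x)
    (g : ℝ → ℝ) : ∫ x, g x ∂(densityMeasure f) = ∫ x, f x * g x := by
  rw [densityMeasure, integral_withDensity_eq_integral_toReal_smul hfm.ennreal_ofReal
    (Eventually.of_forall fun _ => ENNReal.ofReal_lt_top)]
  simp only [ENNReal.toReal_ofReal (hf _), smul_eq_mul]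

lemma densityMeasure_prod {f : ℝ → ℝ} (hfm : Measurable f) (hf : ∀ x, 0 ≤ f x) :
    (densityMeasure f).prod (densityMeasure f)
      = (volume : Measure (ℝ × ℝ)).withDensity fun p => ENNReal.ofReal (f p.1 * f p.2) := by
  rw [densityMeasure, prod_withDensity hfm.ennreal_ofReal hfm.ennreal_ofReal,
    ← Measure.volume_eq_prod]
  simp only [ENNReal.ofReal_mul (hf _)]

lemma energy_densityMeasure {γ ζ : ℝ} {f : ℝ → ℝ} (hf : IsAdmissibleDensity γ f)
    (hf1 : Integrable fun x => |x| * f x) :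
    energy ζ (densityMeasure f) = (densityEnergy ζ f : ℝ) := by
  have hfm := hf.measurable
  have hm2 : Measurable fun p : ℝ × ℝ => f p.1 * f p.2 :=
    (hfm.comp measurable_fst).mul (hfm.comp measurable_snd)
  have hlog := integrable_mul_mul_log (C := 1 / (2 * γ)) hf.integrable hfm hf.integrable hfm
    (fun x => by rw [abs_of_nonneg (hf.nonneg x)]; exact hf.le x) hf1 hf1
  have hp : ∀ p : ℝ × ℝ, 0 ≤ f p.1 * f p.2 := fun p => mul_nonneg (hf.nonneg _) (hf.nonneg _)
  have hI1 : Integrable (fun x : ℝ => |x| - ζ * x) (densityMeasure f) := by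
    rw [integrable_densityMeasure_iff hfm hf.nonneg]
    have hx : Integrable fun x => x * f x :=
      hf1.mono (measurable_id.mul hfm).aestronglyMeasurable
        (Eventually.of_forall fun x => by simp)
    refine (hf1.sub (hx.const_mul ζ)).congr (Eventually.of_forall fun x => ?_)
    simp only [Pi.sub_apply]
    ring
  have hI2 : Integrable (fun p : ℝ × ℝ => Real.log (1 / |p.1 - p.2|))
      ((densityMeasure f).prod (densityMeasure f)) := by
    rw [densityMeasure_prod hfm hf.nonneg,
      integrable_withDensity_iff_integrable_smul' hm2.ennreal_ofReal
        (Eventually.of_forall fun _ => ENNReal.ofReal_lt_top)]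
    simpa only [ENNReal.toReal_ofReal (hp _), smul_eq_mul] using hlog
  rw [energy, if_pos ⟨hI1, hI2.integrableOn⟩, densityEnergy, logEnergy,
    integral_densityMeasure hfm hf.nonneg, setIntegral_eq_integral_of_forall_compl_eq_zero,
    densityMeasure_prod hfm hf.nonneg,
    integral_withDensity_eq_integral_toReal_smul hm2.ennreal_ofReal
        (Eventually.of_forall fun _ => ENNReal.ofReal_lt_top)]
  · simp only [ENNReal.toReal_ofReal (hp _), smul_eq_mul]
  -- On the diagonal `log (1 / 0)` has the default value `0`, so restricting to `x ≠ y` changes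
  -- nothing.
  · intro p hp'
    have : p.1 = p.2 := by simpa using hp'
    simp [this]

/-- Since `|ζ| < 1`, the external field dominates `(1 - |ζ|) |x|`. Finite energy thus gives the
first moment needed by all energy computations. -/
lemma integrable_moment_of_energy_ne_top {γ ζ : ℝ} (hζ : ζ ∈ Ioo (-1 : ℝ) 1) {f : ℝ → ℝ}
    (hf : IsAdmissibleDensity γ f) (hE : energy ζ (densityMeasure f) ≠ ⊤) :
    Integrable fun x => |x| * f x := by
  have h : Integrable (fun x : ℝ => |x| - ζ * x) (densityMeasure f) := by
    by_contra h
    exact hE (by rw [energy, if_neg fun h' => h h'.1])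
  rw [integrable_densityMeasure_iff hf.measurable hf.nonneg] at h
  have hz : |ζ| < 1 := abs_lt.2 hζ
  refine (h.const_mul (1 / (1 - |ζ|))).mono'
    (continuous_abs.measurable.mul hf.measurable).aestronglyMeasurable
    (Eventually.of_forall fun x => ?_)
  have h0 := hf.nonneg x
  rw [Real.norm_of_nonneg (by positivity), one_div, ← div_eq_inv_mul,
    le_div_iff₀ (by linarith)]
  have h1 : ζ * x ≤ |ζ| * |x| := by rw [← abs_mul]; exact le_abs_self _
  nlinarith

/-- The energy splits into a quadratic part and a linear part. -/
lemma densityEnergy_sub {γ ζ : ℝ} {f g : ℝ → ℝ} (hf : IsAdmissibleDensity γ f)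
    (hg : IsAdmissibleDensity γ g) (hf1 : Integrable fun x => |x| * f x)
    (hg1 : Integrable fun x => |x| * g x) :
    Integrable (fun p : ℝ × ℝ =>
      (f p.1 - g p.1) * (f p.2 - g p.2) * Real.log (1 / |p.1 - p.2|)) ∧
    Integrable (fun x => (f x - g x) * effectivePotential ζ g x) ∧
    densityEnergy ζ f - densityEnergy ζ g
      = logEnergy (fun x => f x - g x) (fun x => f x - g x)
        + ∫ x, (f x - g x) * effectivePotential ζ g x := by
  have hlog : ∀ u v : ℝ → ℝ, IsAdmissibleDensity γ u → IsAdmissibleDensity γ v →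
      Integrable (fun x => |x| * u x) → Integrable (fun x => |x| * v x) →
      Integrable fun p : ℝ × ℝ => u p.1 * v p.2 * Real.log (1 / |p.1 - p.2|) := by
    intro u v hu hv hu1 hv1
    exact integrable_mul_mul_log (C := 1 / (2 * γ)) hu.integrable hu.measurable hv.integrable
      hv.measurable (fun x => by rw [abs_of_nonneg (hu.nonneg x)]; exact hu.le x) hu1 hv1
  have iff' := hlog f f hf hf hf1 hf1
  have ifg := hlog f g hf hg hf1 hg1
  have igf := hlog g f hg hf hg1 hf1
  have igg := hlog g g hg hg hg1 hg1
  have hV : ∀ u : ℝ → ℝ, IsAdmissibleDensity γ u → Integrable (fun x => |x| * u x) →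
      Integrable fun x => u x * (|x| - ζ * x) := by
    intro u hu hu1
    have hx : Integrable fun x => x * u x :=
      hu1.mono (measurable_id.mul hu.measurable).aestronglyMeasurable
        (Eventually.of_forall fun x => by simp)
    refine (hu1.sub (hx.const_mul ζ)).congr (Eventually.of_forall fun x => ?_)
    simp only [Pi.sub_apply]
    ring
  have hsymm : logEnergy g f = logEnergy f g := by
    rw [logEnergy, logEnergy, Measure.volume_eq_prod, ← integral_prod_swap]
    congr 1
    ext p
    simp only [Prod.fst_swap, Prod.snd_swap]
    rw [abs_sub_comm]
    ring
  have hhh : Integrable (fun p : ℝ × ℝ =>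
      (f p.1 - g p.1) * (f p.2 - g p.2) * Real.log (1 / |p.1 - p.2|)) := by
    refine ((iff'.sub ifg).sub (igf.sub igg)).congr (Eventually.of_forall fun p => ?_)
    simp only [Pi.sub_apply]
    ring
  have hhg : Integrable (fun p : ℝ × ℝ =>
      (f p.1 - g p.1) * g p.2 * Real.log (1 / |p.1 - p.2|)) := by
    refine (ifg.sub igg).congr (Eventually.of_forall fun p => ?_)
    simp only [Pi.sub_apply]
    ring
  have hquad : logEnergy (fun x => f x - g x) (fun x => f x - g x)
      = logEnergy f f - logEnergy f g - (logEnergy g f - logEnergy g g) := by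
    simp only [logEnergy]
    rw [← integral_sub iff' ifg, ← integral_sub igf igg]
    refine Eq.trans ?_ (integral_sub (iff'.sub ifg) (igf.sub igg))
    congr 1
    ext p
    ring
  have hU : ∀ x, ∫ y, (f x - g x) * g y * Real.log (1 / |x - y|)
      = (f x - g x) * logPotential g x := by
    intro x
    rw [logPotential, ← integral_const_mul]
    congr 1
    ext y
    ring
  have hUi : Integrable fun x => (f x - g x) * logPotential g x :=
    hhg.integral_prod_left.congr (Eventually.of_forall hU)
  have hcross : ∫ x, (f x - g x) * logPotential g x = logEnergy f g - logEnergy g g := by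
    rw [logEnergy, logEnergy, ← integral_sub ifg igg]
    have : ∫ p : ℝ × ℝ, (f p.1 - g p.1) * g p.2 * Real.log (1 / |p.1 - p.2|)
        = ∫ x, (f x - g x) * logPotential g x := by
      rw [Measure.volume_eq_prod, integral_prod _ hhg]
      exact integral_congr_ae (Eventually.of_forall hU)
    rw [← this]
    congr 1
    ext p
    ring
  have hVi : Integrable fun x => (f x - g x) * (|x| - ζ * x) := by
    refine ((hV f hf hf1).sub (hV g hg hg1)).congr (Eventually.of_forall fun x => ?_)
    simp only [Pi.sub_apply]
    ring
  have hVeq : ∫ x, (f x - g x) * (|x| - ζ * x)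
      = (∫ x, f x * (|x| - ζ * x)) - ∫ x, g x * (|x| - ζ * x) := by
    rw [← integral_sub (hV f hf hf1) (hV g hg hg1)]
    congr 1
    ext x
    ring
  have hsplit : (fun x => (f x - g x) * effectivePotential ζ g x)
      = fun x => 2 * ((f x - g x) * logPotential g x) + (f x - g x) * (|x| - ζ * x) := by
    ext x
    rw [effectivePotential]
    ring
  refine ⟨hhh, ?_, ?_⟩
  · rw [hsplit]
    exact (hUi.const_mul 2).add hVi
  · rw [hsplit, integral_add (hUi.const_mul 2) hVi, integral_const_mul, hcross, hVeq, hquad,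
      hsymm, densityEnergy, densityEnergy]
    ring

/-! ### The equilibrium measure -/

namespace IsMatched

variable {γ ζ α α' β' β : ℝ}

lemma isAdmissibleDensity (h : IsMatched γ ζ α α' β' β) :
    IsAdmissibleDensity γ (bandDensity α α' β' β) where
  measurable := (continuous_bandDensity h.left_lt h.gap_lt h.right_lt).measurable
  nonneg := bandDensity_nonneg α α' β' β
  le x := h.height ▸ bandDensity_le h.left_lt h.gap_lt h.right_lt x
  integral_eq_one := integral_bandDensity h.left_lt h.gap_lt h.right_lt

lemma integrable_moment (h : IsMatched γ ζ α α' β' β) :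
    Integrable fun x => |x| * bandDensity α α' β' β x := by
  have hi := integrable_mul_of_eq_zero_off (a := α) (b := β) (g := fun x => |x|)
    (continuous_bandDensity h.left_lt h.gap_lt h.right_lt)
    (fun _ hx => bandDensity_eq_zero fun h' => hx (Ioo_subset_Icc_self h'))
    continuous_abs.integrableOn_Icc
  simpa only [mul_comm] using hi

/-- The energy of any other density exceeds that of `bandDensity` by at least the logarithmic
energy of the difference. -/
lemma logEnergy_le_densityEnergy_sub (h : IsMatched γ ζ α α' β' β) (hζ : ζ ∈ Ioo (-1) 1)
    {f : ℝ → ℝ} (hf : IsAdmissibleDensity γ f) (hf1 : Integrable fun x => |x| * f x) :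
    logEnergy (fun x => f x - bandDensity α α' β' β x) (fun x => f x - bandDensity α α' β' β x)
      ≤ densityEnergy ζ f - densityEnergy ζ (bandDensity α α' β' β) := by
  have hρ := h.isAdmissibleDensity
  obtain ⟨-, hi, heq⟩ := densityEnergy_sub (ζ := ζ) hf hρ hf1 h.integrable_moment
  rw [heq, le_add_iff_nonneg_right]
  -- Both densities have mass `1`, so a constant may be subtracted from the effective potential.
  -- With its value on the bands, the integrand is nonnegative pointwise.
  set ℓ := effectivePotential ζ (bandDensity α α' β' β) β' with hℓ
  have hd : Integrable fun x => (f x - bandDensity α α' β' β x) * ℓ :=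
    (hf.integrable.sub hρ.integrable).mul_const ℓ
  have hd0 : ∫ x, (f x - bandDensity α α' β' β x) * ℓ = 0 := by
    rw [integral_mul_const, integral_sub hf.integrable hρ.integrable, hf.integral_eq_one,
      hρ.integral_eq_one]
    ring
  have hsub := integral_sub hi hd
  rw [hd0, sub_zero] at hsub
  rw [← hsub]
  refine integral_nonneg fun x => ?_
  have := h.euler_lagrange hζ (x := x) (hf.nonneg x) (hf.le x)
  rw [mul_sub] at this
  exact this

lemma integral_sub_bandDensity (h : IsMatched γ ζ α α' β' β) {f : ℝ → ℝ}
    (hf : IsAdmissibleDensity γ f) : ∫ x, (f x - bandDensity α α' β' β x) = 0 := by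
  rw [integral_sub hf.integrable h.isAdmissibleDensity.integrable, hf.integral_eq_one,
    h.isAdmissibleDensity.integral_eq_one, sub_self]

lemma densityEnergy_le (h : IsMatched γ ζ α α' β' β) (hζ : ζ ∈ Ioo (-1) 1)
    {f : ℝ → ℝ} (hf : IsAdmissibleDensity γ f) (hf1 : Integrable fun x => |x| * f x) :
    densityEnergy ζ (bandDensity α α' β' β) ≤ densityEnergy ζ f := by
  have hρ := h.isAdmissibleDensity
  have h1 := h.logEnergy_le_densityEnergy_sub hζ hf hf1
  have h2 := logEnergy_nonneg (hf.measurable.sub hρ.measurable) (hf.integrable.sub hρ.integrable)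
    (h.integral_sub_bandDensity hf) (densityEnergy_sub (ζ := ζ) hf hρ hf1 h.integrable_moment).1
  have h3 : 0 ≤ logEnergy (fun x => f x - bandDensity α α' β' β x)
    (fun x => f x - bandDensity α α' β' β x) := h2
  linarith

lemma densityMeasure_eq_of_densityEnergy_le (h : IsMatched γ ζ α α' β' β)
    (hζ : ζ ∈ Ioo (-1) 1) {f : ℝ → ℝ} (hf : IsAdmissibleDensity γ f)
    (hf1 : Integrable fun x => |x| * f x)
    (hle : densityEnergy ζ f ≤ densityEnergy ζ (bandDensity α α' β' β)) :
    densityMeasure f = densityMeasure (bandDensity α α' β' β) := by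
  have hρ := h.isAdmissibleDensity
  have hlog := (densityEnergy_sub (ζ := ζ) hf hρ hf1 h.integrable_moment).1
  have h0 := h.integral_sub_bandDensity hf
  have h1 := h.logEnergy_le_densityEnergy_sub hζ hf hf1
  have h2 : 0 ≤ logEnergy (fun x => f x - bandDensity α α' β' β x)
      (fun x => f x - bandDensity α α' β' β x) :=
    logEnergy_nonneg (hf.measurable.sub hρ.measurable) (hf.integrable.sub hρ.integrable) h0 hlog
  have hE : logEnergy (fun x => f x - bandDensity α α' β' β x)
      (fun x => f x - bandDensity α α' β' β x) = 0 := by linarith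
  have := (IsAdmissibleDensity.mem_admissibleMeasures hf).1
  refine Real.measure_ext_Ioo_rat fun a b => ?_
  rcases lt_or_ge (a : ℝ) b with hab | hab
  · have hz := setIntegral_eq_zero_of_logEnergy_eq_zero (hf.measurable.sub hρ.measurable)
      (hf.integrable.sub hρ.integrable) h0 hlog hE hab
    simp only [Pi.sub_apply] at hz
    rw [integral_sub hf.integrable.integrableOn hρ.integrable.integrableOn, sub_eq_zero,
      integral_Icc_eq_integral_Ioo, integral_Icc_eq_integral_Ioo] at hz
    rw [hf.densityMeasure_apply measurableSet_Ioo, hρ.densityMeasure_apply measurableSet_Ioo, hz]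
  · rw [Ioo_eq_empty hab.not_gt, measure_empty, measure_empty]

lemma isEquilibriumMeasure (h : IsMatched γ ζ α α' β' β) (hγ : 0 < γ) (hζ : ζ ∈ Ioo (-1) 1) :
    IsEquilibriumMeasure γ ζ (densityMeasure (bandDensity α α' β' β)) := by
  refine ⟨h.isAdmissibleDensity.mem_admissibleMeasures, fun ν hν => ?_⟩
  obtain ⟨f, hf, rfl⟩ := exists_density_of_mem_admissibleMeasures hγ hν
  change energy ζ _ ≤ energy ζ _
  by_cases hE : energy ζ (densityMeasure f) = ⊤
  · rw [hE]; exact le_top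
  · have hf1 := integrable_moment_of_energy_ne_top hζ hf hE
    rw [energy_densityMeasure h.isAdmissibleDensity h.integrable_moment,
      energy_densityMeasure hf hf1, EReal.coe_le_coe_iff]
    exact h.densityEnergy_le hζ hf hf1

lemma eq_of_isEquilibriumMeasure (h : IsMatched γ ζ α α' β' β) (hγ : 0 < γ)
    (hζ : ζ ∈ Ioo (-1) 1) {ν : Measure ℝ} (hν : IsEquilibriumMeasure γ ζ ν) :
    ν = densityMeasure (bandDensity α α' β' β) := by
  obtain ⟨f, hf, rfl⟩ := exists_density_of_mem_admissibleMeasures hγ hν.1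
  have hle : energy ζ (densityMeasure f) ≤ energy ζ (densityMeasure (bandDensity α α' β' β)) :=
    hν.2 h.isAdmissibleDensity.mem_admissibleMeasures
  rw [energy_densityMeasure h.isAdmissibleDensity h.integrable_moment] at hle
  have hf1 := integrable_moment_of_energy_ne_top hζ hf
    (ne_top_of_le_ne_top (EReal.coe_ne_top _) hle)
  rw [energy_densityMeasure hf hf1, EReal.coe_le_coe_iff] at hle
  exact h.densityMeasure_eq_of_densityEnergy_le hζ hf hf1 hle

/-! ### Balance of the masses on the two half-lines -/

/-- A translate of the density is an admissible competitor with the same logarithmic energy, so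
minimality reduces to the external field. -/
lemma densityEnergy_translate (h : IsMatched γ ζ α α' β' β) (hζ : ζ ∈ Ioo (-1) 1) (s : ℝ) :
    ∫ x, bandDensity α α' β' β x * (|x| - ζ * x)
      ≤ ∫ x, bandDensity α α' β' β x * (|x + s| - ζ * (x + s)) := by
  set ρ := bandDensity α α' β' β with hρdef
  have hρ := h.isAdmissibleDensity
  have hf : IsAdmissibleDensity γ (fun x => ρ (x - s)) :=
    ⟨hρ.measurable.comp (measurable_id.sub_const s), fun x => hρ.nonneg _, fun x => hρ.le _,
      by rw [integral_sub_right_eq_self ρ s]; exact hρ.integral_eq_one⟩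
  have hf1 : Integrable fun x => |x| * ρ (x - s) := by
    have h1 : Integrable fun x => |x + s| * ρ x := by
      refine ((h.integrable_moment).add (hρ.integrable.const_mul |s|)).mono'
        ((continuous_abs.measurable.comp (measurable_id.add_const s)).mul
          hρ.measurable).aestronglyMeasurable (Eventually.of_forall fun x => ?_)
      have h0 := hρ.nonneg x
      rw [Real.norm_of_nonneg (mul_nonneg (abs_nonneg _) h0), Pi.add_apply, ← add_mul]
      exact mul_le_mul_of_nonneg_right (abs_add_le x s) h0
    simpa using h1.comp_sub_right s
  have hle := h.densityEnergy_le hζ hf hf1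
  have hlog : logEnergy (fun x => ρ (x - s)) (fun x => ρ (x - s)) = logEnergy ρ ρ := by
    rw [logEnergy, logEnergy, ← integral_sub_right_eq_self
      (fun p : ℝ × ℝ => ρ p.1 * ρ p.2 * Real.log (1 / |p.1 - p.2|)) (s, s)]
    simp
  have hV : ∫ x, ρ (x - s) * (|x| - ζ * x) = ∫ x, ρ x * (|x + s| - ζ * (x + s)) := by
    rw [← integral_add_right_eq_self (fun x => ρ (x - s) * (|x| - ζ * x)) s]
    simp
  rw [densityEnergy, densityEnergy, hlog, hV] at hle
  linarith

/-- This is the first-order condition at `s = 0` for the translation inequality. The kink of `|x +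
s|` at `s = 0` affects only `x = 0`, a null set, and the Lipschitz constant `1 + |ζ|` gives the
domination. -/
lemma integral_mul_sign (h : IsMatched γ ζ α α' β' β) (hζ : ζ ∈ Ioo (-1) 1) :
    ∫ x, bandDensity α α' β' β x * (SignType.sign x - ζ) = 0 := by
  have hρ := h.isAdmissibleDensity
  have hi0 : Integrable fun x => bandDensity α α' β' β x * (|x + 0| - ζ * (x + 0)) := by
    have hx : Integrable fun x => x * bandDensity α α' β' β x :=
      h.integrable_moment.mono (measurable_id.mul hρ.measurable).aestronglyMeasurable
        (Eventually.of_forall fun x => by simp)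
    refine (h.integrable_moment.sub (hx.const_mul ζ)).congr (Eventually.of_forall fun x => ?_)
    simp only [Pi.sub_apply, add_zero]
    ring
  have hsign : Measurable fun x : ℝ => ((SignType.sign x : SignType) : ℝ) := by
    have : (fun x : ℝ => ((SignType.sign x : SignType) : ℝ))
        = fun x => if 0 < x then 1 else if x < 0 then -1 else 0 := by
      ext x
      rw [sign_apply]
      split_ifs <;> simp
    rw [this]
    exact Measurable.ite measurableSet_Ioi measurable_const
      (Measurable.ite measurableSet_Iio measurable_const measurable_const)
  have hderiv := (hasDerivAt_integral_of_dominated_loc_of_lip (μ := volume) (x₀ := (0 : ℝ))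
    (F := fun s x => bandDensity α α' β' β x * (|x + s| - ζ * (x + s)))
    (F' := fun x => bandDensity α α' β' β x * (SignType.sign x - ζ))
    (bound := fun x => bandDensity α α' β' β x * (1 + |ζ|)) univ_mem ?_ hi0 ?_ ?_ ?_ ?_).2
  · refine IsLocalMin.hasDerivAt_eq_zero (Eventually.of_forall fun s => ?_) hderiv
    simpa using h.densityEnergy_translate hζ s
  · refine Eventually.of_forall fun s => (hρ.measurable.mul ?_).aestronglyMeasurable
    fun_prop
  · exact (hρ.measurable.mul (hsign.sub_const ζ)).aestronglyMeasurable
  · refine Eventually.of_forall fun x => LipschitzOnWith.of_dist_le_mul fun s _ t _ => ?_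
    have h0 := hρ.nonneg x
    rw [Real.coe_nnabs, abs_of_nonneg
      (show 0 ≤ bandDensity α α' β' β x * (1 + |ζ|) from mul_nonneg h0 (by positivity)),
      Real.dist_eq, Real.dist_eq, ← mul_sub,
      abs_mul, abs_of_nonneg h0, mul_assoc]
    refine mul_le_mul_of_nonneg_left ?_ h0
    have e1 : |(|x + s| - |x + t|)| ≤ |s - t| := by
      refine (abs_abs_sub_abs_le _ _).trans (le_of_eq ?_)
      congr 1; ring
    calc _ = |(|x + s| - |x + t|) - ζ * (s - t)| := by congr 1; ring
      _ ≤ |(|x + s| - |x + t|)| + |ζ * (s - t)| := abs_sub _ _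
      _ ≤ (1 + |ζ|) * |s - t| := by rw [abs_mul]; linarith
  · exact hρ.integrable.mul_const _
  · have hne : ∀ᵐ x : ℝ, x ≠ 0 := compl_mem_ae_iff.2 (measure_singleton 0)
    filter_upwards [hne] with x hx
    have h1 : HasDerivAt (fun s : ℝ => x + s) 1 0 := (hasDerivAt_id 0).const_add x
    have h2 : HasDerivAt (fun s : ℝ => |x + s|) (SignType.sign x : ℝ) 0 := by
      have := HasDerivAt.comp (0 : ℝ) (h₂ := fun y : ℝ => |y|)
        (by rw [add_zero]; exact hasDerivAt_abs hx) h1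
      rw [mul_one] at this
      exact this
    have h3 := (h2.sub (h1.const_mul ζ)).const_mul (bandDensity α α' β' β x)
    rw [mul_one] at h3
    exact h3

/-- Almost everywhere the sign is `2 · 1_{x > 0} - 1`. The stationarity condition then reads: twice
the right mass equals `1 + ζ`. -/
lemma integral_right_mass (h : IsMatched γ ζ α α' β' β) (hζ : ζ ∈ Ioo (-1) 1) :
    ∫ x in (0 : ℝ)..β, bandDensity α α' β' β x = (1 + ζ) / 2 := by
  have hρ := h.isAdmissibleDensity
  have hβ : 0 < β := (h.zero_mem_gap hζ).2.trans h.right_lt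
  have h0 := h.integral_mul_sign hζ
  have hIoi : ∫ x in Ioi 0, bandDensity α α' β' β x
      = ∫ x in (0 : ℝ)..β, bandDensity α α' β' β x := by
    rw [intervalIntegral.integral_of_le hβ.le]
    refine setIntegral_eq_of_subset_of_forall_sdiff_eq_zero measurableSet_Ioi Ioc_subset_Ioi_self
      fun x hx => bandDensity_eq_zero fun h' => hx.2 ⟨hx.1, h'.2.le⟩
  have hsplit : ∀ᵐ x : ℝ, bandDensity α α' β' β x * (SignType.sign x - ζ)
      = 2 * (Ioi 0).indicator (bandDensity α α' β' β) x
        - (1 + ζ) * bandDensity α α' β' β x := by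
    have hne : ∀ᵐ x : ℝ, x ≠ 0 := compl_mem_ae_iff.2 (measure_singleton 0)
    filter_upwards [hne] with x hx
    rcases lt_or_gt_of_ne hx with hx | hx
    · rw [sign_neg hx, indicator_of_notMem (show x ∉ Ioi 0 from hx.not_gt)]
      simp; ring
    · rw [sign_pos hx, indicator_of_mem (show x ∈ Ioi 0 from hx)]
      simp; ring
  rw [integral_congr_ae hsplit,
    integral_sub ((hρ.integrable.indicator measurableSet_Ioi).const_mul 2)
      (hρ.integrable.const_mul _), integral_const_mul, integral_const_mul,
    integral_indicator measurableSet_Ioi, hρ.integral_eq_one, hIoi] at h0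
  linarith

lemma support_densityMeasure (h : IsMatched γ ζ α α' β' β) :
    (densityMeasure (bandDensity α α' β' β)).support = Icc α β := by
  have hρ := h.isAdmissibleDensity
  have hαβ : α < β := h.left_lt.trans (h.gap_lt.trans h.right_lt)
  apply Subset.antisymm
  · intro x hx
    by_contra hx'
    refine Measure.notMem_support_iff_exists.2
      ⟨(Icc α β)ᶜ, isClosed_Icc.isOpen_compl.mem_nhds hx', ?_⟩ hx
    rw [hρ.densityMeasure_apply measurableSet_Icc.compl,
      setIntegral_eq_zero_of_forall_eq_zero, ENNReal.ofReal_zero]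
    exact fun y hy => bandDensity_eq_zero fun h' => hy (Ioo_subset_Icc_self h')
  · rw [← closure_Ioo hαβ.ne]
    refine closure_minimal (fun x hx => ?_) Measure.isClosed_support
    rw [Measure.mem_support_iff_forall]
    intro U hU
    obtain ⟨ε, hε, hball⟩ := Metric.mem_nhds_iff.1 (inter_mem hU (isOpen_Ioo.mem_nhds hx))
    refine lt_of_lt_of_le ?_ (measure_mono (hball.trans inter_subset_left))
    rw [Real.ball_eq_Ioo, hρ.densityMeasure_apply measurableSet_Ioo, ENNReal.ofReal_pos,
      ← integral_Ioc_eq_integral_Ioo, ← intervalIntegral.integral_of_le (by linarith)]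
    refine intervalIntegral.intervalIntegral_pos_of_pos_on
      hρ.integrable.intervalIntegrable (fun y hy => ?_) (by linarith)
    rw [← Real.ball_eq_Ioo] at hy
    exact bandDensity_pos h.left_lt h.gap_lt h.right_lt (hball hy).2

end IsMatched

end

/-! ### Assembly of the proposition -/

theorem proposition2p2 (γ t ζ : ℝ) (ht : |t| < γ) (hζ : ζ = t / γ) :
    (∃! ν : Measure ℝ, IsEquilibriumMeasure γ ζ ν) ∧
    ∀ ν : Measure ℝ, IsEquilibriumMeasure γ ζ ν →
      ∃ (ρ : ℝ → ℝ) (α α' β' β : ℝ) (sqrtR : ℂ → ℂ),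
        -- `ρ` is the (continuous) density of the equilibrium measure
        Continuous ρ ∧ (∀ x, 0 ≤ ρ x) ∧
        ν = volume.withDensity (fun x => ENNReal.ofReal (ρ x)) ∧
        -- `[α, β]` is the support and `[α', β']` the saturated region
        α < α' ∧ α' < 0 ∧ 0 < β' ∧ β' < β ∧
        ν.support = Icc α β ∧
        {x | ρ x = 1 / (2 * γ)} = Icc α' β' ∧
        (∀ x ∈ Ioo α α' ∪ Ioo β' β, 0 < ρ x ∧ ρ x < 1 / (2 * γ)) ∧
        -- the density
        (∀ x ∈ Icc α α', ρ x = 1 / Real.pi *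
          ∫ y in α..x, 1 / Real.sqrt ((y - α) * (α' - y) * (β' - y) * (β - y))) ∧
        (∀ x ∈ Icc α' β', ρ x = 1 / (2 * γ)) ∧
        (∀ x ∈ Icc β' β, ρ x = 1 / Real.pi *
          ∫ y in x..β, 1 / Real.sqrt ((y - α) * (y - α') * (y - β') * (β - y))) ∧
        (∀ x, x ∉ Icc α β → ρ x = 0) ∧
        (∫ x in (0 : ℝ)..β, ρ x) = (1 + ζ) / 2 ∧
        -- the resolvent
        IsSqrtSheet α α' β' β sqrtR ∧
        ∀ z : ℂ, z ∉ realSegment α β →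
          IntegralToInfinityEq (realSegment α β)ᶜ (fun w => 1 / sqrtR w) z (measureResolvent ν z) := by
  have hγ : 0 < γ := (abs_nonneg t).trans_lt ht
  have hζ' : ζ ∈ Ioo (-1) 1 := by
    rw [hζ, mem_Ioo, ← abs_lt, abs_div, abs_of_pos hγ]
    exact (div_lt_one hγ).2 ht
  obtain ⟨α, α', β', β, h⟩ := exists_isMatched hγ hζ'
  obtain ⟨h₁, h₂, h₃⟩ := And.intro h.left_lt (And.intro h.gap_lt h.right_lt)
  have hcont := continuous_bandDensity h₁ h₂ h₃
  refine ⟨⟨_, h.isEquilibriumMeasure hγ hζ', fun ν hν => h.eq_of_isEquilibriumMeasure hγ hζ' hν⟩,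
    fun ν hν => ?_⟩
  obtain rfl := h.eq_of_isEquilibriumMeasure hγ hζ' hν
  refine ⟨bandDensity α α' β' β, α, α', β', β, quarticSqrt α α' β' β, hcont,
    bandDensity_nonneg α α' β' β, rfl, h₁, (h.zero_mem_gap hζ').1, (h.zero_mem_gap hζ').2, h₃,
    h.support_densityMeasure, ?_, ?_, fun x hx => bandDensity_left h₁ h₂ h₃ hx, ?_,
    fun x hx => bandDensity_right h₁ h₂ h₃ hx, ?_, h.integral_right_mass hζ',
    isSqrtSheet_quarticSqrt h₁ h₂ h₃, fun z hz => ?_⟩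
  · rw [← h.height]
    exact setOf_bandDensity_eq_height h₁ h₂ h₃
  · rw [← h.height]
    rintro x (hx | hx)
    · exact bandDensity_mem_of_left h₁ h₂ h₃ hx
    · exact bandDensity_mem_of_right h₁ h₂ h₃ hx
  · rw [← h.height]
    exact fun x hx => bandDensity_eq_height hx
  · exact fun x hx => bandDensity_eq_zero fun hx' => hx (Ioo_subset_Icc_self hx')
  · rw [densityMeasure, measureResolvent_withDensity hcont.measurable
      (bandDensity_nonneg α α' β' β)]
    exact integralToInfinityEq_stieltjes_bandDensity h₁ h₂ h₃ hz
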